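/- Let $N$ be an even positive integer, let $m$ be any integer, and let $\alpha,\beta>0$ satisfy $\alpha\beta^{N}=\pi^{N+1}$. Then the infinite series below converge absolutely, and \begin{align*} &\alpha^{-\frac{2Nm-1}{N+1}}\left(\frac12\,\zeta(2Nm)+\sum_{n=1}^{\infty}\frac{n^{-2Nm}}{\exp\left((2n)^{N}\alpha\right)-1}\right)\\ &=\beta^{-\frac{2Nm-1}{N+1}}\,\frac{(-1)^m}{N}\,2^{(N-1)\left(2m-\frac1N\right)}\Bigg(\frac{\zeta\left(2m+1-\frac1N\right)}{2\cos\left(\frac{\pi}{2N}\right)}\\ &\qquad-2(-1)^{\frac N2}\sum_{j=0}^{\frac N2-1}(-1)^j\sum_{n=1}^{\infty}\frac{1}{n^{2m+1-\frac1N}}\,\mathrm{Im}\left(\frac{e^{\frac{i\pi(2j+1)}{2N}}}{\exp\left((2n)^{\frac1N}\beta e^{\frac{i\pi(2j+1)}{2N}}\right)-1}\right)\Bigg)\\ &\quad+(-1)^{\frac N2+1}\,2^{2Nm-1}\sum_{j=0}^{m}\frac{B_{2j}\,B_{(2m+1-2j)N}}{(2j)!\,((2m+1-2j)N)!}\,\alpha^{\frac{2j}{N+1}}\,\beta^{N+\frac{2N^2(m-j)-N}{N+1}},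 \end{align*} where $\zeta$ is the (analytically continued) Riemann zeta function, $B_k$ are the Bernoulli numbers, given by $\frac{x}{e^x-1}=\sum_{k\ge 0}B_k\frac{x^k}{k!}$ for $|x|<2\pi$, and the last sum is empty (equal to $0$) when $m<0$. -/

import Mathlib

/-- The `n`-th term `n ^ (-2Nm) / (exp ((2n) ^ N α) - 1)` of the generalized Lambert series
with argument `α`. -/
noncomputable def lambertTerm (N : ℕ) (m : ℤ) (α : ℝ) (n : ℕ+) : ℝ :=
  (n : ℝ) ^ (-2 * (N : ℤ) * m) / (Real.exp ((2 * (n : ℝ)) ^ N * α) - 1)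

/-- The point `exp (iπ(2j+1)/(2N))` of the unit circle. -/
noncomputable def unitRotation (N j : ℕ) : ℂ :=
  Complex.exp (Complex.I * (Real.pi : ℂ) * (2 * (j : ℂ) + 1) / (2 * (N : ℂ)))

/-- The `n`-th term `n ^ (-(2m+1-1/N)) Im (w / (exp ((2n) ^ (1/N) β w) - 1))` of the rotated
Lambert series, with `w = exp (iπ(2j+1)/(2N))`. -/
noncomputable def rotatedLambertTerm (N : ℕ) (m : ℤ) (β : ℝ) (j : ℕ) (n : ℕ+) : ℝ :=
  1 / (n : ℝ) ^ (2 * (m : ℝ) + 1 - 1 / (N : ℝ)) *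
    (unitRotation N j /
      (Complex.exp ((((2 * (n : ℝ)) ^ (1 / (N : ℝ)) : ℝ) : ℂ) * (β : ℂ) * unitRotation N j)
        - 1)).im

/-- The finite sum over `0 ≤ j ≤ m` (empty when `m < 0`) of
`B_{2j} B_{(2m+1-2j)N} / ((2j)! ((2m+1-2j)N)!) α ^ (2j/(N+1)) β ^ (N + (2N²(m-j)-N)/(N+1))`.
The integer `(2m+1-2j)N` is nonnegative for every `j` in the range. -/
noncomputable def bernoulliSum (N : ℕ) (m : ℤ) (α β : ℝ) : ℝ :=
  ∑ j ∈ Finset.range (m + 1).toNat,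
    ((bernoulli (2 * j) : ℚ) : ℝ) *
        ((bernoulli ((2 * m + 1 - 2 * (j : ℤ)) * (N : ℤ)).toNat : ℚ) : ℝ) /
      ((Nat.factorial (2 * j) : ℝ) *
        (Nat.factorial ((2 * m + 1 - 2 * (j : ℤ)) * (N : ℤ)).toNat : ℝ)) *
      α ^ (2 * (j : ℝ) / ((N : ℝ) + 1)) *
      β ^ ((N : ℝ) + (2 * (N : ℝ) ^ 2 * ((m : ℝ) - (j : ℝ)) - (N : ℝ)) / ((N : ℝ) + 1))

section

open Complex Filter Topology MeasureTheory Set FourierTransform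

/-! Put `A = 2 ^ N α`, so that `(2n) ^ N α = A n ^ N`. The theorem is then a transformation formula
in the single parameter `A` (`lambert_identity`). The relation between `α` and `β` serves only to
rewrite powers of `π` and the rotated arguments at the end.

For `m > 0`, expand `1 / (exp x - 1) = 1/x - 1/2 + ∑ 2x / (x² + 4π²k²)` at `x = A n ^ N` and
interchange the sums over `n` and `k`, which is legitimate because all terms are nonnegative. For
fixed `k`, the weight `n ^ (-2Nm)` is removed step by step, each step costing a zeta value
(`weightedCauchySum_eq`). The sum left over, `cauchySum`, is a rational function of `n²`. Its poles
are `-b² w²` with `w = exp (iπ(2j+1)/(2N))`, and the same Bose expansion, now read in `n`, sums the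
partial fractions (`cauchySum_eq`). Products of zeta values give the Bernoulli sum.

For `m = -μ ≤ 0` that double series is no longer summable, and Poisson summation replaces it. The
slowly decaying part of `cauchySum` scales like `A ^ (-1/N)`, so it cancels in a combination of the
dilates `A` and `2A`. Poisson summation of what remains does not give the formula itself, but shows
that its defect `D` satisfies `A ^ (2μ) D(A) = 2 ^ (1/N) (2A) ^ (2μ) D(2A)`
(`lambertDefect_dilate`). Hence `δ ^ (2Nμ+1) D(δ ^ N)` is invariant under `δ ↦ 2 ^ (-1/N) δ`, and it
vanishes as soon as it tends to `0` with `δ` (`lambertDefect_eq_zero`). In that limit the Lambert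
series is a Riemann sum for a Mellin integral of the Bose function, equal to `Γ(s) ζ(s) / N` at `s =
2μ + 1/N`. The functional equation of `ζ` matches this with the `ζ(1 - s)` term
(`tendsto_lambertDefect`). -/

/-! ### The Bose function: geometric series, decay and partial fractions. -/

/-- The Bose–Einstein function `1 / (exp z - 1)`. -/
noncomputable def bose (z : ℂ) : ℂ := 1 / (Complex.exp z - 1)

lemma exp_sub_one_ne_zero_of_re_pos {z : ℂ} (hz : 0 < z.re) : Complex.exp z - 1 ≠ 0 := by
  intro h
  have h1 : ‖Complex.exp z‖ = 1 := by rw [sub_eq_zero.mp h]; simp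
  rw [Complex.norm_exp, Real.exp_eq_one_iff] at h1
  exact hz.ne' h1

lemma bose_hasSum_geometric {z : ℂ} (hz : 0 < z.re) :
    HasSum (fun r : ℕ+ ↦ Complex.exp (-(r : ℂ) * z)) (bose z) := by
  have hlt : ‖Complex.exp (-z)‖ < 1 := by
    rw [Complex.norm_exp, Real.exp_lt_one_iff]; simpa using hz
  have h := (hasSum_geometric_of_norm_lt_one hlt).mul_left (Complex.exp (-z))
  have e : Complex.exp (-z) * (1 - Complex.exp (-z))⁻¹ = bose z := by
    have := exp_sub_one_ne_zero_of_re_pos hz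
    have h2 : Complex.exp z ≠ 0 := Complex.exp_ne_zero z
    rw [bose, Complex.exp_neg, one_div]
    field_simp
  rw [e] at h
  rw [← Equiv.pnatEquivNat.symm.hasSum_iff]
  convert! h using 1
  funext n
  simp only [Function.comp, Equiv.pnatEquivNat_symm_apply]
  rw [← Complex.exp_nat_mul, ← Complex.exp_add]
  congr 1
  simp [Nat.succPNat]
  ring

/-- Keep only the terms of degree `0` and `p` in the exponential series. The case `p = 1` controls
the pole at the origin, and large `p` gives arbitrary polynomial decay at infinity. -/
lemma norm_bose_le {z : ℂ} (hz : 0 < z.re) {p : ℕ} (hp : p ≠ 0) :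
    ‖bose z‖ ≤ p.factorial / z.re ^ p := by
  have h1 : z.re ^ p / p.factorial ≤ Real.exp z.re - 1 := by
    have h := Real.sum_le_exp_of_nonneg hz.le (p + 1)
    have h2 : ∑ i ∈ ({0, p} : Finset ℕ), z.re ^ i / i.factorial ≤
        ∑ i ∈ Finset.range (p + 1), z.re ^ i / (i.factorial : ℝ) := by
      apply Finset.sum_le_sum_of_subset_of_nonneg
      · intro i hi; simp at hi; simp; omega
      · intros; positivity
    rw [Finset.sum_pair (Ne.symm hp)] at h2
    simp at h2
    linarith
  have h3 : Real.exp z.re - 1 ≤ ‖Complex.exp z - 1‖ := by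
    have := norm_sub_norm_le (Complex.exp z) 1
    rwa [Complex.norm_exp, norm_one] at this
  have h4 : 0 < z.re ^ p / p.factorial := by positivity
  rw [bose, norm_div, norm_one, ← one_div_div (z.re ^ p)]
  exact one_div_le_one_div_of_le h4 (h1.trans h3)

/-- This is the cotangent series at `z = ix/(2π)`, which is not an integer because `Re x > 0` makes
`Im z` positive. -/
lemma bose_hasSum_partialFraction {x : ℂ} (hx : 0 < x.re) :
    HasSum (fun k : ℕ+ ↦ 2 * x / (x ^ 2 + (2 * Real.pi * (k : ℂ)) ^ 2))
      (bose x - 1 / x + 1 / 2) := by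
  have hpi : (Real.pi : ℂ) ≠ 0 := by exact_mod_cast Real.pi_ne_zero
  have hx0 : x ≠ 0 := by rintro rfl; simp at hx
  set z : ℂ := I * x / (2 * Real.pi) with hzdef
  have hzim : z.im = x.re / (2 * Real.pi) := by
    have : z = ((1 / (2 * Real.pi) : ℝ) : ℂ) * (I * x) := by
      rw [hzdef]; push_cast; ring
    rw [this, Complex.im_ofReal_mul]; simp; ring
  have hz : z ∈ Complex.integerComplement := by
    rintro ⟨n, hn⟩
    have : z.im = 0 := by rw [← hn]; simp
    rw [hzim] at this
    have h2 : 0 < x.re / (2 * Real.pi) := by positivity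
    linarith
  have hne : ∀ k : ℕ+, x ^ 2 + (2 * Real.pi * (k : ℂ)) ^ 2 ≠ 0 := by
    intro k h
    have : (x - 2 * Real.pi * k * I) * (x + 2 * Real.pi * k * I) = 0 := by
      linear_combination h - (2 * Real.pi * (k : ℂ)) ^ 2 * I_sq
    rcases mul_eq_zero.mp this with h | h
    · have := congrArg Complex.re h; simp at this; linarith
    · have := congrArg Complex.re h; simp at this; linarith
  have hterm : ∀ k : ℕ+, 1 / (z - k) + 1 / (z + k) =
      (-2 * Real.pi * I) * (2 * x / (x ^ 2 + (2 * Real.pi * (k : ℂ)) ^ 2)) := by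
    intro k
    have h1 : z - k ≠ 0 := by
      intro h
      exact hz ⟨k, by push_cast; exact (sub_eq_zero.mp h).symm⟩
    have h2 : z + k ≠ 0 := by
      intro h
      exact hz ⟨-k, by push_cast; exact (eq_neg_of_add_eq_zero_left h).symm⟩
    have h3 : (z - k) * (z + k) = -(x ^ 2 + (2 * Real.pi * (k : ℂ)) ^ 2) / (2 * Real.pi) ^ 2 := by
      rw [hzdef]; field_simp; linear_combination x ^ 2 * I_sq
    have h4 : 1 / (z - k) + 1 / (z + k) = 2 * z / ((z - k) * (z + k)) := by
      field_simp; ring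
    rw [h4, h3, hzdef]
    have := hne k
    field_simp
  have hsum : Summable fun k : ℕ+ ↦ 2 * x / (x ^ 2 + (2 * Real.pi * (k : ℂ)) ^ 2) := by
    have h := summable_cotTerm hz
    have h' : Summable fun k : ℕ+ ↦ 1 / (z - k) + 1 / (z + k) := by
      rw [summable_pnat_iff_summable_succ (f := fun k : ℕ ↦ 1 / (z - k) + 1 / (z + k))]
      convert! h using 1
      funext n
      simp [cotTerm]
    simp_rw [hterm] at h'
    exact (summable_mul_left_iff (by simp [hpi])).mp h'
  have hcot := cot_series_rep hz
  simp_rw [hterm] at hcot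
  rw [tsum_mul_left, cot_eq_exp_ratio] at hcot
  have hE : Complex.exp (2 * I * (Real.pi * z)) = (Complex.exp x)⁻¹ := by
    rw [← Complex.exp_neg]; congr 1; rw [hzdef]; field_simp; linear_combination I_sq
  rw [hE] at hcot
  convert! hsum.hasSum using 1
  have h1 := exp_sub_one_ne_zero_of_re_pos hx
  have h2 := Complex.exp_ne_zero x
  have h5 : 1 - (Complex.exp x)⁻¹ ≠ 0 := by
    intro h; apply h1; field_simp at h; simpa using h
  set T := ∑' k : ℕ+, 2 * x / (x ^ 2 + (2 * Real.pi * (k : ℂ)) ^ 2)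
  have h6 : (((Complex.exp x)⁻¹ + 1) / (I * (1 - (Complex.exp x)⁻¹))) = -I * (1 + 2 * bose x) := by
    rw [bose]
    field_simp
    linear_combination (1 + Complex.exp x) * I_sq
  rw [h6, hzdef] at hcot
  field_simp at hcot
  rw [I_sq] at hcot
  field_simp
  linear_combination hcot

/-! ### The rotation points and partial fractions over them. -/

/-- The alternating sum of `Im (w φ (2πbw))` over `w = exp (iπ(2j+1)/(2N))`, with `φ = bose`. -/
noncomputable def rotatedBoseSum (N : ℕ) (b : ℝ) : ℝ :=
  ∑ j ∈ Finset.range (N / 2),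
    (-1) ^ j * (unitRotation N j * bose (2 * Real.pi * b * unitRotation N j)).im

/-- The alternating sum of the imaginary parts of the points `exp (iπ(2j+1)/(2N))`. -/
noncomputable def rotationImSum (N : ℕ) : ℝ :=
  ∑ j ∈ Finset.range (N / 2), (-1) ^ j * (unitRotation N j).im

lemma unitRotation_eq (N j : ℕ) :
    unitRotation N j = Complex.exp (((Real.pi * (2 * j + 1) / (2 * N) : ℝ) : ℂ) * I) := by
  rw [unitRotation]; congr 1; push_cast; ring

lemma norm_unitRotation (N j : ℕ) : ‖unitRotation N j‖ = 1 := by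
  rw [unitRotation_eq, Complex.norm_exp_ofReal_mul_I]

lemma unitRotation_ne_zero (N j : ℕ) : unitRotation N j ≠ 0 := Complex.exp_ne_zero _

lemma unitRotation_re (N j : ℕ) :
    (unitRotation N j).re = Real.cos (Real.pi * (2 * j + 1) / (2 * N)) := by
  rw [unitRotation_eq, Complex.exp_ofReal_mul_I_re]

lemma unitRotation_im (N j : ℕ) :
    (unitRotation N j).im = Real.sin (Real.pi * (2 * j + 1) / (2 * N)) := by
  rw [unitRotation_eq, Complex.exp_ofReal_mul_I_im]

lemma unitRotation_angle_lt {N j : ℕ} (hj : j < N / 2) :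
    Real.pi * (2 * j + 1) / (2 * N) < Real.pi / 2 := by
  have hN : (0 : ℝ) < N := by
    have : 0 < N := by omega
    exact_mod_cast this
  rw [div_lt_div_iff₀ (by positivity) two_pos]
  have : (2 * (j : ℝ) + 1) < N := by exact_mod_cast (by omega : 2 * j + 1 < N)
  nlinarith [Real.pi_pos]

lemma unitRotation_angle_pos {N j : ℕ} (hj : j < N / 2) :
    0 < Real.pi * (2 * j + 1) / (2 * N) := by
  have hN : (0 : ℝ) < N := by
    have : 0 < N := by omega
    exact_mod_cast this
  have := Real.pi_pos
  positivity

lemma unitRotation_re_pos {N j : ℕ} (hj : j < N / 2) : 0 < (unitRotation N j).re := by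
  rw [unitRotation_re]
  apply Real.cos_pos_of_mem_Ioo
  have := unitRotation_angle_lt hj
  have := unitRotation_angle_pos hj
  constructor <;> linarith [Real.pi_pos]

lemma unitRotation_pow_self {N : ℕ} (hN : N ≠ 0) (j : ℕ) :
    unitRotation N j ^ N = I * (-1) ^ j := by
  have hN' : (N : ℂ) ≠ 0 := by exact_mod_cast hN
  rw [unitRotation, ← Complex.exp_nat_mul]
  have : (N : ℂ) * (I * Real.pi * (2 * (j : ℂ) + 1) / (2 * N)) =
      Real.pi / 2 * I + j * (Real.pi * I) := by field_simp; ring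
  rw [this, Complex.exp_add, Complex.exp_nat_mul, Complex.exp_pi_mul_I, Complex.exp_pi_div_two_mul_I]

/-- The angle `θ` becomes `π - θ`. This pairing folds a sum over all `N` points into imaginary parts
over the half with positive real part. -/
lemma unitRotation_reflect {N j : ℕ} (hj : j < N) :
    unitRotation N (N - 1 - j) = -(starRingEnd ℂ) (unitRotation N j) := by
  have hN' : (N : ℂ) ≠ 0 := by exact_mod_cast (by omega : N ≠ 0)
  rw [unitRotation, unitRotation, ← Complex.exp_conj, ← neg_one_mul, ← Complex.exp_pi_mul_I,
    ← Complex.exp_add]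
  congr 1
  have hc : ((N - 1 - j : ℕ) : ℂ) = N - 1 - j := by
    rw [Nat.cast_sub (by omega), Nat.cast_sub (by omega)]; simp
  rw [hc]
  simp only [map_div₀, map_mul, map_add, Complex.conj_I, Complex.conj_ofReal, map_one, map_ofNat,
    map_natCast]
  field_simp
  ring

/-- The squares form one coset of the `N`-th roots of unity, so orthogonality applies. -/
lemma sum_unitRotation_sq_pow {N : ℕ} (hN : N ≠ 0) {k : ℕ} (hk : ¬ N ∣ k) :
    ∑ l ∈ Finset.range N, (unitRotation N l ^ 2) ^ k = 0 := by
  have hN' : (N : ℂ) ≠ 0 := by exact_mod_cast hN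
  have hprim := Complex.isPrimitiveRoot_exp N hN
  set η := Complex.exp (2 * Real.pi * I / N)
  have h1 : ∀ l : ℕ, (unitRotation N l ^ 2) ^ k = (unitRotation N 0 ^ 2) ^ k * (η ^ k) ^ l := by
    intro l
    rw [← pow_mul, ← pow_mul, ← pow_mul, unitRotation, unitRotation, ← Complex.exp_nat_mul,
      ← Complex.exp_nat_mul, ← Complex.exp_nat_mul, ← Complex.exp_add]
    congr 1
    push_cast
    field_simp
    ring
  rw [Finset.sum_congr rfl fun l _ ↦ h1 l]
  rw [← Finset.mul_sum]
  have h2 : η ^ k ≠ 1 := fun h ↦ hk ((hprim.pow_eq_one_iff_dvd k).mp h)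
  have h3 := mul_neg_geom_sum (η ^ k) N
  rw [← pow_mul, mul_comm k N, pow_mul, hprim.pow_eq_one, one_pow, sub_self] at h3
  rw [(mul_eq_zero.mp h3).resolve_left (sub_ne_zero.mpr h2.symm), mul_zero]

lemma sum_range_two_mul_reflect {R : Type*} [AddCommMonoid R] (f : ℕ → R) (M : ℕ) :
    ∑ l ∈ Finset.range (2 * M), f l = ∑ j ∈ Finset.range M, (f j + f (2 * M - 1 - j)) := by
  rw [two_mul, Finset.sum_range_add, Finset.sum_add_distrib]
  congr 1
  rw [← Finset.sum_range_reflect]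
  apply Finset.sum_congr rfl
  intro j hj
  rw [Finset.mem_range] at hj
  congr 1
  omega

lemma rotation_denominator_ne_zero {N j : ℕ} (hj : j < N / 2) {b x : ℝ} (hb : 0 < b) :
    (x : ℂ) ^ 2 + b ^ 2 * unitRotation N j ^ 2 ≠ 0 := by
  intro h
  have hre := unitRotation_re_pos hj
  have : (b * unitRotation N j - x * I) * (b * unitRotation N j + x * I) = 0 := by
    linear_combination h - (x : ℂ) ^ 2 * I_sq
  rcases mul_eq_zero.mp this with h | h
  · have := congrArg Complex.re h
    simp at this
    rcases this with h | h <;> linarith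
  · have := congrArg Complex.re h
    simp at this
    rcases this with h | h <;> linarith

/-- The numbers `σ l = -b² w_l²` satisfy `σ ^ (2M) = -b ^ (4M)`, so `1 / (x² - σ l)` is a finite
geometric sum over the common denominator. With weights `σ l ^ (M+1)`, orthogonality keeps only the
power `x ^ (2M)`. Since `w_l ^ (2M) = i (-1) ^ l`, these weights are, up to a constant, `(-1) ^ l
w_l²`. -/
lemma partialFraction_complex {M : ℕ} (hM : M ≠ 0) {b x : ℝ} (hb : 0 < b) :
    ((x : ℂ) ^ (2 * M) / (x ^ (2 * (2 * M)) + b ^ (2 * (2 * M)))) =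
      (-1) ^ M * I * b ^ 2 / ((2 * M) * b ^ (2 * M)) * ∑ l ∈ Finset.range (2 * M),
        (-1) ^ l * (unitRotation (2 * M) l ^ 2 / (x ^ 2 + b ^ 2 * unitRotation (2 * M) l ^ 2)) := by
  have hN : 2 * M ≠ 0 := by omega
  have hbC : (b : ℂ) ≠ 0 := by exact_mod_cast hb.ne'
  have hMC : (M : ℂ) ≠ 0 := by exact_mod_cast hM
  set w : ℕ → ℂ := unitRotation (2 * M) with hw
  set σ : ℕ → ℂ := fun l ↦ -(b ^ 2 * w l ^ 2) with hσ
  have hden : (x : ℂ) ^ (2 * (2 * M)) + b ^ (2 * (2 * M)) ≠ 0 := by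
    have : (0 : ℝ) < x ^ (2 * (2 * M)) + b ^ (2 * (2 * M)) := by
      have := (even_two_mul (2 * M)).pow_nonneg x
      positivity
    exact_mod_cast this.ne'
  have hwN : ∀ l, w l ^ (2 * M) = I * (-1) ^ l := unitRotation_pow_self hN
  have hσN : ∀ l, σ l ^ (2 * M) = -b ^ (2 * (2 * M)) := by
    intro l
    rw [hσ]
    simp only
    rw [(even_two_mul M).neg_pow, mul_pow, ← pow_mul, pow_right_comm, hwN, mul_pow, I_sq,
      ← pow_mul, mul_comm l 2, pow_mul]
    norm_num
  have hne : ∀ l, (x : ℂ) ^ 2 - σ l ≠ 0 := by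
    intro l h
    have h1 : (x : ℂ) ^ 2 = σ l := sub_eq_zero.mp h
    have h2 := congrArg (· ^ (2 * M)) h1
    simp only [hσN, ← pow_mul] at h2
    exact hden (by rw [h2]; ring)
  have hgeom : ∀ l, 1 / ((x : ℂ) ^ 2 - σ l) =
      (∑ i ∈ Finset.range (2 * M), ((x : ℂ) ^ 2) ^ (2 * M - 1 - i) * σ l ^ i) /
        (x ^ (2 * (2 * M)) + b ^ (2 * (2 * M))) := by
    intro l
    have h := (Commute.all ((x : ℂ) ^ 2) (σ l)).geom_sum₂_mul (2 * M)
    rw [hσN, ← pow_mul] at h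
    have h' : (x : ℂ) ^ (2 * (2 * M)) + b ^ (2 * (2 * M)) = _ := (sub_neg_eq_add _ _).symm.trans h.symm
    rw [div_eq_div_iff (hne l) hden, one_mul, h', ← Finset.sum_range_reflect]
    congr 1
    apply Finset.sum_congr rfl
    intro i hi
    rw [Finset.mem_range] at hi
    congr 2
    omega
  have hpow : ∀ l, σ l ^ (M + 1) = (-1) ^ (M + 1) * b ^ (2 * M) * b ^ 2 * I * ((-1) ^ l * w l ^ 2) := by
    intro l
    have : σ l ^ (M + 1) = (-1) ^ (M + 1) * b ^ (2 * M) * b ^ 2 * (w l ^ (2 * M) * w l ^ 2) := by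
      rw [hσ]; simp only; ring
    rw [this, hwN]; ring
  have hkey : ∑ l ∈ Finset.range (2 * M), σ l ^ (M + 1) * (1 / ((x : ℂ) ^ 2 - σ l)) =
      2 * (M : ℂ) * (-(b : ℂ) ^ (2 * (2 * M))) * (x : ℂ) ^ (2 * M) / ((x : ℂ) ^ (2 * (2 * M)) + b ^ (2 * (2 * M))) := by
    simp_rw [hgeom, mul_div_assoc']
    rw [← Finset.sum_div]
    congr 1
    simp_rw [Finset.mul_sum]
    rw [Finset.sum_comm, Finset.sum_eq_single (M - 1)]
    · have e : ∀ l ∈ Finset.range (2 * M), σ l ^ (M + 1) *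
          (((x : ℂ) ^ 2) ^ (2 * M - 1 - (M - 1)) * σ l ^ (M - 1)) =
          -(b : ℂ) ^ (2 * (2 * M)) * x ^ (2 * M) := by
        intro l _
        have e1 : 2 * M - 1 - (M - 1) = M := by omega
        have e2 : M + 1 + (M - 1) = 2 * M := by omega
        rw [e1, mul_left_comm, ← pow_add, e2, hσN, ← pow_mul]
        ring
      rw [Finset.sum_congr rfl e]
      simp
      ring
    · intro i hi hiM
      rw [Finset.mem_range] at hi
      have e : ∀ l ∈ Finset.range (2 * M), σ l ^ (M + 1) *
          (((x : ℂ) ^ 2) ^ (2 * M - 1 - i) * σ l ^ i) =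
          ((x : ℂ) ^ 2) ^ (2 * M - 1 - i) * (-b ^ 2) ^ (M + 1 + i) * (w l ^ 2) ^ (M + 1 + i) := by
        intro l _
        have : σ l ^ (M + 1) * σ l ^ i = (-b ^ 2) ^ (M + 1 + i) * (w l ^ 2) ^ (M + 1 + i) := by
          rw [← pow_add, ← mul_pow, hσ]; simp only; ring
        linear_combination ((x : ℂ) ^ 2) ^ (2 * M - 1 - i) * this
      rw [Finset.sum_congr rfl e, ← Finset.mul_sum, sum_unitRotation_sq_pow hN, mul_zero]
      -- The exponent `M + 1 + i` lies between `M + 1` and `3M`, so the only multiple of `2M` it can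
      -- equal is `2M` itself, at `i = M - 1`.
      rintro ⟨c, hc⟩
      have : c < 2 := by
        by_contra h
        push Not at h
        have : 2 * M * 2 ≤ 2 * M * c := Nat.mul_le_mul_left _ h
        omega
      interval_cases c <;> omega
    · intro h
      exact absurd (Finset.mem_range.mpr (by omega)) h
  have hkey2 : ∑ l ∈ Finset.range (2 * M), σ l ^ (M + 1) * (1 / ((x : ℂ) ^ 2 - σ l)) =
      (-1) ^ (M + 1) * b ^ (2 * M) * b ^ 2 * I * ∑ l ∈ Finset.range (2 * M),
        (-1) ^ l * (w l ^ 2 / (x ^ 2 + b ^ 2 * w l ^ 2)) := by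
    rw [Finset.mul_sum]
    apply Finset.sum_congr rfl
    intro l _
    rw [hpow]
    have : (x : ℂ) ^ 2 - σ l = x ^ 2 + b ^ 2 * w l ^ 2 := by rw [hσ]; simp only; ring
    rw [this]
    ring
  rw [hkey2] at hkey
  have hb4 : (b : ℂ) ^ (2 * (2 * M)) = b ^ (2 * M) * b ^ (2 * M) := by rw [← pow_add]; ring_nf
  set T := ∑ l ∈ Finset.range (2 * M), (-1) ^ l * (w l ^ 2 / ((x : ℂ) ^ 2 + b ^ 2 * w l ^ 2))
  have hbM : (b : ℂ) ^ (2 * M) ≠ 0 := pow_ne_zero _ hbC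
  have : (2 * M * b ^ (2 * M)) * ((x : ℂ) ^ (2 * M) / (x ^ (2 * (2 * M)) + b ^ (2 * (2 * M)))) =
      (-1) ^ M * I * b ^ 2 * T := by
    apply mul_left_cancel₀ hbM
    rw [pow_succ (-1 : ℂ) M] at hkey
    rw [hb4] at hkey ⊢
    linear_combination hkey
  rw [div_mul_eq_mul_div, ← this]
  field_simp

/-- Under `l ↦ 2M - 1 - l` the quotient is conjugated and the sign `(-1) ^ l` flips, so each pair
contributes `q - conj q = 2i Im q`. -/
lemma partialFraction_real {N : ℕ} (hN : 0 < N) (hNe : Even N) {b : ℝ} (hb : 0 < b) (x : ℝ) :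
    x ^ N / (x ^ (2 * N) + b ^ (2 * N)) =
      -(2 * (-1) ^ (N / 2) * b ^ 2 / (N * b ^ N)) * ∑ j ∈ Finset.range (N / 2),
        (-1) ^ j * (unitRotation N j ^ 2 / ((x : ℂ) ^ 2 + b ^ 2 * unitRotation N j ^ 2)).im := by
  obtain ⟨M, hM⟩ := hNe
  have hM2 : N = 2 * M := by omega
  have hM0 : M ≠ 0 := by omega
  have hdiv : N / 2 = M := by omega
  subst hM2
  rw [hdiv]
  have h := partialFraction_complex hM0 (x := x) hb
  rw [sum_range_two_mul_reflect] at h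
  have e : ∀ j ∈ Finset.range M,
      ((-1 : ℂ) ^ j * (unitRotation (2 * M) j ^ 2 /
        ((x : ℂ) ^ 2 + b ^ 2 * unitRotation (2 * M) j ^ 2)) +
      (-1) ^ (2 * M - 1 - j) * (unitRotation (2 * M) (2 * M - 1 - j) ^ 2 /
        (x ^ 2 + b ^ 2 * unitRotation (2 * M) (2 * M - 1 - j) ^ 2))) =
      2 * I * (((-1) ^ j * (unitRotation (2 * M) j ^ 2 /
        ((x : ℂ) ^ 2 + b ^ 2 * unitRotation (2 * M) j ^ 2)).im : ℝ) : ℂ) := by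
    intro j hj
    rw [Finset.mem_range] at hj
    rw [unitRotation_reflect (by omega : j < 2 * M)]
    set q := unitRotation (2 * M) j ^ 2 / ((x : ℂ) ^ 2 + b ^ 2 * unitRotation (2 * M) j ^ 2) with hq
    have hcq : (-(starRingEnd ℂ) (unitRotation (2 * M) j)) ^ 2 /
        ((x : ℂ) ^ 2 + b ^ 2 * (-(starRingEnd ℂ) (unitRotation (2 * M) j)) ^ 2) =
        (starRingEnd ℂ) q := by
      rw [hq]; simp
    have hs : (-1 : ℂ) ^ (2 * M - 1 - j) = -(-1) ^ j := by
      have h1 : (-1 : ℂ) ^ (2 * M - 1 - j) * (-1) ^ (j + 1) = 1 := by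
        rw [← pow_add, show 2 * M - 1 - j + (j + 1) = 2 * M by omega, pow_mul]; simp
      have h2 : ((-1 : ℂ) ^ j) * (-1) ^ j = 1 := by
        rw [← pow_add, ← two_mul, pow_mul]; simp
      rw [pow_succ] at h1
      linear_combination (-(-1 : ℂ) ^ j) * h1 - ((-1 : ℂ) ^ (2 * M - 1 - j)) * h2
    rw [hcq, hs]
    have := Complex.sub_conj q
    push_cast at this ⊢
    linear_combination (-1 : ℂ) ^ j * this
  rw [Finset.sum_congr rfl e, ← Finset.mul_sum, ← Complex.ofReal_sum] at h
  apply Complex.ofReal_injective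
  push_cast
  rw [h]
  push_cast
  linear_combination (2 * (-1 : ℂ) ^ M * b ^ 2 / (2 * M * b ^ (2 * M)) *
    (∑ j ∈ Finset.range M, (-1 : ℂ) ^ j * (((unitRotation (2 * M) j ^ 2 /
      ((x : ℂ) ^ 2 + b ^ 2 * unitRotation (2 * M) j ^ 2)).im : ℝ) : ℂ))) * I_sq

/-- The Bose expansion again, at `x = 2πbw`, with `n` as the summation index of its poles. -/
lemma hasSum_rotation_quotient {N j : ℕ} (hj : j < N / 2) {b : ℝ} (hb : 0 < b) :
    HasSum (fun n : ℕ+ ↦ unitRotation N j ^ 2 / (((n : ℝ) : ℂ) ^ 2 + b ^ 2 * unitRotation N j ^ 2))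
      (Real.pi / b * (unitRotation N j * bose (2 * Real.pi * b * unitRotation N j)
        + unitRotation N j / 2) - 1 / (2 * b ^ 2)) := by
  have hpi : (Real.pi : ℂ) ≠ 0 := by exact_mod_cast Real.pi_ne_zero
  have hbC : (b : ℂ) ≠ 0 := by exact_mod_cast hb.ne'
  set w := unitRotation N j with hw
  have hw0 : w ≠ 0 := unitRotation_ne_zero N j
  have hre : 0 < (2 * Real.pi * b * w).re := by
    have : (2 * Real.pi * b * w : ℂ) = ((2 * Real.pi * b : ℝ) : ℂ) * w := by push_cast; ring
    rw [this, Complex.re_ofReal_mul]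
    have := unitRotation_re_pos hj
    have := Real.pi_pos
    positivity
  have h := (bose_hasSum_partialFraction hre).mul_left (Real.pi * w / b)
  convert! h using 1
  · funext n
    have h1 : ((n : ℝ) : ℂ) ^ 2 + b ^ 2 * w ^ 2 ≠ 0 := rotation_denominator_ne_zero hj hb
    have h2 : (2 * Real.pi * b * w) ^ 2 + (2 * Real.pi * (n : ℂ)) ^ 2 =
      (2 * Real.pi) ^ 2 * (((n : ℝ) : ℂ) ^ 2 + b ^ 2 * w ^ 2) := by push_cast; ring
    rw [h2]
    field_simp
  · field_simp
    ring

/-- Writing the second parameter as `A b ^ N` keeps `N`-th roots out of the computation;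
`cauchySum_eq` substitutes `b = (2πy/A) ^ (1/N)` afterwards. -/
lemma cauchySum_hasSum_aux {N : ℕ} (hN : 0 < N) (hNe : Even N) {A b : ℝ} (hA : 0 < A)
    (hb : 0 < b) :
    HasSum (fun n : ℕ+ ↦ 2 * A * (n : ℝ) ^ N / (A ^ 2 * (n : ℝ) ^ (2 * N) + (A * b ^ N) ^ 2))
      (-(4 * Real.pi * (-1) ^ (N / 2) / N) * (b / (A * b ^ N)) *
        (rotatedBoseSum N b + rotationImSum N / 2)) := by
  have hterm : ∀ n : ℕ+, 2 * A * (n : ℝ) ^ N / (A ^ 2 * (n : ℝ) ^ (2 * N) + (A * b ^ N) ^ 2) =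
      (2 / A) * (-(2 * (-1) ^ (N / 2) * b ^ 2 / (N * b ^ N)) * ∑ j ∈ Finset.range (N / 2),
        (-1) ^ j * (unitRotation N j ^ 2 /
          ((((n : ℝ) : ℝ) : ℂ) ^ 2 + b ^ 2 * unitRotation N j ^ 2)).im) := by
    intro n
    rw [← partialFraction_real hN hNe hb]
    have : A ^ 2 * (n : ℝ) ^ (2 * N) + (A * b ^ N) ^ 2 =
        A ^ 2 * ((n : ℝ) ^ (2 * N) + b ^ (2 * N)) := by ring
    rw [this]
    have : (0 : ℝ) < (n : ℝ) ^ (2 * N) + b ^ (2 * N) := by positivity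
    field_simp
  simp_rw [hterm]
  have hsum : HasSum (fun n : ℕ+ ↦ ∑ j ∈ Finset.range (N / 2),
        (-1) ^ j * (unitRotation N j ^ 2 /
          ((((n : ℝ) : ℝ) : ℂ) ^ 2 + b ^ 2 * unitRotation N j ^ 2)).im)
        (∑ j ∈ Finset.range (N / 2), (-1) ^ j * (Real.pi / b *
          ((unitRotation N j * bose (2 * Real.pi * b * unitRotation N j)).im +
            (unitRotation N j).im / 2))) := by
    apply hasSum_sum
    intro j hj
    apply HasSum.mul_left
    have h := Complex.hasSum_im (hasSum_rotation_quotient (Finset.mem_range.mp hj) hb)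
    convert! h using 1
    -- The term `1 / (2b²)` is real and drops out of the imaginary part.
    have e : (Real.pi / b * (unitRotation N j * bose (2 * Real.pi * b * unitRotation N j)
        + unitRotation N j / 2) - 1 / (2 * b ^ 2) : ℂ) =
        ((Real.pi / b : ℝ) : ℂ) * (unitRotation N j * bose (2 * Real.pi * b * unitRotation N j)
        + ((1 / 2 : ℝ) : ℂ) * unitRotation N j) - ((1 / (2 * b ^ 2) : ℝ) : ℂ) := by
      push_cast; ring
    rw [e, Complex.sub_im, Complex.im_ofReal_mul, Complex.add_im, Complex.im_ofReal_mul,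
      Complex.ofReal_im]
    ring
  have h2 := (hsum.mul_left (-(2 * (-1) ^ (N / 2) * b ^ 2 / (N * b ^ N)))).mul_left (2 / A)
  convert! h2 using 1
  have e : ∑ j ∈ Finset.range (N / 2), (-1) ^ j * (Real.pi / b *
          ((unitRotation N j * bose (2 * Real.pi * b * unitRotation N j)).im +
            (unitRotation N j).im / 2)) =
      Real.pi / b * (rotatedBoseSum N b + rotationImSum N / 2) := by
    rw [rotatedBoseSum, rotationImSum, Finset.sum_div, ← Finset.sum_add_distrib, Finset.mul_sum]
    apply Finset.sum_congr rfl
    intros; ring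
  rw [e]
  field_simp
  ring

/-! ### Evaluation of the Cauchy sums. -/

/-- The sum `∑ 2 A n ^ N / (A ^ 2 n ^ (2N) + (2πy) ^ 2)` over the positive integers. -/
noncomputable def cauchySum (N : ℕ) (A y : ℝ) : ℝ :=
  ∑' n : ℕ+, 2 * A * (n : ℝ) ^ N / (A ^ 2 * (n : ℝ) ^ (2 * N) + (2 * Real.pi * y) ^ 2)

lemma cauchySum_eq {N : ℕ} (hN : 0 < N) (hNe : Even N) {A y : ℝ} (hA : 0 < A) (hy : 0 < y) :
    cauchySum N A y = -(4 * Real.pi * (-1) ^ (N / 2) / N) * A ^ (-(1 / N : ℝ)) *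
      (2 * Real.pi * y) ^ ((1 / N : ℝ) - 1) *
        (rotatedBoseSum N ((2 * Real.pi * y / A) ^ (1 / N : ℝ)) + rotationImSum N / 2) := by
  have hpi := Real.pi_pos
  have hY : 0 < 2 * Real.pi * y := by positivity
  have hb : 0 < (2 * Real.pi * y / A) ^ (1 / N : ℝ) := by positivity
  have h := (cauchySum_hasSum_aux hN hNe hA hb).tsum_eq
  have hbN : A * ((2 * Real.pi * y / A) ^ (1 / N : ℝ)) ^ N = 2 * Real.pi * y := by
    rw [one_div, Real.rpow_inv_natCast_pow (by positivity) hN.ne']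
    field_simp
  rw [hbN] at h
  rw [cauchySum, h]
  congr 1
  rw [mul_assoc _ (A ^ _)]
  congr 1
  rw [Real.div_rpow hY.le hA.le, Real.rpow_neg hA.le, Real.rpow_sub hY, Real.rpow_one]
  field_simp

/-- With `x = π/(2N)`, the identity `2 sin((2K+1)x) cos x = sin((2K+2)x) + sin(2Kx)` makes the
alternating sum telescope, and `2Kx = π/2` at `K = N/2`. This is the source of the cosine in the
theorem. -/
lemma rotationImSum_eq {N : ℕ} (hN : 0 < N) (hNe : Even N) :
    rotationImSum N = -(-1) ^ (N / 2) / (2 * Real.cos (Real.pi / (2 * N))) := by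
  obtain ⟨M, hM⟩ := hNe
  have hM2 : N = 2 * M := by omega
  have hNR : (0 : ℝ) < N := by exact_mod_cast hN
  have hdiv : N / 2 = M := by omega
  set x := Real.pi / (2 * N) with hx
  have hcos : 0 < Real.cos x := by
    apply Real.cos_pos_of_mem_Ioo
    have h1 : 0 < x := by have := Real.pi_pos; positivity
    have h2 : x < Real.pi / 2 := by
      rw [hx]; apply div_lt_div_of_pos_left Real.pi_pos two_pos
      have : (1 : ℝ) < N := by exact_mod_cast (by omega : 1 < N)
      linarith
    constructor <;> linarith
  have hsum : ∀ K : ℕ, (∑ j ∈ Finset.range K, (-1) ^ j * (unitRotation N j).im) *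
      (2 * Real.cos x) = -(-1) ^ K * Real.sin (2 * K * x) := by
    intro K
    induction K with
    | zero => simp
    | succ K ih =>
      rw [Finset.sum_range_succ, add_mul, ih, unitRotation_im]
      have e1 : Real.pi * (2 * K + 1) / (2 * N) = 2 * K * x + x := by rw [hx]; field_simp
      have e2 : 2 * ((K + 1 : ℕ) : ℝ) * x = (2 * K * x + x) + x := by push_cast; ring
      have e3 : Real.sin (2 * K * x) = Real.sin ((2 * K * x + x) - x) := by ring_nf
      rw [e1, e2, e3, Real.sin_add (2 * K * x + x) x, Real.sin_sub (2 * K * x + x) x]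
      ring
  rw [eq_div_iff (by positivity), rotationImSum, hdiv, hsum M]
  have : 2 * (M : ℝ) * x = Real.pi / 2 := by
    rw [hx, hM2]; push_cast
    have : (M : ℝ) ≠ 0 := by
      have : M ≠ 0 := by omega
      exact_mod_cast this
    field_simp
  rw [this, Real.sin_pi_div_two, mul_one]

/-! ### Zeta values as real series, decay estimates and summability. -/

lemma summable_pnat_rpow_neg {s : ℝ} (hs : 1 < s) : Summable fun n : ℕ+ ↦ (n : ℝ) ^ (-s) :=
  (Real.summable_nat_rpow.mpr (by linarith : -s < -1)).comp_injective PNat.coe_injective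

lemma summable_pnat_pow_inv {s : ℕ} (hs : 1 < s) : Summable fun n : ℕ+ ↦ ((n : ℝ) ^ s)⁻¹ :=
  (Real.summable_nat_pow_inv.mpr hs).comp_injective PNat.coe_injective

lemma riemannZeta_ofReal_eq_tsum_pnat {s : ℝ} (hs : 1 < s) :
    riemannZeta (s : ℂ) = ((∑' n : ℕ+, (n : ℝ) ^ (-s) : ℝ) : ℂ) := by
  rw [zeta_eq_tsum_one_div_nat_add_one_cpow (by simpa using hs),
    tsum_pnat_eq_tsum_succ (f := fun n : ℕ ↦ (n : ℝ) ^ (-s)), Complex.ofReal_tsum]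
  congr 1
  funext n
  rw [Complex.ofReal_cpow (by positivity)]
  push_cast
  rw [Complex.cpow_neg, one_div]

lemma riemannZeta_natCast_eq_tsum_pnat {s : ℕ} (hs : 1 < s) :
    riemannZeta (s : ℂ) = ((∑' n : ℕ+, ((n : ℝ) ^ s)⁻¹ : ℝ) : ℂ) := by
  have h := riemannZeta_ofReal_eq_tsum_pnat (s := s) (by exact_mod_cast hs)
  simp_rw [Real.rpow_neg (Nat.cast_nonneg _), Real.rpow_natCast] at h
  exact_mod_cast h

lemma abs_rotatedBoseSum_le (N : ℕ) {p : ℕ} (hp : p ≠ 0) :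
    ∃ C : ℝ, 0 ≤ C ∧ ∀ b : ℝ, 0 < b → |rotatedBoseSum N b| ≤ C / b ^ p := by
  refine ⟨∑ j ∈ Finset.range (N / 2), p.factorial / (2 * Real.pi * (unitRotation N j).re) ^ p,
    Finset.sum_nonneg fun j hj ↦ ?_, fun b hb ↦ ?_⟩
  · have := unitRotation_re_pos (Finset.mem_range.mp hj)
    have := Real.pi_pos
    positivity
  · rw [Finset.sum_div]
    refine (Finset.abs_sum_le_sum_abs _ _).trans (Finset.sum_le_sum fun j hj ↦ ?_)
    have hre := unitRotation_re_pos (Finset.mem_range.mp hj)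
    have hpi := Real.pi_pos
    have e : (2 * Real.pi * b * unitRotation N j : ℂ) =
        ((2 * Real.pi * b : ℝ) : ℂ) * unitRotation N j := by push_cast; ring
    have hz : (2 * Real.pi * b * unitRotation N j : ℂ).re =
        2 * Real.pi * b * (unitRotation N j).re := by rw [e, Complex.re_ofReal_mul]
    rw [abs_mul, abs_pow, abs_neg, abs_one, one_pow, one_mul]
    refine (Complex.abs_im_le_norm _).trans ?_
    rw [norm_mul, norm_unitRotation, one_mul]
    refine (norm_bose_le (by rw [hz]; positivity) hp).trans (le_of_eq ?_)
    rw [hz, div_div, ← mul_pow]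
    congr 2
    ring

lemma summable_rpow_mul_rotatedBoseSum {N : ℕ} (hN : 0 < N) (s : ℝ) {c : ℝ} (hc : 0 < c) :
    Summable fun k : ℕ+ ↦ (k : ℝ) ^ s * rotatedBoseSum N ((c * k) ^ (1 / N : ℝ)) := by
  obtain ⟨q, hq⟩ := exists_nat_gt (max (s + 1) 0)
  have hq1 : s + 1 < q := lt_of_le_of_lt (le_max_left _ _) hq
  have hq0 : q ≠ 0 := by
    rintro rfl
    simp at hq
  -- The exponent `N * q` clears the `N`-th root, leaving decay `k ^ (-q)`; `q > s + 1` then gives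
  -- summability.
  obtain ⟨C, hC, hb⟩ := abs_rotatedBoseSum_le N (p := N * q) (Nat.mul_ne_zero hN.ne' hq0)
  refine Summable.of_norm_bounded
    ((summable_pnat_rpow_neg (s := q - s) (by linarith)).mul_left (C / c ^ q)) fun k ↦ ?_
  have hk : (0 : ℝ) < k := by exact_mod_cast k.pos
  have h1 := hb ((c * k) ^ (1 / N : ℝ)) (by positivity)
  rw [pow_mul, one_div, Real.rpow_inv_natCast_pow (by positivity) hN.ne'] at h1
  rw [norm_mul, Real.norm_of_nonneg (by positivity), Real.norm_eq_abs, one_div]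
  calc (k : ℝ) ^ s * |rotatedBoseSum N ((c * k) ^ (N : ℝ)⁻¹)|
      ≤ (k : ℝ) ^ s * (C / (c * k) ^ q) := by gcongr
    _ = _ := by
      rw [neg_sub, Real.rpow_sub hk, Real.rpow_natCast, mul_pow]
      field_simp

lemma bose_ofReal (x : ℝ) : bose x = ((1 / (Real.exp x - 1) : ℝ) : ℂ) := by
  rw [bose]; push_cast; rfl

lemma hasSum_partialFraction_real {x : ℝ} (hx : 0 < x) :
    HasSum (fun k : ℕ+ ↦ 2 * x / (x ^ 2 + (2 * Real.pi * (k : ℝ)) ^ 2))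
      (1 / (Real.exp x - 1) - 1 / x + 1 / 2) := by
  have h := bose_hasSum_partialFraction (x := x) (by simpa using hx)
  rw [bose_ofReal] at h
  rw [← Complex.hasSum_ofReal]
  convert! h using 1
  · funext k; push_cast; rfl
  · push_cast; rfl

lemma one_div_exp_sub_one_le {x : ℝ} (hx : 0 < x) {p : ℕ} (hp : p ≠ 0) :
    1 / (Real.exp x - 1) ≤ p.factorial / x ^ p := by
  have h := norm_bose_le (z := x) (by simpa using hx) hp
  rw [bose_ofReal, Complex.norm_real] at h
  exact (le_abs_self _).trans h

lemma one_div_exp_sub_one_pos {x : ℝ} (hx : 0 < x) : 0 < 1 / (Real.exp x - 1) := by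
  have := Real.add_one_lt_exp hx.ne'
  exact one_div_pos.mpr (by linarith)

/-! ### The Lambert series and the transformation formula for `m > 0`. -/

/-- The Lambert series `∑ n ^ (-2Nm) / (exp (A n ^ N) - 1)`. -/
noncomputable def lambertSum (N : ℕ) (m : ℤ) (A : ℝ) : ℝ :=
  ∑' n : ℕ+, (n : ℝ) ^ (-2 * (N : ℤ) * m) * (1 / (Real.exp (A * (n : ℝ) ^ N) - 1))

lemma summable_lambertSum {N : ℕ} (hN : 0 < N) (m : ℤ) {A : ℝ} (hA : 0 < A) :
    Summable fun n : ℕ+ ↦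
      (n : ℝ) ^ (-2 * (N : ℤ) * m) * (1 / (Real.exp (A * (n : ℝ) ^ N) - 1)) := by
  set s : ℤ := -2 * (N : ℤ) * m
  -- Decay of order `s.toNat + 2` absorbs the weight `n ^ s` and leaves `n ^ (-2)`.
  have hp : s.toNat + 2 ≠ 0 := by omega
  refine Summable.of_nonneg_of_le (fun n ↦ ?_) (fun n ↦ ?_)
    ((summable_pnat_pow_inv (s := 2) one_lt_two).mul_left
      ((s.toNat + 2).factorial / A ^ (s.toNat + 2)))
  · have hn : (0 : ℝ) < n := by exact_mod_cast n.pos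
    have := one_div_exp_sub_one_pos (x := A * (n : ℝ) ^ N) (by positivity)
    positivity
  · have hn : (1 : ℝ) ≤ n := by exact_mod_cast n.pos
    have hn0 : (0 : ℝ) < n := by linarith
    have h1 := one_div_exp_sub_one_le (x := A * (n : ℝ) ^ N) (by positivity) hp
    have h2 : (n : ℝ) ^ s ≤ (n : ℝ) ^ s.toNat := by
      rw [← zpow_natCast]
      exact zpow_le_zpow_right₀ hn (Int.self_le_toNat s)
    have h3 : (n : ℝ) ≤ (n : ℝ) ^ N := le_self_pow₀ hn hN.ne'
    have h0 := one_div_exp_sub_one_pos (x := A * (n : ℝ) ^ N) (by positivity)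
    calc (n : ℝ) ^ s * (1 / (Real.exp (A * (n : ℝ) ^ N) - 1))
        ≤ (n : ℝ) ^ s.toNat * ((s.toNat + 2).factorial / (A * (n : ℝ) ^ N) ^ (s.toNat + 2)) := by
          gcongr
      _ ≤ (n : ℝ) ^ s.toNat * ((s.toNat + 2).factorial / (A * (n : ℝ)) ^ (s.toNat + 2)) := by
          gcongr
      _ = _ := by
          rw [mul_pow, pow_add (n : ℝ)]
          field_simp

/-- The rotated Lambert series `∑ k ^ (-(2m+1-1/N)) rotatedBoseSum ((2πk/A) ^ (1/N))`. -/
noncomputable def rotatedSum (N : ℕ) (m : ℤ) (A : ℝ) : ℝ :=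
  ∑' k : ℕ+, (k : ℝ) ^ (-(2 * (m : ℝ) + 1 - 1 / N)) *
    rotatedBoseSum N ((2 * Real.pi / A * k) ^ (1 / N : ℝ))

/-- The factor `-2 (-1) ^ (m + N/2) / N (A/2π) ^ (2m-1/N)`. -/
noncomputable def rotatedFactor (N : ℕ) (m : ℤ) (A : ℝ) : ℝ :=
  (-1) ^ m * (-(2 * (-1) ^ (N / 2) / N)) * (A / (2 * Real.pi)) ^ (2 * (m : ℝ) - 1 / N)

/-- The residual finite sum of products of two even zeta values. -/
noncomputable def zetaProductSum (N : ℕ) (m : ℤ) (A : ℝ) : ℂ :=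
  ∑ j ∈ Finset.range (m + 1).toNat, (-1) ^ (j + 1) * 2 * (A : ℂ) ^ (2 * (j : ℤ) - 1) *
    (2 * Real.pi : ℂ) ^ (-2 * (j : ℤ)) * riemannZeta (2 * j) *
      riemannZeta ((((2 * m + 1 - 2 * (j : ℤ)) * (N : ℤ)).toNat : ℕ) : ℂ)

/-- The `m`-th variant of `cauchySum`, with weights `n ^ (-2Nm)`. -/
noncomputable def weightedCauchySum (N m : ℕ) (A Y : ℝ) : ℝ :=
  ∑' n : ℕ+, ((n : ℝ) ^ (2 * N * m))⁻¹ * (2 * A * (n : ℝ) ^ N / (A ^ 2 * (n : ℝ) ^ (2 * N) + Y ^ 2))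

lemma summable_weightedCauchySum {N : ℕ} (hN : 1 < N) (m : ℕ) {A Y : ℝ} (hA : 0 < A) :
    Summable fun n : ℕ+ ↦ ((n : ℝ) ^ (2 * N * m))⁻¹ *
      (2 * A * (n : ℝ) ^ N / (A ^ 2 * (n : ℝ) ^ (2 * N) + Y ^ 2)) := by
  refine Summable.of_nonneg_of_le (fun n ↦ by positivity) (fun n ↦ ?_)
    ((summable_pnat_pow_inv hN).mul_left (2 / A))
  have hn : (1 : ℝ) ≤ n := by exact_mod_cast n.pos
  have h1 : ((n : ℝ) ^ (2 * N * m))⁻¹ ≤ 1 := inv_le_one_of_one_le₀ (one_le_pow₀ hn)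
  calc _ ≤ 1 * (2 * A * (n : ℝ) ^ N / (A ^ 2 * (n : ℝ) ^ (2 * N))) := by
        gcongr
        · have := sq_nonneg Y; linarith
    _ = _ := by
      rw [two_mul N, pow_add]
      field_simp

/-- From `1 / (t (A² t + Y²)) = Y⁻² (1/t - A² / (A² t + Y²))` with `t = n ^ (2N)`: lowering the
weight by `2N` costs one zeta value. -/
lemma weightedCauchySum_succ {N : ℕ} (hN : 1 < N) (m : ℕ) {A Y : ℝ} (hA : 0 < A) (hY : 0 < Y) :
    weightedCauchySum N (m + 1) A Y = 2 * A / Y ^ 2 * ∑' n : ℕ+, ((n : ℝ) ^ (N * (2 * m + 1)))⁻¹ +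
      (-(A ^ 2 / Y ^ 2)) * weightedCauchySum N m A Y := by
  have hs : 1 < N * (2 * m + 1) := by nlinarith
  rw [weightedCauchySum, weightedCauchySum, ← tsum_mul_left, ← tsum_mul_left,
    ← Summable.tsum_add ((summable_pnat_pow_inv hs).mul_left _)
      ((summable_weightedCauchySum hN m hA).mul_left _)]
  congr 1
  funext n
  have hn : (0 : ℝ) < n := by exact_mod_cast n.pos
  have e1 : (n : ℝ) ^ (2 * N * (m + 1)) = (n : ℝ) ^ (2 * N * m) * ((n : ℝ) ^ N * (n : ℝ) ^ N) := by
    ring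
  have e2 : (n : ℝ) ^ (N * (2 * m + 1)) = (n : ℝ) ^ (2 * N * m) * (n : ℝ) ^ N := by ring
  have e3 : (n : ℝ) ^ (2 * N) = (n : ℝ) ^ N * (n : ℝ) ^ N := by ring
  have hd : (0 : ℝ) < A ^ 2 * ((n : ℝ) ^ N * (n : ℝ) ^ N) + Y ^ 2 := by positivity
  rw [e1, e2, e3]
  field_simp
  ring

lemma weightedCauchySum_eq {N : ℕ} (hN : 1 < N) (m : ℕ) {A Y : ℝ} (hA : 0 < A) (hY : 0 < Y) :
    weightedCauchySum N m A Y = (-(A ^ 2 / Y ^ 2)) ^ m * weightedCauchySum N 0 A Y +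
      ∑ i ∈ Finset.range m, 2 * A / Y ^ 2 * (-(A ^ 2 / Y ^ 2)) ^ i *
        ∑' n : ℕ+, ((n : ℝ) ^ (N * (2 * (m - 1 - i) + 1)))⁻¹ := by
  induction m with
  | zero => simp
  | succ m ih =>
    rw [weightedCauchySum_succ hN m hA hY, ih, Finset.sum_range_succ', mul_add (-(A ^ 2 / Y ^ 2)),
      Finset.mul_sum]
    have : ∀ i ∈ Finset.range m, -(A ^ 2 / Y ^ 2) * (2 * A / Y ^ 2 * (-(A ^ 2 / Y ^ 2)) ^ i *
        ∑' n : ℕ+, ((n : ℝ) ^ (N * (2 * (m - 1 - i) + 1)))⁻¹) =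
        2 * A / Y ^ 2 * (-(A ^ 2 / Y ^ 2)) ^ (i + 1) *
        ∑' n : ℕ+, ((n : ℝ) ^ (N * (2 * (m + 1 - 1 - (i + 1)) + 1)))⁻¹ := by
      intro i _
      rw [show m + 1 - 1 - (i + 1) = m - 1 - i by omega, pow_succ]
      ring
    rw [Finset.sum_congr rfl this]
    simp only [Nat.add_sub_cancel, Nat.sub_zero, pow_zero, pow_succ]
    ring

lemma weightedCauchySum_zero (N : ℕ) (A y : ℝ) :
    weightedCauchySum N 0 A (2 * Real.pi * y) = cauchySum N A y := by
  simp [weightedCauchySum, cauchySum]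

/-- Tonelli for a nonnegative double series. The row sum over `k` is at most `n ^ (-2Nm) / 2`, which
is summable because `m ≠ 0`; at `m = 0` the row sums tend to `1/2` and the interchange breaks down.
-/
lemma lambertSum_eq_tsum_weightedCauchySum {N m : ℕ} (hN : 1 < N) (hm : m ≠ 0) {A : ℝ}
    (hA : 0 < A) :
    (Summable fun k : ℕ+ ↦ weightedCauchySum N m A (2 * Real.pi * k)) ∧
    lambertSum N m A = 1 / A * ∑' n : ℕ+, ((n : ℝ) ^ (N * (2 * m + 1)))⁻¹ -
      1 / 2 * ∑' n : ℕ+, ((n : ℝ) ^ (2 * N * m))⁻¹ +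
      ∑' k : ℕ+, weightedCauchySum N m A (2 * Real.pi * k) := by
  have hs1 : 1 < N * (2 * m + 1) := by nlinarith
  have hs2 : 1 < 2 * N * m := by
    have : 1 ≤ m := Nat.one_le_iff_ne_zero.mpr hm
    nlinarith
  have hpos : ∀ n : ℕ+, (0 : ℝ) < A * (n : ℝ) ^ N := fun n ↦ by positivity
  set g : ℕ+ → ℕ+ → ℝ := fun n k ↦ ((n : ℝ) ^ (2 * N * m))⁻¹ *
    (2 * A * (n : ℝ) ^ N / (A ^ 2 * (n : ℝ) ^ (2 * N) + (2 * Real.pi * k) ^ 2)) with hg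
  have hgn : ∀ n, HasSum (g n) (((n : ℝ) ^ (2 * N * m))⁻¹ *
      (1 / (Real.exp (A * (n : ℝ) ^ N) - 1) - 1 / (A * (n : ℝ) ^ N) + 1 / 2)) := by
    intro n
    have h := (hasSum_partialFraction_real (hpos n)).mul_left ((n : ℝ) ^ (2 * N * m))⁻¹
    convert! h using 1
    funext k
    simp only [hg]
    congr 2 <;> ring
  have hg0 : 0 ≤ Function.uncurry g := fun p ↦ by
    simp only [Function.uncurry, hg, Pi.zero_apply]; positivity
  have hsum : Summable (Function.uncurry g) := by
    rw [summable_prod_of_nonneg hg0]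
    refine ⟨fun n ↦ (hgn n).summable, ?_⟩
    refine Summable.of_nonneg_of_le (fun n ↦ tsum_nonneg fun k ↦ hg0 (n, k)) (fun n ↦ ?_)
      ((summable_pnat_pow_inv hs2).mul_right (1 / 2))
    refine (le_of_eq (hgn n).tsum_eq).trans ?_
    have := one_div_exp_sub_one_le (hpos n) one_ne_zero
    simp only [Nat.factorial_one, Nat.cast_one, pow_one] at this
    gcongr
    linarith
  have hcomm := Summable.tsum_comm hsum
  simp_rw [fun n ↦ (hgn n).tsum_eq] at hcomm
  refine ⟨?_, ?_⟩
  · have := hsum.prod_symm.prod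
    exact this
  · have h1 : ∑' k : ℕ+, weightedCauchySum N m A (2 * Real.pi * k) = ∑' k, ∑' n, g n k := rfl
    rw [h1, hcomm, ← tsum_mul_left, ← tsum_mul_left]
    have hsl : Summable fun n : ℕ+ ↦ ((n : ℝ) ^ (2 * N * m))⁻¹ *
      (1 / (Real.exp (A * (n : ℝ) ^ N) - 1) - 1 / (A * (n : ℝ) ^ N) + 1 / 2) := by
      have := hsum.prod
      convert! this using 1
      funext n
      exact (hgn n).tsum_eq.symm
    rw [← Summable.tsum_sub ((summable_pnat_pow_inv hs1).mul_left _)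
      ((summable_pnat_pow_inv hs2).mul_left _), ← Summable.tsum_add _ hsl]
    · rw [lambertSum]
      congr 1
      funext n
      have hn : (0 : ℝ) < n := by exact_mod_cast n.pos
      have e1 : (n : ℝ) ^ (-2 * (N : ℤ) * (m : ℤ)) = ((n : ℝ) ^ (2 * N * m))⁻¹ := by
        rw [← zpow_natCast, ← zpow_neg]; congr 1; push_cast; ring
      have e2 : (n : ℝ) ^ (N * (2 * m + 1)) = (n : ℝ) ^ (2 * N * m) * (n : ℝ) ^ N := by ring
      rw [e1, e2]
      field_simp
      ring
    · exact ((summable_pnat_pow_inv hs1).mul_left _).sub ((summable_pnat_pow_inv hs2).mul_left _)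

/-- The power `k ^ (-2m)` combines with the `k ^ (1/N - 1)` of `cauchySum_eq`. The exponent `m` is
an integer because both signs occur: positive in the direct expansion, negative in the Poisson
argument. -/
lemma neg_sq_div_pow_mul_cauchySum {N : ℕ} (hN : 0 < N) (hNe : Even N) (m : ℤ) {A k : ℝ}
    (hA : 0 < A) (hk : 0 < k) :
    (-(A ^ 2 / (2 * Real.pi * k) ^ 2)) ^ m * cauchySum N A k =
      rotatedFactor N m A * (k ^ (-(2 * (m : ℝ) + 1 - 1 / N)) *
        rotatedBoseSum N ((2 * Real.pi / A * k) ^ (1 / N : ℝ)) +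
        rotationImSum N / 2 * k ^ (-(2 * (m : ℝ) + 1 - 1 / N))) := by
  have hpi := Real.pi_pos
  have h2pi : 0 < 2 * Real.pi := by positivity
  rw [cauchySum_eq hN hNe hA hk, rotatedFactor, neg_eq_neg_one_mul, mul_zpow]
  have e0 : (2 * Real.pi * k / A) = 2 * Real.pi / A * k := by ring
  have e1 : (A ^ 2 / (2 * Real.pi * k) ^ 2) ^ m =
      A ^ (2 * (m : ℝ)) / ((2 * Real.pi) ^ (2 * (m : ℝ)) * k ^ (2 * (m : ℝ))) := by
    rw [← Real.mul_rpow h2pi.le hk.le, ← Real.div_rpow hA.le (by positivity), ← div_pow,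
      Real.rpow_mul (by positivity), Real.rpow_intCast]
    norm_cast
  rw [e0, e1, Real.mul_rpow h2pi.le hk.le, Real.div_rpow hA.le h2pi.le, Real.rpow_sub hA,
    Real.rpow_neg hA.le, Real.rpow_sub h2pi, Real.rpow_sub h2pi, Real.rpow_sub hk, Real.rpow_one,
    Real.rpow_one, Real.rpow_neg hk.le, Real.rpow_sub hk, Real.rpow_add hk, Real.rpow_one]
  field_simp
  ring

/-- Summing `weightedCauchySum_eq` over `k`, each recursion term factors into two zeta values, while
the remaining `cauchySum` gives the rotated series and `ζ(2m + 1 - 1/N)`, a convergent series since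
`m ≥ 1`. -/
lemma lambert_identity_of_pos {N : ℕ} (hN : 0 < N) (hNe : Even N) {m : ℕ} (hm : m ≠ 0) {A : ℝ}
    (hA : 0 < A) :
    riemannZeta (2 * N * m) / 2 + (lambertSum N m A : ℂ) = zetaProductSum N m A +
      rotatedFactor N m A * (rotatedSum N m A + rotationImSum N / 2 *
        riemannZeta (2 * m + 1 - 1 / N)) := by
  have hN1 : 1 < N := by obtain ⟨M, hM⟩ := hNe; omega
  have hpi := Real.pi_pos
  obtain ⟨hWs, hL⟩ := lambertSum_eq_tsum_weightedCauchySum hN1 hm hA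
  have hs2 : 1 < 2 * N * m := by
    have : 1 ≤ m := Nat.one_le_iff_ne_zero.mpr hm
    nlinarith
  have hsr : 1 < 2 * (m : ℝ) + 1 - 1 / N := by
    have h1 : (1 : ℝ) ≤ m := by exact_mod_cast Nat.one_le_iff_ne_zero.mpr hm
    have h2 : (1 : ℝ) / N ≤ 1 := by
      rw [div_le_one (by exact_mod_cast hN)]; exact_mod_cast hN
    linarith
  have hz1 : riemannZeta (2 * N * m) = ((∑' n : ℕ+, ((n : ℝ) ^ (2 * N * m))⁻¹ : ℝ) : ℂ) := by
    rw [← riemannZeta_natCast_eq_tsum_pnat hs2]; push_cast; rfl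
  have hz2 : riemannZeta (2 * m + 1 - 1 / N) =
      ((∑' n : ℕ+, (n : ℝ) ^ (-(2 * (m : ℝ) + 1 - 1 / N)) : ℝ) : ℂ) := by
    rw [← riemannZeta_ofReal_eq_tsum_pnat hsr]; push_cast; rfl
  have hc : 0 < 2 * Real.pi / A := by positivity
  have hB : Summable fun k : ℕ+ ↦ (k : ℝ) ^ (-(2 * (m : ℝ) + 1 - 1 / N)) *
      rotatedBoseSum N ((2 * Real.pi / A * k) ^ (1 / N : ℝ)) :=
    summable_rpow_mul_rotatedBoseSum hN _ hc
  have hK := summable_pnat_rpow_neg hsr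
  have hW : ∀ k : ℕ+, weightedCauchySum N m A (2 * Real.pi * k) =
      rotatedFactor N m A * ((k : ℝ) ^ (-(2 * (m : ℝ) + 1 - 1 / N)) *
        rotatedBoseSum N ((2 * Real.pi / A * k) ^ (1 / N : ℝ)) +
        rotationImSum N / 2 * (k : ℝ) ^ (-(2 * (m : ℝ) + 1 - 1 / N))) +
      ∑ i ∈ Finset.range m, (2 * (-1) ^ i * A ^ (2 * i + 1) / (2 * Real.pi) ^ (2 * i + 2) *
        ∑' n : ℕ+, ((n : ℝ) ^ (N * (2 * (m - 1 - i) + 1)))⁻¹) * ((k : ℝ) ^ (2 * i + 2))⁻¹ := by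
    intro k
    have hk : (0 : ℝ) < k := by exact_mod_cast k.pos
    rw [weightedCauchySum_eq hN1 m hA (by positivity), weightedCauchySum_zero]
    have := neg_sq_div_pow_mul_cauchySum hN hNe m hA hk
    rw [zpow_natCast] at this
    rw [this]
    congr 1
    apply Finset.sum_congr rfl
    intro i _
    rw [neg_eq_neg_one_mul (A ^ 2 / _), mul_pow (-1 : ℝ), div_pow]
    have h2pi : 0 < 2 * Real.pi := by positivity
    generalize 2 * Real.pi = t at h2pi
    field_simp
    ring
  have hfin : ∀ i ∈ Finset.range m, Summable fun k : ℕ+ ↦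
      (2 * (-1) ^ i * A ^ (2 * i + 1) / (2 * Real.pi) ^ (2 * i + 2) *
        ∑' n : ℕ+, ((n : ℝ) ^ (N * (2 * (m - 1 - i) + 1)))⁻¹) * ((k : ℝ) ^ (2 * i + 2))⁻¹ :=
    fun i _ ↦ (summable_pnat_pow_inv (by omega)).mul_left _
  have hWsum : ∑' k : ℕ+, weightedCauchySum N m A (2 * Real.pi * k) =
      rotatedFactor N m A * (rotatedSum N m A + rotationImSum N / 2 *
        ∑' n : ℕ+, (n : ℝ) ^ (-(2 * (m : ℝ) + 1 - 1 / N))) +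
      ∑ i ∈ Finset.range m, (2 * (-1) ^ i * A ^ (2 * i + 1) / (2 * Real.pi) ^ (2 * i + 2) *
        ∑' n : ℕ+, ((n : ℝ) ^ (N * (2 * (m - 1 - i) + 1)))⁻¹) *
        ∑' k : ℕ+, ((k : ℝ) ^ (2 * i + 2))⁻¹ := by
    simp_rw [hW]
    rw [Summable.tsum_add ((hB.add (hK.mul_left _)).mul_left _) (summable_sum hfin),
      Summable.tsum_finsetSum hfin, tsum_mul_left, Summable.tsum_add hB (hK.mul_left _),
      tsum_mul_left]
    simp_rw [tsum_mul_left]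
    rfl
  have hR : zetaProductSum N m A = ((1 / A * ∑' n : ℕ+, ((n : ℝ) ^ (N * (2 * m + 1)))⁻¹ +
      ∑ i ∈ Finset.range m, (2 * (-1) ^ i * A ^ (2 * i + 1) / (2 * Real.pi) ^ (2 * i + 2) *
        ∑' n : ℕ+, ((n : ℝ) ^ (N * (2 * (m - 1 - i) + 1)))⁻¹) *
        ∑' k : ℕ+, ((k : ℝ) ^ (2 * i + 2))⁻¹ : ℝ) : ℂ) := by
    have hAC : (A : ℂ) ≠ 0 := by exact_mod_cast hA.ne'
    rw [zetaProductSum, show ((m : ℤ) + 1).toNat = m + 1 by omega, Finset.sum_range_succ', add_comm,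
      Complex.ofReal_add, Complex.ofReal_sum]
    congr 1
    -- The `j = 0` term of `zetaProductSum` is the `1/x` part of the expansion, since `-2 ζ(0) = 1`;
    -- the recursion term `i` is the one with `j = i + 1`.
    · have e : ((2 * (m : ℤ) + 1 - 2 * ((0 : ℕ) : ℤ)) * (N : ℤ)).toNat = N * (2 * m + 1) := by
        rw [← Int.toNat_natCast (N * (2 * m + 1))]; congr 1; push_cast; ring
      rw [e, riemannZeta_natCast_eq_tsum_pnat (by nlinarith)]
      simp [riemannZeta_zero]
      field_simp
    · apply Finset.sum_congr rfl
      intro i hi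
      rw [Finset.mem_range] at hi
      have e : ((2 * (m : ℤ) + 1 - 2 * ((i + 1 : ℕ) : ℤ)) * (N : ℤ)).toNat =
          N * (2 * (m - 1 - i) + 1) := by
        rw [← Int.toNat_natCast (N * (2 * (m - 1 - i) + 1))]
        congr 1
        push_cast [Nat.cast_sub (by omega : i ≤ m - 1), Nat.cast_sub (by omega : 1 ≤ m)]
        ring
      have e2 : (2 * ((i + 1 : ℕ) : ℂ)) = ((2 * i + 2 : ℕ) : ℂ) := by push_cast; ring
      rw [e, e2, riemannZeta_natCast_eq_tsum_pnat (s := N * (2 * (m - 1 - i) + 1)) (by nlinarith),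
        riemannZeta_natCast_eq_tsum_pnat (by omega : 1 < 2 * i + 2)]
      have e3 : (A : ℂ) ^ (2 * ((i + 1 : ℕ) : ℤ) - 1) = (A : ℂ) ^ (2 * i + 1) := by
        rw [← zpow_natCast]; congr 1; push_cast; omega
      have e4 : (2 * Real.pi : ℂ) ^ (-2 * ((i + 1 : ℕ) : ℤ)) = ((2 * Real.pi : ℂ) ^ (2 * i + 2))⁻¹ := by
        rw [← zpow_natCast, ← zpow_neg]; congr 1
      rw [e3, e4]
      push_cast
      ring
  rw [hR, hz1, hz2, hL, hWsum]
  push_cast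
  ring

/-! ### Theta-like series and their Fourier transforms. -/

lemma integrable_exp_neg_mul_abs {X : ℝ} (hX : 0 < X) :
    Integrable fun u : ℝ ↦ Real.exp (-X * |u|) := by
  rw [← integrableOn_univ, ← Iic_union_Ioi (a := (0 : ℝ)), integrableOn_union]
  constructor
  · refine (integrableOn_exp_mul_Iic hX 0).congr_fun (fun u hu ↦ ?_) measurableSet_Iic
    simp only [abs_of_nonpos (mem_Iic.mp hu)]
    congr 1; ring
  · refine (integrableOn_exp_mul_Ioi (neg_lt_zero.mpr hX) 0).congr_fun (fun u hu ↦ ?_)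
      measurableSet_Ioi
    simp only [abs_of_pos (mem_Ioi.mp hu)]

lemma integral_exp_neg_mul_abs {X : ℝ} (hX : 0 < X) :
    ∫ u : ℝ, Real.exp (-X * |u|) = 2 / X := by
  rw [integral_comp_abs (f := fun u ↦ Real.exp (-X * u)), integral_exp_mul_Ioi (neg_lt_zero.mpr hX)]
  simp
  field_simp

/-- With `X = A n ^ N` the right side is the `n`-th term of `cauchySum`, which is therefore the
Fourier transform of a sum of exponentials. -/
lemma fourier_exp_neg_mul_abs {X : ℝ} (hX : 0 < X) (y : ℝ) :
    𝓕 (fun u : ℝ ↦ (Real.exp (-X * |u|) : ℂ)) y =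
      ((2 * X / (X ^ 2 + (2 * Real.pi * y) ^ 2) : ℝ) : ℂ) := by
  have h1 : ∀ u ∈ Ioi (0 : ℝ), Complex.exp (((-2 * Real.pi * u * y : ℝ) : ℂ) * I) •
      (Real.exp (-X * |u|) : ℂ) = Complex.exp ((-X - 2 * Real.pi * y * I : ℂ) * u) := by
    intro u hu
    rw [abs_of_pos (mem_Ioi.mp hu), smul_eq_mul, Complex.ofReal_exp, ← Complex.exp_add]
    congr 1; push_cast; ring
  have h2 : ∀ u ∈ Iic (0 : ℝ), Complex.exp (((-2 * Real.pi * u * y : ℝ) : ℂ) * I) •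
      (Real.exp (-X * |u|) : ℂ) = Complex.exp ((X - 2 * Real.pi * y * I : ℂ) * u) := by
    intro u hu
    rw [abs_of_nonpos (mem_Iic.mp hu), smul_eq_mul, Complex.ofReal_exp, ← Complex.exp_add]
    congr 1; push_cast; ring
  have r1 : (-X - 2 * Real.pi * y * I : ℂ).re < 0 := by simpa using hX
  have r2 : 0 < (X - 2 * Real.pi * y * I : ℂ).re := by simpa using hX
  rw [Real.fourier_real_eq_integral_exp_smul, ← intervalIntegral.integral_Iic_add_Ioi (b := 0)
    ((integrableOn_exp_mul_complex_Iic r2 0).congr_fun (fun u hu ↦ (h2 u hu).symm) measurableSet_Iic)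
    ((integrableOn_exp_mul_complex_Ioi r1 0).congr_fun (fun u hu ↦ (h1 u hu).symm) measurableSet_Ioi),
    setIntegral_congr_fun measurableSet_Iic h2, setIntegral_congr_fun measurableSet_Ioi h1,
    integral_exp_mul_complex_Iic r2, integral_exp_mul_complex_Ioi r1]
  have n1 : (-X - 2 * Real.pi * y * I : ℂ) ≠ 0 := fun h ↦ by rw [h] at r1; simp at r1
  have n2 : (X - 2 * Real.pi * y * I : ℂ) ≠ 0 := fun h ↦ by rw [h] at r2; simp at r2
  have n3 : ((X : ℂ) ^ 2 + (2 * Real.pi * y) ^ 2) ≠ 0 := by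
    have : 0 < X ^ 2 + (2 * Real.pi * y) ^ 2 := by positivity
    exact_mod_cast this.ne'
  push_cast
  simp only [mul_zero, Complex.exp_zero]
  rw [div_add_div _ _ n2 n1, div_eq_div_iff (mul_ne_zero n2 n1) n3]
  linear_combination (-2 * X * (2 * Real.pi * y : ℂ) ^ 2 ) * I_sq

/-- The `i`-th derivative `∑ (-A n ^ N) ^ i exp (-A n ^ N u)` of the theta-like series. -/
noncomputable def powerTheta (N : ℕ) (A : ℝ) (i : ℕ) (u : ℝ) : ℝ :=
  ∑' n : ℕ+, (-(A * (n : ℝ) ^ N)) ^ i * Real.exp (-(A * (n : ℝ) ^ N) * u)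

/-- From `v ^ (i+p) / (i+p)! ≤ exp v`: the extra `p` powers pay for the sum over `n`. -/
lemma pow_mul_exp_neg_le {X u : ℝ} (hX : 0 < X) (hu : 0 < u) (i p : ℕ) :
    X ^ i * Real.exp (-X * u) ≤ (i + p).factorial / u ^ (i + p) * (X ^ p)⁻¹ := by
  have h := Real.pow_div_factorial_le_exp (X * u) (by positivity) (i + p)
  rw [neg_mul, Real.exp_neg, ← div_eq_mul_inv, div_le_iff₀ (Real.exp_pos _)]
  have : X ^ i = (i + p).factorial / u ^ (i + p) * (X ^ p)⁻¹ * ((X * u) ^ (i + p) / (i + p).factorial) := by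
    rw [mul_pow, pow_add X]
    field_simp
  rw [this]
  gcongr

lemma abs_powerTheta_term_le {N : ℕ} {A u : ℝ} (hA : 0 < A) (hu : 0 < u) (i p : ℕ) (n : ℕ+) :
    |(-(A * (n : ℝ) ^ N)) ^ i * Real.exp (-(A * (n : ℝ) ^ N) * u)| ≤
      (i + p).factorial / (u ^ (i + p) * A ^ p) * (((n : ℝ) ^ (N * p))⁻¹) := by
  have hX : 0 < A * (n : ℝ) ^ N := by positivity
  rw [abs_mul, abs_pow, abs_neg, abs_of_pos hX, Real.abs_exp]
  refine (pow_mul_exp_neg_le hX hu i p).trans (le_of_eq ?_)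
  rw [mul_pow, ← pow_mul]
  field_simp

lemma summable_powerTheta {N : ℕ} (hN : 0 < N) {A u : ℝ} (hA : 0 < A) (hu : 0 < u) (i : ℕ) :
    Summable fun n : ℕ+ ↦ (-(A * (n : ℝ) ^ N)) ^ i * Real.exp (-(A * (n : ℝ) ^ N) * u) :=
  Summable.of_norm_bounded ((summable_pnat_pow_inv (s := N * 2) (by omega)).mul_left _)
    fun n ↦ abs_powerTheta_term_le hA hu i 2 n

lemma abs_powerTheta_le {N : ℕ} (hN : 0 < N) {A : ℝ} (hA : 0 < A) (i : ℕ) {p : ℕ} (hp : 2 ≤ p) :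
    ∃ C : ℝ, 0 ≤ C ∧ ∀ u, 0 < u → |powerTheta N A i u| ≤ C / u ^ (i + p) := by
  have hs := summable_pnat_pow_inv (s := N * p) (by nlinarith)
  refine ⟨(i + p).factorial / A ^ p * ∑' n : ℕ+, ((n : ℝ) ^ (N * p))⁻¹, ?_, fun u hu ↦ ?_⟩
  · have : 0 ≤ ∑' n : ℕ+, ((n : ℝ) ^ (N * p))⁻¹ := tsum_nonneg fun n ↦ by positivity
    positivity
  · have := tsum_of_norm_bounded
      (f := fun n : ℕ+ ↦ (-(A * (n : ℝ) ^ N)) ^ i * Real.exp (-(A * (n : ℝ) ^ N) * u))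
      (hs.mul_left ((i + p).factorial / (u ^ (i + p) * A ^ p))).hasSum
      fun n ↦ abs_powerTheta_term_le hA hu i p n
    rw [tsum_mul_left, Real.norm_eq_abs] at this
    rw [powerTheta]
    refine this.trans (le_of_eq ?_)
    field_simp

lemma hasDerivAt_powerTheta {N : ℕ} (hN : 0 < N) {A u : ℝ} (hA : 0 < A) (hu : 0 < u) (i : ℕ) :
    HasDerivAt (powerTheta N A i) (powerTheta N A (i + 1) u) u := by
  -- On `(u/2, ∞)` the term bounds are uniform, as termwise differentiation requires.
  have hu2 : 0 < u / 2 := by positivity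
  refine hasDerivAt_tsum_of_isPreconnected (t := Ioi (u / 2)) (y₀ := u)
    (g := fun (n : ℕ+) v ↦ (-(A * (n : ℝ) ^ N)) ^ i * Real.exp (-(A * (n : ℝ) ^ N) * v))
    (g' := fun (n : ℕ+) v ↦ (-(A * (n : ℝ) ^ N)) ^ (i + 1) * Real.exp (-(A * (n : ℝ) ^ N) * v))
    (((summable_pnat_pow_inv (s := N * 2) (by omega)).mul_left
      ((i + 1 + 2).factorial / ((u / 2) ^ (i + 1 + 2) * A ^ 2))))
    isOpen_Ioi isPreconnected_Ioi (fun n v _ ↦ ?_) (fun n v hv ↦ ?_) (by simpa using hu)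
    (summable_powerTheta hN hA hu i) (by simpa using hu)
  · have h := ((hasDerivAt_id v).const_mul (-(A * (n : ℝ) ^ N))).exp.const_mul
      ((-(A * (n : ℝ) ^ N)) ^ i)
    convert! h using 1
    simp only [id]
    ring
  · have hv0 : u / 2 < v := hv
    refine (abs_powerTheta_term_le hA (hu2.trans hv0) (i + 1) 2 n).trans ?_
    gcongr

lemma integrable_powerTheta_abs {N : ℕ} (hN : 1 < N) {A : ℝ} (hA : 0 < A) :
    (Integrable fun u : ℝ ↦ (powerTheta N A 0 |u| : ℂ)) ∧
    ∀ y, 𝓕 (fun u : ℝ ↦ (powerTheta N A 0 |u| : ℂ)) y = (cauchySum N A y : ℂ) := by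
  have hX : ∀ n : ℕ+, 0 < A * (n : ℝ) ^ N := fun n ↦ by positivity
  have hs : Summable fun n : ℕ+ ↦ 2 / (A * (n : ℝ) ^ N) := by
    convert! (summable_pnat_pow_inv hN).mul_left (2 / A) using 1
    funext n; field_simp
  constructor
  · refine Integrable.ofReal (f := fun u ↦ powerTheta N A 0 |u|) ?_
    have hsum := hasSum_integral_of_summable_integral_norm (μ := volume)
      (F := fun (n : ℕ+) (u : ℝ) ↦ Real.exp (-(A * (n : ℝ) ^ N) * |u|))
      (fun n ↦ integrable_exp_neg_mul_abs (hX n)) (by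
        simp_rw [Real.norm_eq_abs, Real.abs_exp, integral_exp_neg_mul_abs (hX _)]
        exact hs)
    simp_rw [integral_exp_neg_mul_abs (hX _)] at hsum
    -- A non-integrable function has Bochner integral `0` by convention, so a nonzero value of the
    -- integral proves integrability.
    have hpos : 0 < ∑' n : ℕ+, 2 / (A * (n : ℝ) ^ N) :=
      hs.tsum_pos (fun n ↦ by positivity) 1 (by positivity)
    have e : (fun u : ℝ ↦ powerTheta N A 0 |u|) =
        fun u ↦ ∑' n : ℕ+, Real.exp (-(A * (n : ℝ) ^ N) * |u|) := by
      funext u; simp only [powerTheta, pow_zero, one_mul]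
    rw [e]
    exact Integrable.of_integral_ne_zero (by rw [← hsum.tsum_eq]; exact hpos.ne')
  · intro y
    have e : ∀ (n : ℕ+) (u : ℝ), ‖Complex.exp (((-2 * Real.pi * u * y : ℝ) : ℂ) * I) •
        (Real.exp (-(A * (n : ℝ) ^ N) * |u|) : ℂ)‖ = Real.exp (-(A * (n : ℝ) ^ N) * |u|) := by
      intro n u
      rw [norm_smul, Complex.norm_exp_ofReal_mul_I, one_mul, Complex.norm_real, Real.norm_eq_abs,
        Real.abs_exp]
    have hsum := hasSum_integral_of_summable_integral_norm (μ := volume)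
      (F := fun (n : ℕ+) (u : ℝ) ↦ Complex.exp (((-2 * Real.pi * u * y : ℝ) : ℂ) * I) •
        (Real.exp (-(A * (n : ℝ) ^ N) * |u|) : ℂ))
      (fun n ↦ by
        refine (integrable_norm_iff ?_).mp ?_
        · apply Continuous.aestronglyMeasurable
          fun_prop
        · simp_rw [e]
          exact integrable_exp_neg_mul_abs (hX n))
      (by simp_rw [e, integral_exp_neg_mul_abs (hX _)]; exact hs)
    have hf := fun n : ℕ+ ↦ fourier_exp_neg_mul_abs (hX n) y
    simp_rw [Real.fourier_real_eq_integral_exp_smul] at hf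
    simp_rw [hf] at hsum
    rw [Real.fourier_real_eq_integral_exp_smul, cauchySum]
    have h2 : ∀ u : ℝ, Complex.exp (((-2 * Real.pi * u * y : ℝ) : ℂ) * I) •
        (powerTheta N A 0 |u| : ℂ) = ∑' n : ℕ+,
        Complex.exp (((-2 * Real.pi * u * y : ℝ) : ℂ) * I) •
        (Real.exp (-(A * (n : ℝ) ^ N) * |u|) : ℂ) := by
      intro u
      simp only [powerTheta, pow_zero, one_mul, smul_eq_mul]
      rw [tsum_mul_left, Complex.ofReal_tsum]
    simp_rw [h2]
    rw [← hsum.tsum_eq, Complex.ofReal_tsum]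
    congr 1
    funext n
    congr 2 <;> ring

lemma continuous_cauchySum {N : ℕ} (hN : 1 < N) {A : ℝ} (hA : 0 < A) :
    Continuous (cauchySum N A) := by
  refine continuous_tsum (u := fun n : ℕ+ ↦ 2 / A * ((n : ℝ) ^ N)⁻¹) (fun n ↦ ?_)
    ((summable_pnat_pow_inv hN).mul_left _) fun n y ↦ ?_
  · have : ∀ y : ℝ, A ^ 2 * (n : ℝ) ^ (2 * N) + (2 * Real.pi * y) ^ 2 ≠ 0 := fun y ↦ by positivity
    fun_prop (disch := assumption)
  · rw [Real.norm_of_nonneg (by positivity)]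
    calc _ ≤ 2 * A * (n : ℝ) ^ N / (A ^ 2 * (n : ℝ) ^ (2 * N)) := by
          gcongr
          have := sq_nonneg (2 * Real.pi * y); linarith
      _ = _ := by rw [two_mul N, pow_add]; field_simp

lemma cauchySum_neg (N : ℕ) (A y : ℝ) : cauchySum N A (-y) = cauchySum N A y := by
  simp [cauchySum]

/-! ### Cancelling two dilates, and Poisson summation. -/

/-- The combination of two dilates of `cauchySum` whose slowly decaying parts cancel. -/
noncomputable def cauchyDiff (N : ℕ) (A y : ℝ) : ℝ :=
  cauchySum N A y - 2 ^ (1 / N : ℝ) * cauchySum N (2 * A) y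

lemma cauchyDiff_neg (N : ℕ) (A y : ℝ) : cauchyDiff N A (-y) = cauchyDiff N A y := by
  simp [cauchyDiff, cauchySum_neg]

lemma continuous_cauchyDiff {N : ℕ} (hN : 1 < N) {A : ℝ} (hA : 0 < A) :
    Continuous (cauchyDiff N A) :=
  (continuous_cauchySum hN hA).sub ((continuous_cauchySum hN (by positivity)).const_mul _)

/-- Because `2 ^ (1/N) (2A) ^ (-1/N) = A ^ (-1/N)`, the two `rotationImSum` terms cancel. Only
rotated Bose sums remain, so the difference decays faster than any power of `y`. -/
lemma cauchyDiff_eq {N : ℕ} (hN : 0 < N) (hNe : Even N) {A y : ℝ} (hA : 0 < A) (hy : 0 < y) :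
    cauchyDiff N A y = -(4 * Real.pi * (-1) ^ (N / 2) / N) * A ^ (-(1 / N : ℝ)) *
      (2 * Real.pi * y) ^ ((1 / N : ℝ) - 1) *
        (rotatedBoseSum N ((2 * Real.pi / A * y) ^ (1 / N : ℝ)) -
          rotatedBoseSum N ((2 * Real.pi / (2 * A) * y) ^ (1 / N : ℝ))) := by
  rw [cauchyDiff, cauchySum_eq hN hNe hA hy, cauchySum_eq hN hNe (by positivity) hy,
    Real.mul_rpow two_pos.le hA.le, Real.rpow_neg two_pos.le]
  have e1 : 2 * Real.pi * y / A = 2 * Real.pi / A * y := by ring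
  have e2 : 2 * Real.pi * y / (2 * A) = 2 * Real.pi / (2 * A) * y := by ring
  rw [e1, e2]
  have : (2 : ℝ) ^ (1 / N : ℝ) ≠ 0 := by positivity
  field_simp
  ring

lemma abs_cauchyDiff_le {N : ℕ} (hN : 0 < N) (hNe : Even N) {A : ℝ} (hA : 0 < A) (q : ℕ) :
    ∃ C : ℝ, 0 ≤ C ∧ ∀ y, 1 ≤ |y| → |cauchyDiff N A y| ≤ C / |y| ^ q := by
  have hpi := Real.pi_pos
  -- The exponent `q + 1` keeps the order positive when `q = 0`; the surplus factor of `y` is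
  -- discarded, as `y ≥ 1`.
  obtain ⟨C, hC, hb⟩ := abs_rotatedBoseSum_le N (p := N * (q + 1)) (by positivity)
  have hb' : ∀ c y : ℝ, 0 < c → 1 ≤ y → |rotatedBoseSum N ((c * y) ^ (1 / N : ℝ))| ≤
      C / c ^ (q + 1) / y ^ q := by
    intro c y hc hy
    have hy0 : 0 < y := by linarith
    have h1 := hb ((c * y) ^ (1 / N : ℝ)) (by positivity)
    rw [pow_mul, one_div, Real.rpow_inv_natCast_pow (by positivity) hN.ne'] at h1
    rw [one_div]
    refine h1.trans ?_
    rw [mul_pow, ← div_div]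
    gcongr
    exact Nat.le_succ q
  set K := |-(4 * Real.pi * (-1) ^ (N / 2) / N) * A ^ (-(1 / N : ℝ))|
  set D := C / (2 * Real.pi / A) ^ (q + 1) + C / (2 * Real.pi / (2 * A)) ^ (q + 1)
  have hD : 0 ≤ D := by positivity
  have key : ∀ y, 1 ≤ y → |cauchyDiff N A y| ≤ K * D / y ^ q := by
    intro y hy
    have hy0 : 0 < y := by linarith
    rw [cauchyDiff_eq hN hNe hA hy0, abs_mul, abs_mul]
    have h1 : |(2 * Real.pi * y) ^ ((1 / N : ℝ) - 1)| ≤ 1 := by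
      rw [abs_of_pos (by positivity)]
      apply Real.rpow_le_one_of_one_le_of_nonpos
      · nlinarith [Real.pi_gt_three]
      · rw [sub_nonpos, div_le_one (by exact_mod_cast hN)]; exact_mod_cast hN
    have h2 : |rotatedBoseSum N ((2 * Real.pi / A * y) ^ (1 / N : ℝ)) -
          rotatedBoseSum N ((2 * Real.pi / (2 * A) * y) ^ (1 / N : ℝ))| ≤ D / y ^ q := by
      refine (abs_sub _ _).trans ?_
      rw [add_div]
      exact add_le_add (hb' _ y (by positivity) hy) (hb' _ y (by positivity) hy)
    calc _ ≤ K * 1 * (D / y ^ q) := by gcongr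
      _ = _ := by ring
  refine ⟨K * D, by positivity, fun y hy ↦ ?_⟩
  have := key |y| hy
  rcases abs_choice y with h | h
  · rwa [h] at this ⊢
  · rw [h, cauchyDiff_neg] at this; rwa [h]

/-- The combination of two dilates of `powerTheta` matching `cauchyDiff` under Fourier inversion. -/
noncomputable def thetaDiff (N : ℕ) (A : ℝ) (i : ℕ) (u : ℝ) : ℝ :=
  powerTheta N A i u - 2 ^ (1 / N : ℝ) * powerTheta N (2 * A) i u

lemma hasDerivAt_thetaDiff {N : ℕ} (hN : 0 < N) {A u : ℝ} (hA : 0 < A) (hu : 0 < u) (i : ℕ) :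
    HasDerivAt (thetaDiff N A i) (thetaDiff N A (i + 1) u) u :=
  (hasDerivAt_powerTheta hN hA hu i).sub
    ((hasDerivAt_powerTheta hN (by positivity) hu i).const_mul _)

lemma integrable_pow_smul_cauchyDiff {N : ℕ} (hN : 0 < N) (hNe : Even N) {A : ℝ} (hA : 0 < A)
    (n : ℕ) : Integrable fun y : ℝ ↦ y ^ n • (cauchyDiff N A y : ℂ) := by
  have hN1 : 1 < N := by obtain ⟨M, hM⟩ := hNe; omega
  obtain ⟨C, hC, hb⟩ := abs_cauchyDiff_le hN hNe hA (n + 2)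
  have hcont := continuous_cauchyDiff hN1 hA
  obtain ⟨K, hK⟩ := isCompact_Icc.exists_bound_of_continuousOn (s := Icc (-1 : ℝ) 1)
    (f := fun y ↦ y ^ n * cauchyDiff N A y) (by fun_prop)
  have hK0 : 0 ≤ K := (norm_nonneg _).trans (hK 0 (by simp))
  refine (integrable_inv_one_add_sq.const_mul (2 * (K + C))).mono'
    (by apply Continuous.aestronglyMeasurable; fun_prop) (.of_forall fun y ↦ ?_)
  rw [norm_smul, Complex.norm_real, Real.norm_eq_abs, Real.norm_eq_abs, abs_pow]
  by_cases hy : |y| ≤ 1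
  · have h1 := hK y (abs_le.mp hy)
    rw [Real.norm_eq_abs, abs_mul, abs_pow] at h1
    have h2 : (2 : ℝ)⁻¹ ≤ (1 + y ^ 2)⁻¹ := by
      apply inv_anti₀ (by positivity)
      have := (sq_le_one_iff_abs_le_one y).mpr hy
      linarith
    calc _ ≤ K := h1
      _ ≤ 2 * (K + C) * 2⁻¹ := by linarith
      _ ≤ _ := by gcongr
  · push Not at hy
    have hy0 : 0 < |y| := by linarith
    have h1 := hb y hy.le
    calc |y| ^ n * |cauchyDiff N A y| ≤ |y| ^ n * (C / |y| ^ (n + 2)) := by gcongr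
      _ = C * (|y| ^ 2)⁻¹ := by rw [pow_add]; field_simp
      _ = 2 * C * (2 * |y| ^ 2)⁻¹ := by field_simp
      _ ≤ 2 * (K + C) * (1 + y ^ 2)⁻¹ := by
        gcongr
        · linarith
        · rw [← sq_abs y]
          have : 1 ≤ |y| ^ 2 := one_le_pow₀ hy.le
          linarith

lemma fourier_thetaDiff {N : ℕ} (hN : 1 < N) {A : ℝ} (hA : 0 < A) :
    (Integrable fun u : ℝ ↦ (thetaDiff N A 0 |u| : ℂ)) ∧
    𝓕 (fun u : ℝ ↦ (thetaDiff N A 0 |u| : ℂ)) = fun y ↦ (cauchyDiff N A y : ℂ) := by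
  obtain ⟨h1, f1⟩ := integrable_powerTheta_abs hN hA
  obtain ⟨h2, f2⟩ := integrable_powerTheta_abs hN (A := 2 * A) (by positivity)
  have e : (fun u : ℝ ↦ (thetaDiff N A 0 |u| : ℂ)) = fun u : ℝ ↦ (powerTheta N A 0 |u| : ℂ) -
      ((2 ^ (1 / N : ℝ) : ℝ) : ℂ) * (powerTheta N (2 * A) 0 |u| : ℂ) := by
    funext u; simp only [thetaDiff]; push_cast; rfl
  rw [e]
  refine ⟨h1.sub (h2.const_mul _), ?_⟩
  funext y
  have i1 := (Real.fourierIntegral_convergent_iff y).mpr h1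
  have i2 := (Real.fourierIntegral_convergent_iff y).mpr (h2.const_mul ((2 ^ (1 / N : ℝ) : ℝ) : ℂ))
  have g1 := f1 y
  have g2 := f2 y
  rw [Real.fourier_eq] at g1 g2 ⊢
  simp only [Circle.smul_def, smul_eq_mul] at g1 g2 i1 i2 ⊢
  simp_rw [mul_sub]
  rw [integral_sub i1 i2, g1]
  simp_rw [mul_left_comm _ ((2 ^ (1 / N : ℝ) : ℝ) : ℂ)]
  rw [integral_const_mul, g2, cauchyDiff]
  push_cast
  rfl

/-- Fourier inversion at a point of continuity. The origin is excluded, since the theta-like series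
diverge there. -/
lemma fourier_cauchyDiff {N : ℕ} (hN : 0 < N) (hNe : Even N) {A u : ℝ} (hA : 0 < A)
    (hu : 0 < u) : 𝓕 (fun y : ℝ ↦ (cauchyDiff N A y : ℂ)) u = (thetaDiff N A 0 u : ℂ) := by
  have hN1 : 1 < N := by obtain ⟨M, hM⟩ := hNe; omega
  obtain ⟨h1, f1⟩ := fourier_thetaDiff hN1 hA
  have h2 : Integrable fun y : ℝ ↦ (cauchyDiff N A y : ℂ) := by
    simpa using integrable_pow_smul_cauchyDiff hN hNe hA 0
  have hc : ContinuousAt (fun u : ℝ ↦ (thetaDiff N A 0 |u| : ℂ)) (-u) := by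
    have h3 : ContinuousAt (thetaDiff N A 0) |(-u)| := by
      rw [abs_neg, abs_of_pos hu]
      exact (hasDerivAt_thetaDiff hN hA hu 0).continuousAt
    exact Complex.continuous_ofReal.continuousAt.comp
      (ContinuousAt.comp (f := fun u : ℝ ↦ |u|) h3 continuous_abs.continuousAt)
  have h := h1.fourierInv_fourier_eq (by rw [f1]; exact h2) hc
  rw [f1, Real.fourierInv_eq_fourier_neg, neg_neg, abs_neg, abs_of_pos hu] at h
  exact h

lemma iteratedDeriv_fourier_cauchyDiff {N : ℕ} (hN : 0 < N) (hNe : Even N) {A : ℝ} (hA : 0 < A)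
    (i : ℕ) {u : ℝ} (hu : 0 < u) :
    iteratedDeriv i (𝓕 (fun y : ℝ ↦ (cauchyDiff N A y : ℂ))) u = (thetaDiff N A i u : ℂ) := by
  induction i generalizing u with
  | zero => rw [iteratedDeriv_zero, fourier_cauchyDiff hN hNe hA hu]
  | succ i ih =>
    rw [iteratedDeriv_succ]
    have : iteratedDeriv i (𝓕 (fun y : ℝ ↦ (cauchyDiff N A y : ℂ))) =ᶠ[𝓝 u]
        fun v ↦ (thetaDiff N A i v : ℂ) := by
      filter_upwards [Ioi_mem_nhds hu] with v hv using ih hv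
    rw [this.deriv_eq]
    exact (hasDerivAt_thetaDiff hN hA hu i).ofReal_comp.deriv

/-- The function whose Poisson summation formula gives the modular relation. -/
noncomputable def modularKernel (N : ℕ) (A : ℝ) (μ : ℕ) (y : ℝ) : ℝ :=
  (-1) ^ μ * (2 * Real.pi * y) ^ (2 * μ) * cauchyDiff N A y

lemma modularKernel_neg (N : ℕ) (A : ℝ) (μ : ℕ) (y : ℝ) :
    modularKernel N A μ (-y) = modularKernel N A μ y := by
  rw [modularKernel, modularKernel, cauchyDiff_neg, mul_neg, (even_two_mul μ).neg_pow]

/-- Differentiating `2μ` times in `u` multiplies by `(-2πiy) ^ (2μ) = (-1) ^ μ (2πy) ^ (2μ)` under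
the transform, and brings down the factors `(A n ^ N) ^ (2μ)` needed for the weight with `m = -μ`.
-/
lemma fourier_modularKernel {N : ℕ} (hN : 0 < N) (hNe : Even N) {A : ℝ} (hA : 0 < A) (μ : ℕ)
    {u : ℝ} (hu : 0 < u) :
    𝓕 (fun y : ℝ ↦ (modularKernel N A μ y : ℂ)) u = (thetaDiff N A (2 * μ) u : ℂ) := by
  rw [← iteratedDeriv_fourier_cauchyDiff hN hNe hA (2 * μ) hu,
    Real.iteratedDeriv_fourier (N := ⊤) (fun n _ ↦ integrable_pow_smul_cauchyDiff hN hNe hA n) le_top]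
  refine congrFun (congrArg 𝓕 (funext fun y ↦ ?_)) u
  rw [modularKernel, smul_eq_mul]
  push_cast
  rw [pow_mul _ 2 μ, pow_mul _ 2 μ, ← mul_pow]
  congr 2
  linear_combination (-(2 * Real.pi * y : ℂ) ^ 2) * I_sq

lemma fourier_neg_of_even {f : ℝ → ℂ} (hf : ∀ x, f (-x) = f x) (u : ℝ) :
    𝓕 f (-u) = 𝓕 f u := by
  rw [← Real.fourierInv_eq_fourier_neg, Real.fourierInv_eq_fourier_comp_neg]
  simp_rw [hf]

lemma isBigO_cocompact_rpow_neg_two {f : ℝ → ℂ} {C : ℝ} (h : ∀ y, 1 ≤ |y| → ‖f y‖ ≤ C / |y| ^ 2) :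
    f =O[cocompact ℝ] fun x ↦ |x| ^ (-(2 : ℝ)) := by
  apply Asymptotics.IsBigO.of_bound C
  have : ∀ᶠ y in cocompact ℝ, 1 ≤ ‖y‖ := (tendsto_norm_cocompact_atTop).eventually_ge_atTop 1
  filter_upwards [this] with y hy
  rw [Real.norm_of_nonneg (by positivity), Real.rpow_neg (abs_nonneg _), Real.rpow_two]
  exact (h y hy)

/-- Even order makes every term nonnegative, so the sums may be interchanged; the geometric series
in `r` then rebuilds the Bose function. -/
lemma tsum_thetaDiff_aux {N : ℕ} (hN : 0 < N) {A : ℝ} (hA : 0 < A) (μ : ℕ) :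
    HasSum (fun r : ℕ+ ↦ powerTheta N A (2 * μ) r) (A ^ (2 * μ) * lambertSum N (-μ) A) := by
  set g : ℕ+ → ℕ+ → ℝ := fun n r ↦ (-(A * (n : ℝ) ^ N)) ^ (2 * μ) *
    Real.exp (-(A * (n : ℝ) ^ N) * r) with hg
  have hX : ∀ n : ℕ+, 0 < A * (n : ℝ) ^ N := fun n ↦ by positivity
  have hgn : ∀ n : ℕ+, HasSum (g n) (A ^ (2 * μ) * ((n : ℝ) ^ (-2 * (N : ℤ) * (-μ : ℤ)) *
      (1 / (Real.exp (A * (n : ℝ) ^ N) - 1)))) := by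
    intro n
    have h := bose_hasSum_geometric (z := ((A * (n : ℝ) ^ N : ℝ) : ℂ)) (by
      rw [Complex.ofReal_re]; exact hX n)
    rw [bose_ofReal] at h
    have h2 : HasSum (fun r : ℕ+ ↦ Real.exp (-(A * (n : ℝ) ^ N) * r))
        (1 / (Real.exp (A * (n : ℝ) ^ N) - 1)) := by
      rw [← Complex.hasSum_ofReal]
      convert! h using 1
      funext r
      push_cast
      congr 1
      ring
    have h3 := h2.mul_left ((-(A * (n : ℝ) ^ N)) ^ (2 * μ))
    convert! h3 using 1
    have e : (n : ℝ) ^ (-2 * (N : ℤ) * (-μ : ℤ)) = ((n : ℝ) ^ N) ^ (2 * μ) := by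
      rw [← pow_mul, ← zpow_natCast]
      congr 1
      push_cast
      ring
    rw [(even_two_mul μ).neg_pow, mul_pow, e, mul_assoc]
  have hg0 : 0 ≤ Function.uncurry g := fun p ↦ by
    simp only [Function.uncurry, hg, Pi.zero_apply, (even_two_mul μ).neg_pow]; positivity
  have hsum : Summable (Function.uncurry g) := by
    rw [summable_prod_of_nonneg hg0]
    refine ⟨fun n ↦ (hgn n).summable, ?_⟩
    have := (summable_lambertSum hN (-μ) hA).mul_left (A ^ (2 * μ))
    convert! this using 1
    funext n
    exact (hgn n).tsum_eq
  have hcomm := Summable.tsum_comm hsum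
  have h1 : Summable fun r : ℕ+ ↦ powerTheta N A (2 * μ) r := hsum.prod_symm.prod
  convert! h1.hasSum using 1
  rw [lambertSum, ← tsum_mul_left]
  trans ∑' n, ∑' r, g n r
  · congr 1
    funext n
    exact (hgn n).tsum_eq.symm
  · exact hcomm.symm

/-- Both the kernel and its transform are `O(|y| ^ (-2))`, and both are even. The zero frequency
stays an integral, because `fourier_modularKernel` covers only `u > 0`. -/
lemma poisson_cauchyDiff {N : ℕ} (hN : 0 < N) (hNe : Even N) {A : ℝ} (hA : 0 < A) (μ : ℕ) :
    (Summable fun k : ℕ+ ↦ modularKernel N A μ k) ∧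
    modularKernel N A μ 0 + 2 * ∑' k : ℕ+, modularKernel N A μ k =
      (∫ y : ℝ, modularKernel N A μ y) + 2 * (A ^ (2 * μ) * lambertSum N (-μ) A -
        2 ^ (1 / N : ℝ) * ((2 * A) ^ (2 * μ) * lambertSum N (-μ) (2 * A))) := by
  have hN1 : 1 < N := by obtain ⟨M, hM⟩ := hNe; omega
  have hpi := Real.pi_pos
  set f : ℝ → ℂ := fun y ↦ (modularKernel N A μ y : ℂ) with hf
  have hcont : Continuous f := by
    have := continuous_cauchyDiff hN1 hA
    simp only [hf, modularKernel]
    fun_prop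
  have hfe : ∀ x, f (-x) = f x := fun x ↦ by simp only [hf, modularKernel_neg]
  obtain ⟨C, hC, hb⟩ := abs_cauchyDiff_le hN hNe hA (2 * μ + 2)
  have hfb : ∀ y, 1 ≤ |y| → ‖f y‖ ≤ ((2 * Real.pi) ^ (2 * μ) * C) / |y| ^ 2 := by
    intro y hy
    have hy0 : 0 < |y| := by linarith
    simp only [hf, modularKernel]
    rw [Complex.norm_real, Real.norm_eq_abs, abs_mul, abs_mul, abs_pow, abs_neg, abs_one, one_pow,
      one_mul, abs_pow, abs_mul, abs_of_pos (by positivity : 0 < 2 * Real.pi)]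
    calc _ ≤ (2 * Real.pi * |y|) ^ (2 * μ) * (C / |y| ^ (2 * μ + 2)) := by
          gcongr
          exact hb y hy
      _ = _ := by rw [mul_pow, pow_add]; field_simp
  obtain ⟨C1, hC1, hb1⟩ := abs_powerTheta_le hN hA (2 * μ) (le_refl 2)
  obtain ⟨C2, hC2, hb2⟩ := abs_powerTheta_le hN (A := 2 * A) (by positivity) (2 * μ) (le_refl 2)
  have hFpos : ∀ y, 1 ≤ y → ‖𝓕 f y‖ ≤ (C1 + 2 ^ (1 / N : ℝ) * C2) / y ^ 2 := by
    intro y hy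
    have hy0 : 0 < y := by linarith
    rw [fourier_modularKernel hN hNe hA μ hy0, Complex.norm_real, Real.norm_eq_abs, thetaDiff]
    have hpow : y ^ 2 ≤ y ^ (2 * μ + 2) := pow_le_pow_right₀ hy (by omega)
    refine (abs_sub _ _).trans ?_
    rw [abs_mul, abs_of_pos (by positivity : (0 : ℝ) < 2 ^ (1 / N : ℝ)), add_div, mul_div_assoc]
    gcongr
    · exact (hb1 y hy0).trans (by gcongr)
    · exact (hb2 y hy0).trans (by gcongr)
  have hFb : ∀ y, 1 ≤ |y| → ‖𝓕 f y‖ ≤ (C1 + 2 ^ (1 / N : ℝ) * C2) / |y| ^ 2 := by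
    intro y hy
    have := hFpos |y| hy
    rcases abs_choice y with h | h
    · rwa [h] at this ⊢
    · rw [h, fourier_neg_of_even hfe] at this; rwa [h]
  have hO1 := isBigO_cocompact_rpow_neg_two hfb
  have hO2 := isBigO_cocompact_rpow_neg_two hFb
  have hP := Real.tsum_eq_tsum_fourier_of_rpow_decay hcont one_lt_two hO1 hO2 0
  have hsum_int : ∀ {g : ℝ → ℂ} {K : ℝ}, (∀ y, 1 ≤ |y| → ‖g y‖ ≤ K / |y| ^ 2) →
      Summable fun n : ℤ ↦ g n := by
    intro g K hg
    have h0 : Summable fun n : ℤ ↦ K * (1 / (n : ℝ) ^ 2) :=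
      (Real.summable_one_div_int_pow.mpr one_lt_two).mul_left K
    refine Summable.of_norm_bounded_eventually h0 ?_
    have : ({0} : Set ℤ).Finite := Set.finite_singleton 0
    filter_upwards [this.compl_mem_cofinite] with n hn
    have hn0 : n ≠ 0 := hn
    have h1 : (1 : ℝ) ≤ |(n : ℝ)| := by
      rw [← Int.cast_abs]; exact_mod_cast Int.one_le_abs hn0
    refine (hg n h1).trans (le_of_eq ?_)
    rw [sq_abs]; ring
  have s1 := hsum_int hfb
  have s2 := hsum_int hFb
  simp only [zero_add, QuotientAddGroup.mk_zero, fourier_eval_zero, mul_one] at hP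
  rw [tsum_int_eq_zero_add_two_mul_tsum_pnat (f := fun n : ℤ ↦ f n)
      (fun n ↦ by simp only [Int.cast_neg, hfe]) s1,
    tsum_int_eq_zero_add_two_mul_tsum_pnat (f := fun n : ℤ ↦ 𝓕 f n)
      (fun n ↦ by simp only [Int.cast_neg, fourier_neg_of_even hfe]) s2] at hP
  have hF0 : 𝓕 f ((0 : ℤ) : ℝ) = ((∫ y : ℝ, modularKernel N A μ y : ℝ) : ℂ) := by
    rw [Real.fourier_real_eq_integral_exp_smul]
    simp only [hf, Int.cast_zero, mul_zero, Complex.ofReal_zero, zero_mul, Complex.exp_zero, one_smul]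
    exact integral_ofReal
  have hFr : ∑' r : ℕ+, 𝓕 f (((r : ℕ) : ℤ) : ℝ) = ((A ^ (2 * μ) * lambertSum N (-μ) A -
        2 ^ (1 / N : ℝ) * ((2 * A) ^ (2 * μ) * lambertSum N (-μ) (2 * A)) : ℝ) : ℂ) := by
    have h := (tsum_thetaDiff_aux hN hA μ).sub
      ((tsum_thetaDiff_aux hN (A := 2 * A) (by positivity) μ).mul_left (2 ^ (1 / N : ℝ)))
    rw [← h.tsum_eq, Complex.ofReal_tsum]
    congr 1
    funext r
    rw [Int.cast_natCast, fourier_modularKernel hN hNe hA μ (by exact_mod_cast r.pos)]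
    rfl
  have hsk : Summable fun k : ℕ+ ↦ modularKernel N A μ k := by
    rw [← Complex.summable_ofReal]
    have := s1.comp_injective (i := fun k : ℕ+ ↦ ((k : ℕ) : ℤ))
      (fun a b h ↦ PNat.coe_injective (Int.ofNat_injective h))
    convert! this using 1
  refine ⟨hsk, ?_⟩
  have hfk : ∑' k : ℕ+, f (((k : ℕ) : ℤ) : ℝ) = ((∑' k : ℕ+, modularKernel N A μ k : ℝ) : ℂ) := by
    rw [Complex.ofReal_tsum]
    congr 1
  rw [hF0, hFr, hfk] at hP
  apply Complex.ofReal_injective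
  push_cast at hP ⊢
  simpa [hf] using hP

/-! ### The zero-frequency integral. -/

lemma two_pi_mul_rotation_re_pos {N j : ℕ} (hj : j < N / 2) {t : ℝ} (ht : 0 < t) :
    0 < (2 * Real.pi * t * unitRotation N j : ℂ).re := by
  have e : (2 * Real.pi * t * unitRotation N j : ℂ) =
      ((2 * Real.pi * t : ℝ) : ℂ) * unitRotation N j := by push_cast; ring
  rw [e, Complex.re_ofReal_mul]
  have := unitRotation_re_pos hj
  have := Real.pi_pos
  positivity

lemma continuousOn_bose_rotation {N j : ℕ} (hj : j < N / 2) :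
    ContinuousOn (fun t : ℝ ↦ bose (2 * Real.pi * t * unitRotation N j)) (Ioi 0) := by
  unfold bose
  refine ContinuousOn.div continuousOn_const (by fun_prop) fun t ht ↦ ?_
  exact exp_sub_one_ne_zero_of_re_pos (two_pi_mul_rotation_re_pos hj ht)

lemma continuousOn_rotatedBoseSum (N : ℕ) : ContinuousOn (rotatedBoseSum N) (Ioi 0) := by
  refine continuousOn_finsetSum _ fun j hj ↦ ?_
  have h := continuousOn_bose_rotation (Finset.mem_range.mp hj)
  exact continuousOn_const.mul
    (Complex.continuous_im.comp_continuousOn (continuousOn_const.mul h))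

/-- The evaluation of `cauchySum` is read backwards at `A = 1`: the left side is continuous, hence
bounded on `[0, 1]`, and the coefficient `b / b ^ N` on the right is at least `1`. No analysis of
the poles at `b = 0` is needed. -/
lemma abs_rotatedBoseSum_le_of_le_one {N : ℕ} (hN : 0 < N) (hNe : Even N) :
    ∃ K : ℝ, 0 ≤ K ∧ ∀ b : ℝ, 0 < b → b ≤ 1 → |rotatedBoseSum N b| ≤ K := by
  have hN1 : 1 < N := by obtain ⟨M, hM⟩ := hNe; omega
  have hpi := Real.pi_pos
  obtain ⟨K, hK⟩ := isCompact_Icc.exists_bound_of_continuousOn (s := Icc (0 : ℝ) 1)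
    (continuous_cauchySum hN1 one_pos).continuousOn
  have hK0 : 0 ≤ K := (norm_nonneg _).trans (hK 0 (by simp))
  refine ⟨N / (4 * Real.pi) * K + |rotationImSum N / 2|, by positivity, fun b hb hb1 ↦ ?_⟩
  have h := (cauchySum_hasSum_aux hN hNe one_pos hb).tsum_eq
  have hbN : b ^ N ≤ 1 := pow_le_one₀ hb.le hb1
  have hS := hK (b ^ N / (2 * Real.pi)) ⟨by positivity, by
    rw [div_le_one (by positivity)]; nlinarith [Real.pi_gt_three]⟩
  rw [cauchySum, show 2 * Real.pi * (b ^ N / (2 * Real.pi)) = 1 * b ^ N by field_simp, h,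
    Real.norm_eq_abs] at hS
  have hc : |(-(4 * Real.pi * (-1) ^ (N / 2) / N) * (b / (1 * b ^ N)))| =
      4 * Real.pi / N * (b / b ^ N) := by
    rw [abs_mul, abs_neg, abs_div, abs_mul, abs_pow, abs_neg, abs_one, one_pow, one_mul, mul_one,
      abs_of_pos (by positivity : 0 < 4 * Real.pi), Nat.abs_cast, abs_of_pos (by positivity)]
  have hb2 : 1 ≤ b / b ^ N := by
    rw [one_le_div (by positivity)]
    exact pow_le_of_le_one hb.le hb1 hN.ne'
  rw [abs_mul, hc] at hS
  have hNR : (0 : ℝ) < N := by exact_mod_cast hN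
  have h2 : 4 * Real.pi / N * |rotatedBoseSum N b + rotationImSum N / 2| ≤ K := by
    refine le_trans ?_ hS
    have : 4 * Real.pi / N * 1 ≤ 4 * Real.pi / N * (b / b ^ N) := by gcongr
    rw [mul_one] at this
    gcongr
  have h3 : |rotatedBoseSum N b + rotationImSum N / 2| ≤ N / (4 * Real.pi) * K := by
    rw [div_mul_eq_mul_div, le_div_iff₀ (by positivity)]
    rw [div_mul_eq_mul_div, div_le_iff₀ hNR] at h2
    linarith
  calc |rotatedBoseSum N b| = |(rotatedBoseSum N b + rotationImSum N / 2) - rotationImSum N / 2| := by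
        ring_nf
    _ ≤ _ := (abs_sub _ _).trans (by linarith)

lemma integrableOn_pow_mul_rotatedBoseSum {N : ℕ} (hN : 0 < N) (hNe : Even N) (n : ℕ) :
    IntegrableOn (fun t ↦ t ^ n * rotatedBoseSum N t) (Ioi 0) := by
  obtain ⟨K, hK, hb1⟩ := abs_rotatedBoseSum_le_of_le_one hN hNe
  obtain ⟨C, hC, hb2⟩ := abs_rotatedBoseSum_le N (p := n + 2) (by omega)
  refine (integrable_inv_one_add_sq.const_mul (2 * (K + C))).integrableOn.mono'
    (ContinuousOn.aestronglyMeasurable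
      ((continuousOn_id.pow n).mul (continuousOn_rotatedBoseSum N)) measurableSet_Ioi)
    ((ae_restrict_iff' measurableSet_Ioi).mpr (.of_forall fun t ht ↦ ?_))
  have ht0 : 0 < t := ht
  rw [Real.norm_eq_abs, abs_mul, abs_of_pos (by positivity : 0 < t ^ n)]
  by_cases h1 : t ≤ 1
  · have h2 : (2 : ℝ)⁻¹ ≤ (1 + t ^ 2)⁻¹ := by
      apply inv_anti₀ (by positivity)
      have : t ^ 2 ≤ 1 := pow_le_one₀ ht0.le h1
      linarith
    calc t ^ n * |rotatedBoseSum N t| ≤ 1 * K := by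
          gcongr
          · exact pow_le_one₀ ht0.le h1
          · exact hb1 t ht0 h1
      _ ≤ 2 * (K + C) * 2⁻¹ := by linarith
      _ ≤ _ := by gcongr
  · push Not at h1
    calc t ^ n * |rotatedBoseSum N t| ≤ t ^ n * (C / t ^ (n + 2)) := by
          gcongr; exact hb2 t ht0
      _ = 2 * C * (2 * t ^ 2)⁻¹ := by rw [pow_add]; field_simp
      _ ≤ 2 * (K + C) * (1 + t ^ 2)⁻¹ := by
        gcongr
        · linarith
        · have : 1 ≤ t ^ 2 := one_le_pow₀ h1.le
          linarith

lemma integrableOn_pow_mul_exp_neg {c : ℂ} (hc : 0 < c.re) (n : ℕ) :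
    IntegrableOn (fun t : ℝ ↦ (t : ℂ) ^ n * Complex.exp (-c * t)) (Ioi 0) := by
  refine (integrable_norm_iff (by apply Continuous.aestronglyMeasurable; fun_prop)).mp ?_
  have h := integrableOn_rpow_mul_exp_neg_mul_rpow (p := 1) (s := n) (b := c.re)
    (by have := Nat.cast_nonneg (α := ℝ) n; linarith) one_pos hc
  refine h.congr_fun (fun t ht ↦ ?_) measurableSet_Ioi
  have ht0 : 0 < t := ht
  simp [Complex.norm_exp, abs_of_pos ht0]

lemma integral_pow_mul_exp_neg {c : ℂ} (hc : 0 < c.re) (n : ℕ) :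
    ∫ t : ℝ in Ioi 0, (t : ℂ) ^ n * Complex.exp (-c * t) = n.factorial / c ^ (n + 1) := by
  have hc0 : c ≠ 0 := by rintro rfl; simp at hc
  induction n with
  | zero =>
    simp only [pow_zero, one_mul]
    rw [integral_exp_mul_complex_Ioi (by simpa using hc)]
    simp
  | succ n ih =>
    have hd : ∀ t : ℝ, HasDerivAt (fun t : ℝ ↦ (t : ℂ) ^ (n + 1) * Complex.exp (-c * t))
        ((n + 1) * ((t : ℂ) ^ n * Complex.exp (-c * t)) -
          c * ((t : ℂ) ^ (n + 1) * Complex.exp (-c * t))) t := by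
      intro t
      have h1 : HasDerivAt (fun z : ℂ ↦ z ^ (n + 1) * Complex.exp (-c * z))
          (((n + 1 : ℕ) * (t : ℂ) ^ n) * Complex.exp (-c * t) +
            (t : ℂ) ^ (n + 1) * (Complex.exp (-c * t) * (-c * 1))) (t : ℂ) :=
        (hasDerivAt_pow (n + 1) (t : ℂ)).mul (((hasDerivAt_id (t : ℂ)).const_mul (-c)).cexp)
      convert! h1.comp_ofReal using 1
      push_cast
      ring
    have hlim : Tendsto (fun t : ℝ ↦ (t : ℂ) ^ (n + 1) * Complex.exp (-c * t)) atTop (𝓝 0) := by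
      rw [tendsto_zero_iff_norm_tendsto_zero]
      have h := Real.tendsto_pow_mul_exp_neg_atTop_nhds_zero (n + 1)
      have h2 := (h.comp (tendsto_id.const_mul_atTop hc)).const_mul (c.re ^ (n + 1))⁻¹
      rw [mul_zero] at h2
      refine h2.congr' ?_
      filter_upwards [eventually_gt_atTop 0] with t ht
      simp only [Function.comp, id, norm_mul, norm_pow, Complex.norm_real, Complex.norm_exp,
        Real.norm_eq_abs, abs_of_pos ht, mul_pow]
      rw [← mul_assoc, inv_mul_cancel_left₀ (by positivity)]
      congr 2
      simp
    have hi := integral_Ioi_of_hasDerivAt_of_tendsto (hd 0).continuousAt.continuousWithinAt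
      (fun t _ ↦ hd t) (((integrableOn_pow_mul_exp_neg hc n).const_mul _).sub
        ((integrableOn_pow_mul_exp_neg hc (n + 1)).const_mul _)) hlim
    rw [integral_sub ((integrableOn_pow_mul_exp_neg hc n).const_mul _)
        ((integrableOn_pow_mul_exp_neg hc (n + 1)).const_mul _), integral_const_mul,
      integral_const_mul, ih] at hi
    have hi2 : c * ∫ t : ℝ in Ioi 0, (t : ℂ) ^ (n + 1) * Complex.exp (-c * t) =
        (n + 1) * (n.factorial / c ^ (n + 1)) := by
      rw [Complex.ofReal_zero, zero_pow n.succ_ne_zero, zero_mul, sub_zero] at hi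
      linear_combination -hi
    apply mul_left_cancel₀ hc0
    rw [hi2, Nat.factorial_succ]
    push_cast
    field_simp
    ring

lemma integral_norm_pow_mul_exp_neg {c : ℂ} (hc : 0 < c.re) (n : ℕ) :
    ∫ t : ℝ in Ioi 0, ‖(t : ℂ) ^ n * Complex.exp (-c * t)‖ = n.factorial / c.re ^ (n + 1) := by
  have h := integral_pow_mul_exp_neg (c := (c.re : ℂ)) (by simpa using hc) n
  apply Complex.ofReal_injective
  push_cast
  rw [← h, ← integral_complex_ofReal]
  refine setIntegral_congr_fun measurableSet_Ioi fun t ht ↦ ?_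
  have ht0 : 0 < t := ht
  simp [Complex.norm_exp, abs_of_pos ht0]

/-- Termwise integration of the geometric series. The norms of the terms integrate to multiples of
`r ^ (-(n+1))`, which explains `n ≠ 0`. -/
lemma hasSum_integral_pow_mul_bose {N j : ℕ} (hj : j < N / 2) {n : ℕ} (hn : n ≠ 0) :
    IntegrableOn (fun t : ℝ ↦ (t : ℂ) ^ n * bose (2 * Real.pi * t * unitRotation N j)) (Ioi 0) ∧
    HasSum (fun r : ℕ+ ↦ (n.factorial / (r * (2 * Real.pi * unitRotation N j)) ^ (n + 1) : ℂ))
      (∫ t : ℝ in Ioi 0, (t : ℂ) ^ n * bose (2 * Real.pi * t * unitRotation N j)) := by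
  set c : ℂ := 2 * Real.pi * unitRotation N j with hcdef
  have hc : 0 < c.re := by
    have := two_pi_mul_rotation_re_pos hj one_pos
    simpa [hcdef] using this
  have hrc : ∀ r : ℕ+, 0 < ((r : ℂ) * c).re := by
    intro r
    have : ((r : ℂ) * c).re = r * c.re := by
      rw [← Complex.ofReal_natCast, Complex.re_ofReal_mul]
    rw [this]
    positivity
  have hrc' : ∀ r : ℕ+, ((r : ℂ) * c).re = r * c.re := by
    intro r
    rw [← Complex.ofReal_natCast, Complex.re_ofReal_mul]
  have hS : Summable fun r : ℕ+ ↦ ∫ t : ℝ in Ioi 0, ‖(t : ℂ) ^ n * Complex.exp (-(r * c) * t)‖ := by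
    simp_rw [integral_norm_pow_mul_exp_neg (hrc _), hrc']
    convert! (summable_pnat_pow_inv (s := n + 1) (by omega)).mul_left
      ((n.factorial : ℝ) / c.re ^ (n + 1)) using 1
    funext r
    rw [mul_pow]
    field_simp
  have h := hasSum_integral_of_summable_integral_norm (μ := volume.restrict (Ioi 0))
    (F := fun (r : ℕ+) (t : ℝ) ↦ (t : ℂ) ^ n * Complex.exp (-(r * c) * t))
    (fun r ↦ integrableOn_pow_mul_exp_neg (hrc r) n) hS
  simp_rw [integral_pow_mul_exp_neg (hrc _)] at h
  have e : ∀ t ∈ Ioi (0 : ℝ), ∑' r : ℕ+, (t : ℂ) ^ n * Complex.exp (-(r * c) * t) =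
      (t : ℂ) ^ n * bose (2 * Real.pi * t * unitRotation N j) := by
    intro t ht
    rw [tsum_mul_left, ← (bose_hasSum_geometric (two_pi_mul_rotation_re_pos hj ht)).tsum_eq]
    congr 2
    funext r
    congr 1
    rw [hcdef]
    ring
  rw [setIntegral_congr_fun measurableSet_Ioi e] at h
  refine ⟨?_, h⟩
  have hpos := unitRotation_re_pos hj
  have hpi := Real.pi_pos
  refine (integrable_norm_iff (ContinuousOn.aestronglyMeasurable ((by fun_prop : ContinuousOn
    (fun t : ℝ ↦ (t : ℂ) ^ n) (Ioi 0)).mul (continuousOn_bose_rotation hj)) measurableSet_Ioi)).mp ?_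
  have hre : ∀ t : ℝ, (2 * Real.pi * t * unitRotation N j : ℂ).re = c.re * t := by
    intro t
    have : (2 * Real.pi * t * unitRotation N j : ℂ) = (t : ℂ) * c := by rw [hcdef]; ring
    rw [this, Complex.re_ofReal_mul, mul_comm]
  refine (integrable_inv_one_add_sq.const_mul
    (2 * (1 / c.re + (n + 2).factorial / c.re ^ (n + 2)))).integrableOn.mono'
    (ContinuousOn.aestronglyMeasurable ((by fun_prop : ContinuousOn
    (fun t : ℝ ↦ (t : ℂ) ^ n) (Ioi 0)).mul (continuousOn_bose_rotation hj)) measurableSet_Ioi).norm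
    ((ae_restrict_iff' measurableSet_Ioi).mpr (.of_forall fun t ht ↦ ?_))
  have ht0 : 0 < t := ht
  have hb1 := norm_bose_le (two_pi_mul_rotation_re_pos hj ht0) one_ne_zero
  have hb2 := norm_bose_le (two_pi_mul_rotation_re_pos hj ht0) (p := n + 2) (by omega)
  rw [hre] at hb1 hb2
  rw [norm_norm, Pi.mul_apply, norm_mul, norm_pow, Complex.norm_real, Real.norm_of_nonneg ht0.le]
  have hq : 0 < (n + 2).factorial / c.re ^ (n + 2) := by positivity
  have hq' : 0 < 1 / c.re := by positivity
  by_cases h1 : t ≤ 1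
  · have h2 : (2 : ℝ)⁻¹ ≤ (1 + t ^ 2)⁻¹ := by
      apply inv_anti₀ (by positivity)
      have : t ^ 2 ≤ 1 := pow_le_one₀ ht0.le h1
      linarith
    have h3 : t ^ n ≤ t := pow_le_of_le_one ht0.le h1 hn
    calc t ^ n * ‖bose (2 * Real.pi * t * unitRotation N j)‖ ≤
          t * ((1 : ℕ).factorial / (c.re * t) ^ 1) := by gcongr
      _ = 1 / c.re := by simp; field_simp
      _ ≤ 2 * (1 / c.re + (n + 2).factorial / c.re ^ (n + 2)) * 2⁻¹ := by linarith
      _ ≤ _ := by gcongr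
  · push Not at h1
    calc t ^ n * ‖bose (2 * Real.pi * t * unitRotation N j)‖ ≤
          t ^ n * ((n + 2).factorial / (c.re * t) ^ (n + 2)) := by gcongr
      _ = 2 * ((n + 2).factorial / c.re ^ (n + 2)) * (2 * t ^ 2)⁻¹ := by
        rw [mul_pow, pow_add t]; field_simp
      _ ≤ _ := by
        gcongr
        · linarith
        · have : 1 ≤ t ^ 2 := one_le_pow₀ h1.le
          linarith

/-- After termwise integration the point `w` enters only through `w / w ^ (2Nμ+1)`, and `w ^ (2Nμ) =
(-1) ^ μ` is real, so every imaginary part vanishes. -/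
lemma integral_pow_mul_rotatedBoseSum_eq_zero {N : ℕ} (hN : 0 < N) {μ : ℕ} (hμ : μ ≠ 0) :
    ∫ t in Ioi (0 : ℝ), t ^ (2 * N * μ) * rotatedBoseSum N t = 0 := by
  have hn : 2 * N * μ ≠ 0 := by positivity
  have e : ∀ t ∈ Ioi (0 : ℝ), t ^ (2 * N * μ) * rotatedBoseSum N t =
      ∑ j ∈ Finset.range (N / 2), ((-1) ^ j * ((unitRotation N j * ((t : ℂ) ^ (2 * N * μ) *
        bose (2 * Real.pi * t * unitRotation N j))).im)) := by
    intro t _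
    rw [rotatedBoseSum, Finset.mul_sum]
    apply Finset.sum_congr rfl
    intro j _
    rw [mul_left_comm (unitRotation N j), ← Complex.ofReal_pow, Complex.im_ofReal_mul]
    ring
  rw [setIntegral_congr_fun measurableSet_Ioi e, integral_finsetSum]
  · apply Finset.sum_eq_zero
    intro j hj
    rw [Finset.mem_range] at hj
    obtain ⟨hi, hs⟩ := hasSum_integral_pow_mul_bose hj hn
    rw [integral_const_mul]
    have h1 : ∫ t in Ioi (0 : ℝ), (unitRotation N j * ((t : ℂ) ^ (2 * N * μ) *
        bose (2 * Real.pi * t * unitRotation N j))).im =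
        (unitRotation N j * ∫ t in Ioi (0 : ℝ), ((t : ℂ) ^ (2 * N * μ) *
        bose (2 * Real.pi * t * unitRotation N j))).im := by
      rw [← integral_const_mul]
      exact integral_im (hi.const_mul _)
    rw [h1]
    have h2 := Complex.hasSum_im (hs.mul_left (unitRotation N j))
    have h3 : ∀ r : ℕ+, (unitRotation N j * ((2 * N * μ).factorial /
        (r * (2 * Real.pi * unitRotation N j)) ^ (2 * N * μ + 1) : ℂ)).im = 0 := by
      intro r
      have hw := unitRotation_ne_zero N j
      have h4 : unitRotation N j ^ (2 * N * μ) = (-1) ^ μ := by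
        rw [show 2 * N * μ = N * (2 * μ) by ring, pow_mul, unitRotation_pow_self hN.ne', pow_mul,
          mul_pow, I_sq, ← pow_mul, mul_comm j 2, pow_mul]
        simp
      have h5 : (unitRotation N j * ((2 * N * μ).factorial /
        (r * (2 * Real.pi * unitRotation N j)) ^ (2 * N * μ + 1) : ℂ)) =
        (((2 * N * μ).factorial / ((r * (2 * Real.pi)) ^ (2 * N * μ + 1) * (-1) ^ μ) : ℝ) : ℂ) := by
        rw [← mul_assoc, mul_pow _ (unitRotation N j), pow_succ (unitRotation N j), h4]
        push_cast
        field_simp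
      rw [h5, Complex.ofReal_im]
    simp_rw [h3] at h2
    rw [← h2.tsum_eq]
    simp
  · intro j hj
    obtain ⟨hi, -⟩ := hasSum_integral_pow_mul_bose (Finset.mem_range.mp hj) hn
    exact ((hi.const_mul (unitRotation N j)).im).const_mul _

lemma sum_neg_one_pow_mul_odd (M : ℕ) :
    ∑ j ∈ Finset.range M, (-1 : ℝ) ^ j * (2 * j + 1) = -(-1) ^ M * M := by
  induction M with
  | zero => simp
  | succ M ih => rw [Finset.sum_range_succ, ih]; push_cast; ring

lemma arg_unitRotation {N j : ℕ} (hj : j < N / 2) :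
    Complex.arg (unitRotation N j) = Real.pi * (2 * j + 1) / (2 * N) := by
  have h1 := unitRotation_angle_lt hj
  have h2 := unitRotation_angle_pos hj
  rw [unitRotation_eq, Complex.arg_exp_mul_I, toIocMod_eq_self]
  constructor <;> linarith

/-- The difference quotient at `0` tends to `w`, and dividing by `t > 0` does not change the
argument. -/
lemma arg_one_sub_exp_tendsto_zero {w : ℂ} (hw : 0 < w.re) :
    Tendsto (fun t : ℝ ↦ Complex.arg (1 - Complex.exp (-(w * t)))) (𝓝[>] 0) (𝓝 (Complex.arg w)) := by
  have hd : HasDerivAt (fun t : ℝ ↦ 1 - Complex.exp (-(w * t))) w 0 := by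
    have h1 : HasDerivAt (fun z : ℂ ↦ 1 - Complex.exp (-(w * z)))
        (-(Complex.exp (-(w * ((0 : ℝ) : ℂ))) * -(w * 1))) ((0 : ℝ) : ℂ) :=
      (((hasDerivAt_id ((0 : ℝ) : ℂ)).const_mul w).neg.cexp).const_sub 1
    convert! h1.comp_ofReal using 1
    simp
  have h2 := (hasDerivAt_iff_tendsto_slope_zero.mp hd).mono_left
    (nhdsWithin_mono 0 (fun x (hx : 0 < x) ↦ hx.ne'))
  have h3 := (Complex.continuousAt_arg (Or.inl hw)).tendsto.comp h2
  refine h3.congr' ?_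
  filter_upwards [self_mem_nhdsWithin] with t ht
  have ht0 : 0 < t := ht
  simp only [Function.comp, zero_add, Complex.ofReal_zero, mul_zero, neg_zero, Complex.exp_zero,
    sub_self, sub_zero, Complex.real_smul]
  rw [Complex.arg_real_mul _ (inv_pos.mpr ht0)]

lemma arg_one_sub_exp_tendsto_atTop {w : ℂ} (hw : 0 < w.re) :
    Tendsto (fun t : ℝ ↦ Complex.arg (1 - Complex.exp (-(w * t)))) atTop (𝓝 0) := by
  have h1 : Tendsto (fun t : ℝ ↦ Complex.exp (-(w * t))) atTop (𝓝 0) := by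
    rw [Complex.tendsto_exp_nhds_zero_iff]
    simpa using (tendsto_id.const_mul_atTop hw)
  have h2 : Tendsto (fun t : ℝ ↦ 1 - Complex.exp (-(w * t))) atTop (𝓝 1) := by
    simpa using h1.const_sub 1
  have h3 := (Complex.continuousAt_arg (x := 1) (Or.inl (by simp))).tendsto.comp h2
  rw [Complex.arg_one] at h3
  exact h3

/-- The imaginary part of `d/dt log (1 - exp (-wt)) = w / (exp (wt) - 1)`. -/
lemma hasDerivAt_arg_one_sub_exp {w : ℂ} (hw : 0 < w.re) {t : ℝ} (ht : 0 < t) :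
    HasDerivAt (fun t : ℝ ↦ Complex.arg (1 - Complex.exp (-(w * t)))) (w * bose (w * t)).im t := by
  have hre : 0 < (w * t).re := by simpa using mul_pos hw ht
  have hlt : ‖Complex.exp (-(w * t))‖ < 1 := by
    rw [Complex.norm_exp, Real.exp_lt_one_iff]; simpa using hre
  have hmem : 1 - Complex.exp (-(w * t)) ∈ Complex.slitPlane := by
    left
    have := (Complex.re_le_norm (Complex.exp (-(w * t)))).trans_lt hlt
    simpa using this
  have h1 : HasDerivAt (fun z : ℂ ↦ 1 - Complex.exp (-(w * z)))
      (-(Complex.exp (-(w * t)) * -(w * 1))) (t : ℂ) :=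
    (((hasDerivAt_id (t : ℂ)).const_mul w).neg.cexp).const_sub 1
  have h2 := (h1.clog hmem).comp_ofReal
  have h3 := Complex.imCLM.hasFDerivAt.comp_hasDerivAt t h2
  have e : (fun t : ℝ ↦ Complex.arg (1 - Complex.exp (-(w * t)))) =
      Complex.imCLM ∘ fun t : ℝ ↦ Complex.log (1 - Complex.exp (-(w * t))) := by
    funext t
    exact (Complex.log_im _).symm
  rw [e]
  refine h3.congr_deriv ?_
  change (-(Complex.exp (-(w * t)) * -(w * 1)) / (1 - Complex.exp (-(w * t)))).im =
    (w * bose (w * t)).im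
  congr 1
  have := exp_sub_one_ne_zero_of_re_pos hre
  rw [bose, Complex.exp_neg]
  have h0 := Complex.exp_ne_zero (w * t)
  have h5 : 1 - (Complex.exp (w * t))⁻¹ ≠ 0 := by
    intro h; apply this; field_simp at h; simpa using h
  field_simp

/-- For `μ = 0` termwise integration is unavailable, so an antiderivative is used. Its limit at `0`
is `∑ (-1) ^ j arg(w_j) / (2π) = ∑ (-1) ^ j (2j+1) / (4N)`, and it vanishes at infinity. -/
lemma integral_rotatedBoseSum {N : ℕ} (hN : 0 < N) (hNe : Even N) :
    ∫ t in Ioi (0 : ℝ), rotatedBoseSum N t = (-1) ^ (N / 2) / 8 := by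
  have hpi := Real.pi_pos
  set c : ℕ → ℂ := fun j ↦ 2 * Real.pi * unitRotation N j with hcdef
  have hc : ∀ j ∈ Finset.range (N / 2), 0 < (c j).re := by
    intro j hj
    have := two_pi_mul_rotation_re_pos (Finset.mem_range.mp hj) one_pos
    simpa [hcdef] using this
  set L : ℝ := ∑ j ∈ Finset.range (N / 2), (-1) ^ j * ((2 * Real.pi)⁻¹ * Complex.arg (c j)) with hL
  set G : ℝ → ℝ := fun t ↦ ∑ j ∈ Finset.range (N / 2),
    (-1) ^ j * ((2 * Real.pi)⁻¹ * Complex.arg (1 - Complex.exp (-(c j * t)))) with hG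
  -- The formula for `G` gives `arg 0 = 0` at the origin, not the limit `L`; the update restores
  -- right-continuity.
  have hd : ∀ t ∈ Ioi (0 : ℝ), HasDerivAt (Function.update G 0 L) (rotatedBoseSum N t) t := by
    intro t ht
    have ht0 : (0 : ℝ) < t := ht
    have h1 : HasDerivAt G (rotatedBoseSum N t) t := by
      refine HasDerivAt.fun_sum fun j hj ↦ ?_
      have h2 := ((hasDerivAt_arg_one_sub_exp (hc j hj) ht0).const_mul (2 * Real.pi)⁻¹).const_mul
        ((-1) ^ j)
      convert! h2 using 2
      have e1 : c j * t = 2 * Real.pi * t * unitRotation N j := by simp only [hcdef]; ring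
      have e2 : c j * bose (c j * t) = ((2 * Real.pi : ℝ) : ℂ) *
          (unitRotation N j * bose (2 * Real.pi * t * unitRotation N j)) := by
        rw [e1]; simp only [hcdef]; push_cast; ring
      rw [e2, Complex.im_ofReal_mul]
      field_simp
    refine h1.congr_of_eventuallyEq ?_
    filter_upwards [isOpen_ne.mem_nhds ht0.ne'] with v hv
    exact Function.update_of_ne hv _ _
  have hcont : ContinuousWithinAt (Function.update G 0 L) (Ici 0) 0 := by
    rw [continuousWithinAt_update_same, Ici_sdiff_left]
    refine tendsto_finsetSum _ fun j hj ↦ ?_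
    exact ((arg_one_sub_exp_tendsto_zero (hc j hj)).const_mul _).const_mul _
  have htop : Tendsto (Function.update G 0 L) atTop (𝓝 0) := by
    have h1 : Tendsto G atTop (𝓝 (∑ j ∈ Finset.range (N / 2),
        (-1 : ℝ) ^ j * ((2 * Real.pi)⁻¹ * 0))) :=
      tendsto_finsetSum _ fun j hj ↦
        ((arg_one_sub_exp_tendsto_atTop (hc j hj)).const_mul _).const_mul _
    simp only [mul_zero, Finset.sum_const_zero] at h1
    refine h1.congr' ?_
    filter_upwards [eventually_gt_atTop 0] with t ht
    rw [Function.update_of_ne ht.ne']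
  have hint : IntegrableOn (rotatedBoseSum N) (Ioi 0) := by
    simpa using integrableOn_pow_mul_rotatedBoseSum hN hNe 0
  rw [integral_Ioi_of_hasDerivAt_of_tendsto hcont hd hint htop, Function.update_self, zero_sub, hL]
  have hNR : (N : ℝ) ≠ 0 := by exact_mod_cast hN.ne'
  have e : ∀ j ∈ Finset.range (N / 2), (-1 : ℝ) ^ j * ((2 * Real.pi)⁻¹ * Complex.arg (c j)) =
      1 / (4 * N) * ((-1) ^ j * (2 * j + 1)) := by
    intro j hj
    have : c j = ((2 * Real.pi : ℝ) : ℂ) * unitRotation N j := by simp only [hcdef]; push_cast; rfl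
    rw [this, Complex.arg_real_mul _ (by positivity), arg_unitRotation (Finset.mem_range.mp hj)]
    field_simp
    ring
  rw [Finset.sum_congr rfl e, ← Finset.mul_sum, sum_neg_one_pow_mul_odd]
  have h2 : ((N / 2 : ℕ) : ℝ) = N / 2 := by
    obtain ⟨M, hM⟩ := hNe
    rw [hM, ← two_mul, Nat.mul_div_cancel_left _ two_pos]; push_cast; ring
  rw [h2]
  field_simp
  norm_num

lemma integral_rpow_mul_rotatedBoseSum {N : ℕ} (hN : 0 < N) (hNe : Even N) (μ : ℕ) {A : ℝ}
    (hA : 0 < A) :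
    IntegrableOn (fun y : ℝ ↦ (2 * Real.pi * y) ^ (2 * μ + 1 / N - 1 : ℝ) *
      rotatedBoseSum N ((2 * Real.pi / A * y) ^ (1 / N : ℝ))) (Ioi 0) ∧
    ∫ y in Ioi (0 : ℝ), (2 * Real.pi * y) ^ (2 * μ + 1 / N - 1 : ℝ) *
      rotatedBoseSum N ((2 * Real.pi / A * y) ^ (1 / N : ℝ)) =
      N / (2 * Real.pi) * A ^ (2 * μ + 1 / N : ℝ) *
        ∫ t in Ioi (0 : ℝ), t ^ (2 * N * μ) * rotatedBoseSum N t := by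
  have hpi := Real.pi_pos
  have hNR : (0 : ℝ) < N := by exact_mod_cast hN
  have hp : (0 : ℝ) < 1 / N := by positivity
  have hk : 0 < 2 * Real.pi / A := by positivity
  set h : ℝ → ℝ := fun t ↦ t ^ (2 * N * μ) * rotatedBoseSum N t with hh
  have hint : IntegrableOn h (Ioi 0) := integrableOn_pow_mul_rotatedBoseSum hN hNe _
  set q : ℝ → ℝ := fun x ↦ (1 / N * x ^ ((1 / N : ℝ) - 1)) • h (x ^ (1 / N : ℝ)) with hq
  have hqi : IntegrableOn q (Ioi 0) := by
    have := (integrableOn_Ioi_comp_rpow_iff (f := h) hp.ne').mpr hint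
    rwa [abs_of_pos hp] at this
  have hqv : ∫ x in Ioi 0, q x = ∫ t in Ioi 0, h t := integral_comp_rpow_Ioi_of_pos hp
  have e : ∀ y ∈ Ioi (0 : ℝ), (2 * Real.pi * y) ^ (2 * μ + 1 / N - 1 : ℝ) *
      rotatedBoseSum N ((2 * Real.pi / A * y) ^ (1 / N : ℝ)) =
      N * A ^ (2 * μ + 1 / N - 1 : ℝ) * q (2 * Real.pi / A * y) := by
    intro y hy
    have hy0 : 0 < y := hy
    have hx : 0 < 2 * Real.pi / A * y := by positivity
    have e1 : 2 * Real.pi * y = A * (2 * Real.pi / A * y) := by field_simp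
    rw [e1, Real.mul_rpow hA.le hx.le]
    set x := 2 * Real.pi / A * y
    have e2 : (x ^ (1 / N : ℝ)) ^ (2 * N * μ) = x ^ (2 * μ : ℝ) := by
      rw [← Real.rpow_natCast, ← Real.rpow_mul hx.le]
      congr 1
      push_cast
      field_simp
    have e3 : x ^ (2 * μ + 1 / N - 1 : ℝ) = x ^ (2 * μ : ℝ) * x ^ ((1 / N : ℝ) - 1) := by
      rw [← Real.rpow_add hx]; congr 1; ring
    simp only [hq, hh, smul_eq_mul]
    rw [e2, e3]
    field_simp
  constructor
  · refine IntegrableOn.congr_fun ?_ (fun y hy ↦ (e y hy).symm) measurableSet_Ioi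
    refine Integrable.const_mul ?_ _
    have := (integrableOn_Ioi_comp_mul_left_iff q 0 hk).mpr (by simpa using hqi)
    exact this
  · rw [setIntegral_congr_fun measurableSet_Ioi e, integral_const_mul,
      integral_comp_mul_left_Ioi q 0 hk, mul_zero, hqv, smul_eq_mul, Real.rpow_sub hA,
      Real.rpow_one]
    field_simp

/-- The two cases mirror `ζ(-2Nμ)`: it is `-1/2` at `μ = 0` and a trivial zero otherwise. -/
lemma integral_modularKernel {N : ℕ} (hN : 0 < N) (hNe : Even N) {A : ℝ} (hA : 0 < A) (μ : ℕ) :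
    ∫ y : ℝ, modularKernel N A μ y = if μ = 0 then -(1 - 2 ^ (1 / N : ℝ)) / 2 else 0 := by
  have hpi := Real.pi_pos
  have hNR : (0 : ℝ) < N := by exact_mod_cast hN
  have h1 : ∫ y : ℝ, modularKernel N A μ y = ∫ y : ℝ, modularKernel N A μ |y| := by
    congr 1
    funext y
    rcases abs_choice y with h | h
    · rw [h]
    · rw [h, modularKernel_neg]
  obtain ⟨i1, v1⟩ := integral_rpow_mul_rotatedBoseSum hN hNe μ hA
  obtain ⟨i2, v2⟩ := integral_rpow_mul_rotatedBoseSum hN hNe μ (A := 2 * A) (by positivity)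
  have e : ∀ y ∈ Ioi (0 : ℝ), modularKernel N A μ y =
      (-1) ^ μ * (-(4 * Real.pi * (-1) ^ (N / 2) / N)) * A ^ (-(1 / N : ℝ)) *
      ((2 * Real.pi * y) ^ (2 * μ + 1 / N - 1 : ℝ) *
        rotatedBoseSum N ((2 * Real.pi / A * y) ^ (1 / N : ℝ)) -
      (2 * Real.pi * y) ^ (2 * μ + 1 / N - 1 : ℝ) *
        rotatedBoseSum N ((2 * Real.pi / (2 * A) * y) ^ (1 / N : ℝ))) := by
    intro y hy
    have hy0 : 0 < y := hy
    have e3 : (2 * Real.pi * y) ^ (2 * μ + 1 / N - 1 : ℝ) =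
        (2 * Real.pi * y) ^ (2 * μ) * (2 * Real.pi * y) ^ ((1 / N : ℝ) - 1) := by
      rw [← Real.rpow_natCast, ← Real.rpow_add (by positivity)]; congr 1; push_cast; ring
    rw [modularKernel, cauchyDiff_eq hN hNe hA hy0, e3]
    ring
  rw [h1, integral_comp_abs, setIntegral_congr_fun measurableSet_Ioi e, integral_const_mul,
    integral_sub i1 i2, v1, v2]
  split_ifs with hμ
  · subst hμ
    have hs : ((-1 : ℝ) ^ (N / 2)) ^ 2 = 1 := by rw [← pow_mul, mul_comm, pow_mul]; simp
    simp only [mul_zero, pow_zero, one_mul, Nat.cast_zero, zero_add]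
    rw [integral_rotatedBoseSum hN hNe, Real.mul_rpow two_pos.le hA.le, Real.rpow_neg hA.le]
    have : A ^ (1 / N : ℝ) ≠ 0 := by positivity
    field_simp
    rw [hs]
    ring
  · rw [integral_pow_mul_rotatedBoseSum_eq_zero hN hμ]
    simp

/-! ### The defect for `m ≤ 0` and its scaling law. -/

/-- The difference of the two sides of the transformation formula. -/
noncomputable def lambertDefect (N : ℕ) (m : ℤ) (A : ℝ) : ℂ :=
  riemannZeta (2 * N * m) / 2 + (lambertSum N m A : ℂ) - zetaProductSum N m A -
    rotatedFactor N m A * (rotatedSum N m A + rotationImSum N / 2 *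
      riemannZeta (2 * m + 1 - 1 / N))

lemma zetaProductSum_zero (N : ℕ) (A : ℝ) : zetaProductSum N 0 A = riemannZeta N / A := by
  have : (((2 * (0 : ℤ) + 1 - 2 * ((0 : ℕ) : ℤ)) * (N : ℤ)).toNat : ℕ) = N := by simp
  rw [zetaProductSum, show ((0 : ℤ) + 1).toNat = 1 by rfl, Finset.sum_range_one, this]
  simp [riemannZeta_zero]
  ring

lemma zetaProductSum_neg (N : ℕ) {μ : ℕ} (hμ : μ ≠ 0) (A : ℝ) : zetaProductSum N (-μ) A = 0 := by
  rw [zetaProductSum, show (-(μ : ℤ) + 1).toNat = 0 by omega, Finset.range_zero, Finset.sum_empty]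

lemma riemannZeta_neg_two_mul {N μ : ℕ} (hN : N ≠ 0) (hμ : μ ≠ 0) :
    riemannZeta (2 * N * ((-μ : ℤ) : ℂ)) = 0 := by
  obtain ⟨k, hk⟩ : ∃ k, N * μ = k + 1 := Nat.exists_eq_succ_of_ne_zero (Nat.mul_ne_zero hN hμ)
  have : (2 * N * ((-μ : ℤ) : ℂ)) = -2 * (k + 1) := by
    have : ((N * μ : ℕ) : ℂ) = k + 1 := by rw [hk]; push_cast; rfl
    push_cast at this ⊢
    linear_combination -2 * this
  rw [this, riemannZeta_neg_two_mul_nat_add_one]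

/-- The product `A ^ (2μ) rotatedFactor` is homogeneous of degree `-1/N` in `A`. -/
lemma rotatedFactor_dilate {N : ℕ} (μ : ℕ) {A : ℝ} (hA : 0 < A) :
    A ^ (2 * μ) * rotatedFactor N (-μ) A =
      2 ^ (1 / N : ℝ) * ((2 * A) ^ (2 * μ) * rotatedFactor N (-μ) (2 * A)) := by
  have hpi := Real.pi_pos
  have hA2 : 0 < A / (2 * Real.pi) := by positivity
  rw [rotatedFactor, rotatedFactor, mul_div_assoc 2 A, Real.mul_rpow two_pos.le hA2.le, mul_pow]
  have e : (2 : ℝ) ^ (2 * (((-μ : ℤ) : ℝ)) - 1 / N) * 2 ^ (1 / N : ℝ) * 2 ^ (2 * μ) = 1 := by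
    rw [← Real.rpow_natCast, ← Real.rpow_add two_pos, ← Real.rpow_add two_pos]
    have : 2 * (((-μ : ℤ) : ℝ)) - 1 / N + 1 / N + ((2 * μ : ℕ) : ℝ) = 0 := by push_cast; ring
    rw [this, Real.rpow_zero]
  linear_combination (-(A ^ (2 * μ) * ((-1) ^ (-μ : ℤ) * (-(2 * (-1) ^ (N / 2) / N)) *
    (A / (2 * Real.pi)) ^ (2 * (((-μ : ℤ) : ℝ)) - 1 / N)))) * e

/-- The pure powers `k ^ (2μ - 1 + 1/N)` are not summable, but `rotatedFactor_dilate` cancels them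
between the two dilates for each `k`. -/
lemma tsum_modularKernel {N : ℕ} (hN : 0 < N) (hNe : Even N) {A : ℝ} (hA : 0 < A) (μ : ℕ) :
    ∑' k : ℕ+, modularKernel N A μ k =
      A ^ (2 * μ) * rotatedFactor N (-μ) A * rotatedSum N (-μ) A -
      2 ^ (1 / N : ℝ) * ((2 * A) ^ (2 * μ) * rotatedFactor N (-μ) (2 * A)) *
        rotatedSum N (-μ) (2 * A) := by
  have hpi := Real.pi_pos
  have hS : ∀ B : ℝ, 0 < B → ∀ k : ℕ+, (-1) ^ μ * (2 * Real.pi * k) ^ (2 * μ) * cauchySum N B k =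
      B ^ (2 * μ) * (rotatedFactor N (-μ) B *
        ((k : ℝ) ^ (-(2 * ((-μ : ℤ) : ℝ) + 1 - 1 / N)) *
        rotatedBoseSum N ((2 * Real.pi / B * k) ^ (1 / N : ℝ)) +
        rotationImSum N / 2 * (k : ℝ) ^ (-(2 * ((-μ : ℤ) : ℝ) + 1 - 1 / N)))) := by
    intro B hB k
    have hk : (0 : ℝ) < k := by exact_mod_cast k.pos
    rw [← neg_sq_div_pow_mul_cauchySum hN hNe (-μ) hB hk, zpow_neg, zpow_natCast,
      neg_eq_neg_one_mul (B ^ 2 / _), mul_pow (-1 : ℝ), div_pow, ← pow_mul, ← pow_mul]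
    have h1 : ((-1 : ℝ) ^ μ) ^ 2 = 1 := by rw [← pow_mul, mul_comm, pow_mul]; simp
    have h2 : (-1 : ℝ) ^ μ ≠ 0 := by positivity
    field_simp
    rw [h1, one_mul]
  have hsum : ∀ B : ℝ, 0 < B → Summable fun k : ℕ+ ↦
      (k : ℝ) ^ (-(2 * ((-μ : ℤ) : ℝ) + 1 - 1 / N)) *
        rotatedBoseSum N ((2 * Real.pi / B * k) ^ (1 / N : ℝ)) := fun B hB ↦
    summable_rpow_mul_rotatedBoseSum hN _ (by positivity)
  rw [rotatedSum, rotatedSum, ← tsum_mul_left, ← tsum_mul_left,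
    ← Summable.tsum_sub ((hsum A hA).mul_left _) ((hsum (2 * A) (by positivity)).mul_left _)]
  congr 1
  funext k
  have h1 := hS A hA k
  have h2 := hS (2 * A) (by positivity) k
  rw [modularKernel, cauchyDiff]
  linear_combination h1 - 2 ^ (1 / N : ℝ) * h2 + rotationImSum N / 2 *
    (k : ℝ) ^ (-(2 * ((-μ : ℤ) : ℝ) + 1 - 1 / N)) * rotatedFactor_dilate (N := N) μ hA

lemma modularKernel_zero_right {N : ℕ} (hN : 1 < N) {A : ℝ} (hA : 0 < A) (μ : ℕ) :
    ((modularKernel N A μ 0 : ℝ) : ℂ) = 2 * (A ^ (2 * μ) * zetaProductSum N (-μ) A -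
      ((2 ^ (1 / N : ℝ) : ℝ) : ℂ) * ((2 * A) ^ (2 * μ) * zetaProductSum N (-μ) (2 * A))) := by
  by_cases hμ : μ = 0
  · subst hμ
    have h0 : ∀ B : ℝ, 0 < B → (cauchySum N B 0 : ℂ) = 2 / B * riemannZeta N := by
      intro B hB
      rw [riemannZeta_natCast_eq_tsum_pnat hN, cauchySum]
      have : ∀ n : ℕ+, 2 * B * (n : ℝ) ^ N / (B ^ 2 * (n : ℝ) ^ (2 * N) + (2 * Real.pi * 0) ^ 2) =
          2 / B * ((n : ℝ) ^ N)⁻¹ := by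
        intro n
        rw [two_mul N, pow_add]
        field_simp
        ring
      simp_rw [this]
      rw [tsum_mul_left]
      push_cast
      rfl
    have hAC : (A : ℂ) ≠ 0 := by exact_mod_cast hA.ne'
    have e : (-((0 : ℕ) : ℤ)) = 0 := by simp
    rw [e, zetaProductSum_zero, zetaProductSum_zero, modularKernel, cauchyDiff]
    have h1 := h0 A hA
    have h2 := h0 (2 * A) (by positivity)
    push_cast at h1 h2 ⊢
    rw [h1, h2]
    simp
    field_simp
  · rw [zetaProductSum_neg N hμ, zetaProductSum_neg N hμ, modularKernel]
    simp [hμ]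

/-- Half of the Poisson identity. The zero-frequency integral accounts for `ζ(-2Nμ)`, and the value
of the kernel at `0` for `zetaProductSum`. The other zeta value is multiplied by a combination that
is zero by homogeneity, so this relation cannot detect it; the limit `A → 0` will. -/
lemma lambertDefect_dilate {N : ℕ} (hN : 0 < N) (hNe : Even N) {A : ℝ} (hA : 0 < A) (μ : ℕ) :
    (A : ℂ) ^ (2 * μ) * lambertDefect N (-μ) A =
      ((2 ^ (1 / N : ℝ) : ℝ) : ℂ) * ((2 * A) ^ (2 * μ) * lambertDefect N (-μ) (2 * A)) := by
  have hN1 : 1 < N := by obtain ⟨M, hM⟩ := hNe; omega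
  obtain ⟨-, hP⟩ := poisson_cauchyDiff hN hNe hA μ
  rw [tsum_modularKernel hN hNe hA, integral_modularKernel hN hNe hA] at hP
  have hP' := congrArg (fun x : ℝ ↦ (x : ℂ)) hP
  have hK := modularKernel_zero_right hN1 hA μ
  have hF := congrArg (fun x : ℝ ↦ (x : ℂ)) (rotatedFactor_dilate (N := N) μ hA)
  have hz : (A : ℂ) ^ (2 * μ) * (riemannZeta (2 * N * ((-μ : ℤ) : ℂ)) / 2) -
      ((2 ^ (1 / N : ℝ) : ℝ) : ℂ) * ((2 * A) ^ (2 * μ) * (riemannZeta (2 * N * ((-μ : ℤ) : ℂ)) / 2)) =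
      ((if μ = 0 then -(1 - 2 ^ (1 / N : ℝ)) / 2 else 0 : ℝ) : ℂ) / 2 := by
    split_ifs with hμ
    · subst hμ
      simp [riemannZeta_zero]
      ring
    · rw [riemannZeta_neg_two_mul hN.ne' hμ]
      simp
  rw [Complex.ofReal_add, hK] at hP'
  simp only [Complex.ofReal_add, Complex.ofReal_sub, Complex.ofReal_mul, Complex.ofReal_pow,
    Complex.ofReal_ofNat] at hP' hF
  rw [lambertDefect, lambertDefect]
  linear_combination hz - hP' / 2 - rotationImSum N / 2 *
      riemannZeta (2 * ((-μ : ℤ) : ℂ) + 1 - 1 / N) * hF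

/-! ### Riemann sums on the half line. -/

lemma mul_natCeil_div_mem {δ x : ℝ} (hδ : 0 < δ) (hx : 0 < x) :
    δ * ⌈x / δ⌉₊ ∈ Icc x (x + δ) := by
  have h1 := Nat.le_ceil (x / δ)
  have h2 := Nat.ceil_lt_add_one (div_pos hx hδ).le
  constructor
  · rwa [div_le_iff₀' hδ] at h1
  · have := mul_le_mul_of_nonneg_left h2.le hδ.le
    rwa [mul_add, mul_one, mul_div_cancel₀ _ hδ.ne'] at this

/-- Rounding up moves the point to the right, where the decreasing majorant is smaller; one
dominating function thus serves all `δ`. -/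
lemma abs_comp_natCeil_le {H : ℝ → ℝ} {K : ℝ} (hK : ∀ x, 0 < x → |H x| ≤ K * (1 + x ^ 2)⁻¹)
    {δ x : ℝ} (hδ : 0 < δ) (hx : 0 < x) : |H (δ * ⌈x / δ⌉₊)| ≤ K * (1 + x ^ 2)⁻¹ := by
  have h := mul_natCeil_div_mem hδ hx
  have hK0 : 0 ≤ K := by
    have := (abs_nonneg _).trans (hK 1 one_pos)
    norm_num at this
    linarith
  refine (hK _ (hx.trans_le h.1)).trans (mul_le_mul_of_nonneg_left ?_ hK0)
  have := h.1
  gcongr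

lemma measurable_comp_natCeil (H : ℝ → ℝ) (δ : ℝ) : Measurable fun x ↦ H (δ * ⌈x / δ⌉₊) :=
  (measurable_from_top (f := fun n : ℕ ↦ H (δ * n))).comp
    (Nat.measurable_ceil.comp (measurable_id.div_const δ))

/-- The integrand is constant on each `(δn, δ(n+1)]`, so the Riemann sum is exactly an integral, to
which dominated convergence can be applied. -/
lemma integral_comp_natCeil {H : ℝ → ℝ} {K : ℝ} (hK : ∀ x, 0 < x → |H x| ≤ K * (1 + x ^ 2)⁻¹)
    {δ : ℝ} (hδ : 0 < δ) :
    ∫ x in Ioi (0 : ℝ), H (δ * ⌈x / δ⌉₊) = δ * ∑' n : ℕ+, H (δ * n) := by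
  have hint : IntegrableOn (fun x ↦ H (δ * ⌈x / δ⌉₊)) (Ioi 0) := by
    refine ((integrable_inv_one_add_sq.const_mul K).integrableOn (s := Ioi 0)).mono'
      (measurable_comp_natCeil H δ).aestronglyMeasurable ?_
    filter_upwards [ae_restrict_mem measurableSet_Ioi] with x hx
    exact abs_comp_natCeil_le hK hδ hx
  have hmono : Monotone fun n : ℕ ↦ δ * (n : ℝ) := fun a b hab ↦ by
    dsimp only
    gcongr
  have hU : (⋃ n : ℕ, Ioc (δ * (n : ℝ)) (δ * ((n + 1 : ℕ) : ℝ))) = Ioi 0 := by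
    ext x
    simp only [mem_iUnion, mem_Ioc, mem_Ioi]
    constructor
    · rintro ⟨n, h1, -⟩
      exact lt_of_le_of_lt (by positivity) h1
    · intro hx
      have hc : ⌈x / δ⌉₊ ≠ 0 := (Nat.ceil_pos.mpr (div_pos hx hδ)).ne'
      obtain ⟨n, hn⟩ := Nat.exists_eq_succ_of_ne_zero hc
      have := (Nat.ceil_eq_iff n.succ_ne_zero).mp hn
      refine ⟨n, ?_, ?_⟩
      · rw [← lt_div_iff₀' hδ]; simpa using this.1
      · rw [← div_le_iff₀' hδ]; exact this.2
  have hs := hasSum_integral_iUnion (f := fun x ↦ H (δ * ⌈x / δ⌉₊)) (μ := volume)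
    (s := fun n : ℕ ↦ Ioc (δ * (n : ℝ)) (δ * ((n + 1 : ℕ) : ℝ))) (fun _ ↦ measurableSet_Ioc)
    hmono.pairwise_disjoint_on_Ioc_succ (by rw [hU]; exact hint)
  rw [hU] at hs
  rw [← hs.tsum_eq, tsum_pnat_eq_tsum_succ (f := fun n : ℕ ↦ H (δ * n)), ← tsum_mul_left]
  congr 1
  funext n
  have : ∀ x ∈ Ioc (δ * (n : ℝ)) (δ * ((n + 1 : ℕ) : ℝ)),
      H (δ * ⌈x / δ⌉₊) = H (δ * ((n + 1 : ℕ) : ℝ)) := by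
    intro x hx
    congr 3
    rw [Nat.ceil_eq_iff n.succ_ne_zero, div_le_iff₀' hδ, lt_div_iff₀' hδ]
    exact ⟨by simpa using hx.1, hx.2⟩
  rw [setIntegral_congr_fun measurableSet_Ioc this, setIntegral_const, Measure.real,
    Real.volume_Ioc, ENNReal.toReal_ofReal (by push_cast; nlinarith)]
  push_cast
  simp only [smul_eq_mul]
  ring

/-- Riemann sums of a continuous integrand dominated by `(1 + x ^ 2)⁻¹` converge to its integral
over the positive half line. -/
lemma tendsto_riemannSum_Ioi {H : ℝ → ℝ} {K : ℝ} (hc : ContinuousOn H (Ioi 0))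
    (hK : ∀ x, 0 < x → |H x| ≤ K * (1 + x ^ 2)⁻¹) :
    Tendsto (fun δ : ℝ ↦ δ * ∑' n : ℕ+, H (δ * n)) (𝓝[>] 0) (𝓝 (∫ x in Ioi (0 : ℝ), H x)) := by
  have hpos : ∀ᶠ δ : ℝ in 𝓝[>] 0, 0 < δ := eventually_mem_nhdsWithin
  refine Tendsto.congr' (f₁ := fun δ ↦ ∫ x in Ioi (0 : ℝ), H (δ * ⌈x / δ⌉₊)) ?_ ?_
  · filter_upwards [hpos] with δ hδ using integral_comp_natCeil hK hδ
  refine tendsto_integral_filter_of_dominated_convergence (fun x ↦ K * (1 + x ^ 2)⁻¹)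
    (Eventually.of_forall fun δ ↦ (measurable_comp_natCeil H δ).aestronglyMeasurable) ?_
    (integrable_inv_one_add_sq.const_mul K).integrableOn ?_
  · filter_upwards [hpos] with δ hδ
    filter_upwards [ae_restrict_mem measurableSet_Ioi] with x hx
    exact abs_comp_natCeil_le hK hδ hx
  · filter_upwards [ae_restrict_mem measurableSet_Ioi] with x hx
    refine (hc.continuousAt (Ioi_mem_nhds hx)).tendsto.comp ?_
    have h0 : Tendsto (fun δ : ℝ ↦ x + δ) (𝓝[>] 0) (𝓝 x) := by
      have : Tendsto (fun δ : ℝ ↦ x + δ) (𝓝 0) (𝓝 (x + 0)) := (continuous_const.add continuous_id).tendsto 0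
      rw [add_zero] at this
      exact this.mono_left nhdsWithin_le_nhds
    refine tendsto_of_tendsto_of_tendsto_of_le_of_le' tendsto_const_nhds h0 ?_ ?_
    · filter_upwards [hpos] with δ hδ using (mul_natCeil_div_mem hδ hx).1
    · filter_upwards [hpos] with δ hδ using (mul_natCeil_div_mem hδ hx).2

/-! ### Mellin transform of the Bose function, continued to `Re s > 0`. -/

lemma bose_sub_inv_mem {x : ℝ} (hx : 0 < x) :
    1 / x - 1 / (Real.exp x - 1) ∈ Icc 0 (1 / 2) := by
  have h1 := (hasSum_partialFraction_real hx).nonneg fun k ↦ by positivity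
  have h2 := one_div_exp_sub_one_le hx one_ne_zero
  simp only [Nat.factorial_one, Nat.cast_one, pow_one] at h2
  constructor <;> linarith

lemma continuousOn_one_div_exp_sub_one :
    ContinuousOn (fun x : ℝ ↦ 1 / (Real.exp x - 1)) (Ioi 0) := by
  refine continuousOn_const.div (by fun_prop) fun x hx ↦ ?_
  have := Real.add_one_lt_exp (ne_of_gt (mem_Ioi.mp hx))
  have := mem_Ioi.mp hx
  linarith

lemma continuousOn_bose_ofReal : ContinuousOn (fun x : ℝ ↦ bose x) (Ioi 0) := by
  simp_rw [bose_ofReal]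
  exact Complex.continuous_ofReal.comp_continuousOn continuousOn_one_div_exp_sub_one

lemma mellin_bose {s : ℂ} (hs : 1 < s.re) :
    mellin (fun t : ℝ ↦ bose t) s = Complex.Gamma s * riemannZeta s := by
  have h := hasSum_mellin (a := fun _ : ℕ+ ↦ (1 : ℂ)) (p := fun n : ℕ+ ↦ (n : ℝ))
    (F := fun t : ℝ ↦ bose t) (s := s) (fun n ↦ Or.inr (by exact_mod_cast n.pos)) (by linarith)
    (fun t ht ↦ by
      have := bose_hasSum_geometric (z := (t : ℂ)) (by simpa using ht)
      convert this using 2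
      push_cast
      ring_nf) (by
      simpa [Real.rpow_neg] using summable_pnat_rpow_neg hs)
  rw [← h.tsum_eq]
  simp_rw [mul_one, div_eq_mul_one_div (Complex.Gamma s)]
  rw [tsum_mul_left, zeta_eq_tsum_one_div_nat_add_one_cpow hs,
    tsum_pnat_eq_tsum_succ (f := fun n : ℕ ↦ 1 / (((n : ℝ) : ℂ)) ^ s)]
  push_cast
  rfl

/-- The Bose function with its pole at the origin removed. -/
noncomputable def bosePrincipal (t : ℝ) : ℂ :=
  bose t - indicator (Ioc 0 1) (fun t : ℝ ↦ (t : ℂ) ^ (-1 : ℂ)) t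

lemma locallyIntegrableOn_bosePrincipal : LocallyIntegrableOn bosePrincipal (Ioi 0) := by
  have h1 : LocallyIntegrableOn (fun x : ℝ ↦ bose x) (Ioi 0) :=
    continuousOn_bose_ofReal.locallyIntegrableOn measurableSet_Ioi
  have h2 : LocallyIntegrableOn (fun t : ℝ ↦ (t : ℂ) ^ (-1 : ℂ)) (Ioi 0) := by
    refine ContinuousOn.locallyIntegrableOn ?_ measurableSet_Ioi
    intro t ht
    exact (Complex.continuousAt_ofReal_cpow_const t _ (Or.inr (ne_of_gt ht))).continuousWithinAt
  refine h1.sub fun x hx ↦ ?_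
  obtain ⟨u, hu, hi⟩ := h2 x hx
  exact ⟨u, hu, hi.indicator measurableSet_Ioc⟩

lemma bosePrincipal_isBigO_atTop (a : ℝ) : bosePrincipal =O[atTop] fun t ↦ t ^ (-a) := by
  obtain ⟨p, hp⟩ := exists_nat_gt (max a 1)
  have hp0 : p ≠ 0 := by
    rintro rfl
    have := (le_max_right a 1).trans_lt hp
    norm_num at this
  refine Asymptotics.IsBigO.of_bound p.factorial ?_
  filter_upwards [eventually_gt_atTop 1] with t ht
  have ht0 : 0 < t := by linarith
  rw [bosePrincipal, indicator_of_notMem (by simp [ht]), sub_zero,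
    Real.norm_of_nonneg (by positivity)]
  refine (norm_bose_le (by simpa using ht0) hp0).trans ?_
  rw [Complex.ofReal_re, div_eq_mul_inv, Real.rpow_neg ht0.le]
  refine mul_le_mul_of_nonneg_left ?_ (by positivity)
  refine inv_anti₀ (by positivity) ?_
  rw [← Real.rpow_natCast]
  exact Real.rpow_le_rpow_of_exponent_le ht.le ((le_max_left a 1).trans hp.le)

lemma bosePrincipal_isBigO_zero : bosePrincipal =O[𝓝[>] 0] fun t ↦ t ^ (-(0 : ℝ)) := by
  refine Asymptotics.IsBigO.of_bound 1 ?_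
  filter_upwards [Ioc_mem_nhdsGT one_pos] with t ht
  have h := bose_sub_inv_mem ht.1
  have : bosePrincipal t = ((-(1 / t - 1 / (Real.exp t - 1)) : ℝ) : ℂ) := by
    rw [bosePrincipal, indicator_of_mem ht, bose_ofReal, Complex.cpow_neg_one]
    push_cast
    ring
  rw [this, Complex.norm_real, norm_neg, Real.norm_of_nonneg h.1]
  simp only [neg_zero, Real.rpow_zero, norm_one, mul_one]
  linarith [h.2]

lemma differentiableAt_mellin_bosePrincipal {s : ℂ} (hs : 0 < s.re) :
    DifferentiableAt ℂ (mellin bosePrincipal) s :=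
  mellin_differentiableAt_of_isBigO_rpow locallyIntegrableOn_bosePrincipal
    (bosePrincipal_isBigO_atTop (s.re + 1)) (lt_add_one _) bosePrincipal_isBigO_zero hs

lemma mellinConvergent_bosePrincipal {s : ℂ} (hs : 0 < s.re) :
    MellinConvergent bosePrincipal s :=
  mellinConvergent_of_isBigO_rpow locallyIntegrableOn_bosePrincipal
    (bosePrincipal_isBigO_atTop (s.re + 1)) (lt_add_one _) bosePrincipal_isBigO_zero hs

lemma mellin_bosePrincipal_of_one_lt {s : ℂ} (hs : 1 < s.re) :
    mellin bosePrincipal s = Complex.Gamma s * riemannZeta s - 1 / (s - 1) := by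
  have h1 := hasMellin_cpow_Ioc (-1) (s := s) (by simp; linarith)
  have h2 : MellinConvergent (fun t : ℝ ↦ bose t) s := by
    have := (hasMellin_add (mellinConvergent_bosePrincipal (s := s) (by linarith)) h1.1).1
    convert this using 1
    funext t
    simp [bosePrincipal]
  have h3 := (hasMellin_sub h2 h1.1).2
  rw [mellin_bose hs, h1.2] at h3
  rw [← sub_eq_add_neg] at h3
  exact h3

/-- The identity theorem on the half plane: both sides are analytic once the pole at `s = 1` is
cleared, and they agree for `Re s > 1`. -/
lemma mellin_bosePrincipal {s : ℂ} (hs : 0 < s.re) :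
    (s - 1) * mellin bosePrincipal s = Complex.Gamma s * riemannZeta₁ s - 1 := by
  have hopen : IsOpen {s : ℂ | 0 < s.re} := isOpen_lt continuous_const Complex.continuous_re
  have hconv : IsPreconnected {s : ℂ | 0 < s.re} := (convex_halfSpace_re_gt 0).isPreconnected
  have hf : AnalyticOnNhd ℂ (fun s ↦ (s - 1) * mellin bosePrincipal s) {s : ℂ | 0 < s.re} := by
    refine DifferentiableOn.analyticOnNhd (fun s hs ↦ ?_) hopen
    exact (((differentiableAt_id.sub_const 1)).mul
      (differentiableAt_mellin_bosePrincipal hs)).differentiableWithinAt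
  have hg : AnalyticOnNhd ℂ (fun s ↦ Complex.Gamma s * riemannZeta₁ s - 1)
      {s : ℂ | 0 < s.re} := by
    refine DifferentiableOn.analyticOnNhd (fun s hs ↦ ?_) hopen
    refine DifferentiableAt.differentiableWithinAt ?_
    refine ((Complex.differentiableAt_Gamma s fun m h ↦ ?_).mul
      (differentiable_riemannZeta₁ s)).sub_const 1
    rw [h] at hs
    simp at hs
    have : (0 : ℝ) ≤ m := m.cast_nonneg
    linarith
  refine hf.eqOn_of_preconnected_of_eventuallyEq hg hconv (z₀ := 2) (by simp) ?_ hs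
  have : {s : ℂ | 1 < s.re} ∈ 𝓝 (2 : ℂ) :=
    (isOpen_lt continuous_const Complex.continuous_re).mem_nhds (by simp)
  filter_upwards [this] with z hz
  have hz1 : z ≠ 1 := by
    rintro rfl
    simp at hz
  have hz2 : z - 1 ≠ 0 := sub_ne_zero.mpr hz1
  rw [mellin_bosePrincipal_of_one_lt hz, riemannZeta_eq_inv_sub_mul hz1]
  field_simp

lemma integral_rpow_mul_bose {s : ℝ} (hs : 1 < s) :
    ((∫ v in Ioi (0 : ℝ), v ^ (s - 1) * (1 / (Real.exp v - 1)) : ℝ) : ℂ) =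
      Complex.Gamma s * riemannZeta s := by
  rw [← mellin_bose (by simpa using hs), mellin, ← integral_complex_ofReal]
  refine setIntegral_congr_fun measurableSet_Ioi fun v hv ↦ ?_
  simp only [bose_ofReal, smul_eq_mul, Complex.ofReal_mul]
  rw [Complex.ofReal_cpow (le_of_lt hv)]
  push_cast
  rfl

/-- For `s < 1` the pole `1/v` may be subtracted on the whole half line; the extra piece `∫_1^∞ v ^
(s-2) = 1/(1-s)` cancels the polar term of `mellin_bosePrincipal`. -/
lemma integral_rpow_mul_bose_sub_inv {s : ℝ} (h0 : 0 < s) (h1 : s < 1) :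
    ((∫ v in Ioi (0 : ℝ), v ^ (s - 1) * (1 / (Real.exp v - 1) - 1 / v) : ℝ) : ℂ) =
      Complex.Gamma s * riemannZeta s := by
  have hs1 : (s : ℂ) ≠ 1 := by exact_mod_cast h1.ne
  have hs2 : (s : ℂ) - 1 ≠ 0 := sub_ne_zero.mpr hs1
  have hM := mellin_bosePrincipal (s := s) (by simpa using h0)
  have hI : IntegrableOn (fun t : ℝ ↦ (t : ℂ) ^ ((s : ℂ) - 2)) (Ioi 1) :=
    integrableOn_Ioi_cpow_of_lt (by simp; linarith) one_pos
  have hI2 := integral_Ioi_cpow_of_lt (a := (s : ℂ) - 2) (by simp; linarith) one_pos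
  have hkey : ((∫ v in Ioi (0 : ℝ), v ^ (s - 1) * (1 / (Real.exp v - 1) - 1 / v) : ℝ) : ℂ) =
      mellin bosePrincipal s - ∫ t in Ioi (1 : ℝ), (t : ℂ) ^ ((s : ℂ) - 2) := by
    have h01 : ∫ t in Ioi (1 : ℝ), (t : ℂ) ^ ((s : ℂ) - 2) =
        ∫ t in Ioi (0 : ℝ), indicator (Ioi 1) (fun t : ℝ ↦ (t : ℂ) ^ ((s : ℂ) - 2)) t := by
      rw [setIntegral_indicator measurableSet_Ioi, Ioi_inter_Ioi]
      simp
    have hI' : IntegrableOn (indicator (Ioi 1) (fun t : ℝ ↦ (t : ℂ) ^ ((s : ℂ) - 2))) (Ioi 0) :=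
      ((integrable_indicator_iff measurableSet_Ioi).mpr hI).integrableOn
    rw [h01, mellin, ← integral_sub (mellinConvergent_bosePrincipal (s := s) (by simpa using h0)) hI',
      ← integral_complex_ofReal]
    refine setIntegral_congr_fun measurableSet_Ioi fun v hv ↦ ?_
    have hv0 : (0 : ℝ) < v := hv
    have hvC : (v : ℂ) ≠ 0 := by exact_mod_cast hv0.ne'
    have hp : (v : ℂ) ^ ((s : ℂ) - 2) = (v : ℂ) ^ ((s : ℂ) - 1) * (v : ℂ)⁻¹ := by
      rw [← Complex.cpow_neg_one, ← Complex.cpow_add _ _ hvC]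
      ring_nf
    have hL : ((v ^ (s - 1) * (1 / (Real.exp v - 1) - 1 / v) : ℝ) : ℂ) =
        (v : ℂ) ^ ((s : ℂ) - 1) * (bose v - (v : ℂ)⁻¹) := by
      rw [bose_ofReal, Complex.ofReal_mul, Complex.ofReal_cpow hv0.le]
      push_cast
      ring
    simp only [smul_eq_mul]
    rw [hL, bosePrincipal]
    by_cases h : v ≤ 1
    · rw [indicator_of_mem (show v ∈ Ioc (0 : ℝ) 1 from ⟨hv0, h⟩),
        indicator_of_notMem (by simpa using h), Complex.cpow_neg_one]
      ring
    · rw [indicator_of_notMem (by simp [h]), indicator_of_mem (by simpa using h), hp]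
      ring
  rw [hkey, hI2, riemannZeta_eq_inv_sub_mul hs1]
  have e : (s : ℂ) - 2 + 1 = s - 1 := by ring
  rw [e]
  simp only [Complex.ofReal_one, Complex.one_cpow]
  field_simp
  linear_combination hM

lemma tendsto_rotatedSum_zero {N : ℕ} (hN : 0 < N) (m : ℤ) :
    Tendsto (rotatedSum N m) (𝓝[>] 0) (𝓝 0) := by
  have hpi := Real.pi_pos
  obtain ⟨q, hq⟩ := exists_nat_gt (max (-2 * (m : ℝ) + 1 / N) 0)
  have hq1 : -2 * (m : ℝ) + 1 / N < q := lt_of_le_of_lt (le_max_left _ _) hq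
  have hq0 : q ≠ 0 := by
    rintro rfl
    simp at hq
  obtain ⟨C, hC, hb⟩ := abs_rotatedBoseSum_le N (p := N * q) (Nat.mul_ne_zero hN.ne' hq0)
  have hs := summable_pnat_rpow_neg (s := q + (2 * m + 1 - 1 / N)) (by linarith)
  have hbound : ∀ A : ℝ, 0 < A → ‖rotatedSum N m A‖ ≤ A ^ q * (C / (2 * Real.pi) ^ q *
      ∑' k : ℕ+, (k : ℝ) ^ (-(q + (2 * (m : ℝ) + 1 - 1 / N)))) := by
    intro A hA
    rw [← tsum_mul_left, ← tsum_mul_left]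
    refine tsum_of_norm_bounded ((hs.mul_left _).mul_left _).hasSum fun k ↦ ?_
    have hk : (0 : ℝ) < k := by exact_mod_cast k.pos
    have h1 := hb ((2 * Real.pi / A * k) ^ (1 / N : ℝ)) (by positivity)
    rw [pow_mul, one_div, Real.rpow_inv_natCast_pow (by positivity) hN.ne'] at h1
    rw [norm_mul, Real.norm_of_nonneg (by positivity), Real.norm_eq_abs, one_div]
    calc (k : ℝ) ^ (-(2 * (m : ℝ) + 1 - (N : ℝ)⁻¹)) *
          |rotatedBoseSum N ((2 * Real.pi / A * k) ^ (N : ℝ)⁻¹)|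
        ≤ (k : ℝ) ^ (-(2 * (m : ℝ) + 1 - (N : ℝ)⁻¹)) * (C / (2 * Real.pi / A * k) ^ q) := by gcongr
      _ = _ := by
        rw [neg_add, Real.rpow_add hk, Real.rpow_neg hk.le q, Real.rpow_natCast, mul_pow, div_pow]
        field_simp
  rw [tendsto_zero_iff_norm_tendsto_zero]
  refine squeeze_zero' (Eventually.of_forall fun A ↦ norm_nonneg _)
    (eventually_mem_nhdsWithin.mono fun A hA ↦ hbound A hA) ?_
  have : Tendsto (fun A : ℝ ↦ A ^ q * (C / (2 * Real.pi) ^ q *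
      ∑' k : ℕ+, (k : ℝ) ^ (-(q + (2 * (m : ℝ) + 1 - 1 / N))))) (𝓝 0) (𝓝 0) := by
    refine Continuous.tendsto' (by fun_prop) _ _ ?_
    rw [zero_pow hq0, zero_mul]
  exact this.mono_left nhdsWithin_le_nhds

/-! ### The limit of the defect, and its vanishing. -/

/-- The integrand of the Riemann sums formed by the Lambert series, without its polar part. -/
noncomputable def lambertIntegrand (N μ : ℕ) (x : ℝ) : ℝ :=
  x ^ (2 * N * μ) * (1 / (Real.exp (x ^ N) - 1) - if μ = 0 then 1 / x ^ N else 0)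

lemma continuousOn_lambertIntegrand (N μ : ℕ) : ContinuousOn (lambertIntegrand N μ) (Ioi 0) := by
  have h1 : ContinuousOn (fun x : ℝ ↦ 1 / (Real.exp (x ^ N) - 1)) (Ioi 0) :=
    continuousOn_one_div_exp_sub_one.comp (f := fun x : ℝ ↦ x ^ N) (by fun_prop)
      fun x hx ↦ pow_pos (mem_Ioi.mp hx) N
  have h2 : ContinuousOn (fun x : ℝ ↦ 1 / x ^ N) (Ioi 0) :=
    continuousOn_const.div (by fun_prop) fun x hx ↦ (pow_pos (mem_Ioi.mp hx) N).ne'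
  unfold lambertIntegrand
  split_ifs
  · exact (continuousOn_pow _).mul (h1.sub h2)
  · exact (continuousOn_pow _).mul (h1.sub continuousOn_const)

lemma abs_lambertIntegrand_le {N : ℕ} (hN : 1 < N) (μ : ℕ) {x : ℝ} (hx : 0 < x) :
    |lambertIntegrand N μ x| ≤ 2 * (2 * μ + 1).factorial * (1 + x ^ 2)⁻¹ := by
  have key : |lambertIntegrand N μ x| ≤ (2 * μ + 1).factorial ∧
      |lambertIntegrand N μ x| ≤ (2 * μ + 1).factorial / x ^ N := by
    have hxN : 0 < x ^ N := by positivity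
    have h0 := one_div_exp_sub_one_pos hxN
    by_cases hμ : μ = 0
    · subst hμ
      obtain ⟨h1, h2⟩ := bose_sub_inv_mem hxN
      have : |lambertIntegrand N 0 x| = 1 / x ^ N - 1 / (Real.exp (x ^ N) - 1) := by
        rw [lambertIntegrand, if_pos rfl, mul_zero, pow_zero, one_mul, abs_sub_comm,
          abs_of_nonneg h1]
      rw [this]
      norm_num
      norm_num at h2 h0
      exact ⟨by linarith, by linarith⟩
    · have : |lambertIntegrand N μ x| = x ^ (2 * N * μ) * (1 / (Real.exp (x ^ N) - 1)) := by
        rw [lambertIntegrand, if_neg hμ, sub_zero, abs_of_nonneg (by positivity)]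
      have e : x ^ (2 * N * μ) = (x ^ N) ^ (2 * μ) := by
        rw [← pow_mul]; congr 1; ring
      rw [this, e]
      have h1 := one_div_exp_sub_one_le hxN (p := 2 * μ) (by omega)
      have h2 := one_div_exp_sub_one_le hxN (p := 2 * μ + 1) (by omega)
      constructor
      · calc (x ^ N) ^ (2 * μ) * (1 / (Real.exp (x ^ N) - 1))
            ≤ (x ^ N) ^ (2 * μ) * ((2 * μ).factorial / (x ^ N) ^ (2 * μ)) := by gcongr
          _ = (2 * μ).factorial := by field_simp
          _ ≤ _ := by exact_mod_cast Nat.factorial_le (by omega)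
      · calc (x ^ N) ^ (2 * μ) * (1 / (Real.exp (x ^ N) - 1))
            ≤ (x ^ N) ^ (2 * μ) * ((2 * μ + 1).factorial / (x ^ N) ^ (2 * μ + 1)) := by gcongr
          _ = _ := by rw [pow_succ]; field_simp
  have hfac : (0 : ℝ) < (2 * μ + 1).factorial := by positivity
  rw [← div_eq_mul_inv, le_div_iff₀ (by positivity)]
  rcases le_total x 1 with h | h
  · have : x ^ 2 ≤ 1 := pow_le_one₀ hx.le h
    nlinarith [key.1, abs_nonneg (lambertIntegrand N μ x)]
  · have h3 : x ^ 2 ≤ x ^ N := pow_le_pow_right₀ h hN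
    have h4 := key.2
    rw [le_div_iff₀ (by positivity)] at h4
    nlinarith [key.1, abs_nonneg (lambertIntegrand N μ x)]

/-- Substitute `v = x ^ N`. The Mellin exponent `2μ + 1/N` exceeds `1` for `μ ≥ 1` and lies in `(0,
1)` for `μ = 0`, where the subtracted pole is needed. -/
lemma integral_lambertIntegrand {N : ℕ} (hN : 1 < N) (μ : ℕ) :
    ((∫ x in Ioi (0 : ℝ), lambertIntegrand N μ x : ℝ) : ℂ) =
      Complex.Gamma (2 * μ + 1 / N) * riemannZeta (2 * μ + 1 / N) / N := by
  have hN0 : (0 : ℝ) < N := by exact_mod_cast (by omega : 0 < N)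
  have hNC : (N : ℂ) ≠ 0 := by exact_mod_cast hN0.ne'
  have hsub := integral_comp_rpow_Ioi_of_pos (p := (N : ℝ)) hN0
    (g := fun v : ℝ ↦ v ^ (2 * (μ : ℝ) + 1 / N - 1) *
      (1 / (Real.exp v - 1) - if μ = 0 then 1 / v else 0))
  have e : ∀ x ∈ Ioi (0 : ℝ), ((N : ℝ) * x ^ ((N : ℝ) - 1)) •
      ((x ^ (N : ℝ)) ^ (2 * (μ : ℝ) + 1 / N - 1) *
      (1 / (Real.exp (x ^ (N : ℝ)) - 1) - if μ = 0 then 1 / (x ^ (N : ℝ)) else 0)) =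
      N * lambertIntegrand N μ x := by
    intro x hx
    have hx0 : (0 : ℝ) < x := hx
    rw [lambertIntegrand, ← Real.rpow_natCast x (2 * N * μ), ← Real.rpow_natCast x N,
      ← Real.rpow_mul hx0.le, smul_eq_mul]
    have : x ^ (((2 * N * μ : ℕ) : ℝ)) =
        x ^ ((N : ℝ) - 1) * x ^ ((N : ℝ) * (2 * (μ : ℝ) + 1 / N - 1)) := by
      rw [← Real.rpow_add hx0]
      congr 1
      push_cast
      field_simp
      ring
    rw [this]
    ring
  rw [setIntegral_congr_fun measurableSet_Ioi e, integral_const_mul] at hsub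
  have hval : ((∫ v in Ioi (0 : ℝ), v ^ (2 * (μ : ℝ) + 1 / N - 1) *
      (1 / (Real.exp v - 1) - if μ = 0 then 1 / v else 0) : ℝ) : ℂ) =
      Complex.Gamma (2 * μ + 1 / N) * riemannZeta (2 * μ + 1 / N) := by
    have hc : (2 * (μ : ℂ) + 1 / N) = ((2 * (μ : ℝ) + 1 / N : ℝ) : ℂ) := by push_cast; rfl
    rw [hc]
    have hi : (0 : ℝ) < 1 / N := by positivity
    have hi1 : (1 : ℝ) / N < 1 := by
      rw [div_lt_one hN0]; exact_mod_cast hN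
    by_cases hμ : μ = 0
    · subst hμ
      simp only [if_true, Nat.cast_zero, mul_zero, zero_add]
      exact integral_rpow_mul_bose_sub_inv hi hi1
    · simp only [if_neg hμ, sub_zero]
      have : (1 : ℝ) ≤ μ := by exact_mod_cast Nat.one_le_iff_ne_zero.mpr hμ
      exact integral_rpow_mul_bose (by linarith)
  rw [eq_div_iff hNC, ← hval, ← hsub]
  push_cast
  ring

lemma riemannSum_lambertIntegrand {N : ℕ} (hN : 1 < N) (μ : ℕ) {δ : ℝ} (hδ : 0 < δ) :
    ((δ * ∑' n : ℕ+, lambertIntegrand N μ (δ * n) : ℝ) : ℂ) =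
      (δ : ℂ) ^ (2 * N * μ + 1) *
        (lambertSum N (-μ) (δ ^ N) - zetaProductSum N (-μ) (δ ^ N)) := by
  have hδN : 0 < δ ^ N := by positivity
  have hδC : (δ : ℂ) ≠ 0 := by exact_mod_cast hδ.ne'
  have hz : ∀ n : ℕ+, (n : ℝ) ^ (-2 * (N : ℤ) * (-(μ : ℤ))) = (n : ℝ) ^ (2 * N * μ) := by
    intro n
    rw [← zpow_natCast]
    congr 1
    push_cast
    ring
  have hL := summable_lambertSum (N := N) (by omega) (-μ) hδN
  by_cases hμ : μ = 0
  · subst hμ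
    have hs := summable_pnat_pow_inv hN
    have : ∀ n : ℕ+, lambertIntegrand N 0 (δ * n) =
        (n : ℝ) ^ (-2 * (N : ℤ) * (-((0 : ℕ) : ℤ))) * (1 / (Real.exp (δ ^ N * (n : ℝ) ^ N) - 1)) -
          (δ ^ N)⁻¹ * ((n : ℝ) ^ N)⁻¹ := by
      intro n
      rw [hz, lambertIntegrand, if_pos rfl, mul_pow]
      simp
      ring_nf
    simp_rw [this]
    rw [Summable.tsum_sub hL (hs.mul_left _), tsum_mul_left]
    have e : (-((0 : ℕ) : ℤ)) = 0 := by simp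
    rw [← lambertSum, e, zetaProductSum_zero, riemannZeta_natCast_eq_tsum_pnat hN]
    push_cast
    rw [mul_zero, zero_add, pow_one]
    ring
  · rw [zetaProductSum_neg N hμ, sub_zero, lambertSum]
    have : ∀ n : ℕ+, lambertIntegrand N μ (δ * n) = δ ^ (2 * N * μ) *
        ((n : ℝ) ^ (-2 * (N : ℤ) * (-(μ : ℤ))) *
          (1 / (Real.exp (δ ^ N * (n : ℝ) ^ N) - 1))) := by
      intro n
      rw [hz, lambertIntegrand, if_neg hμ, mul_pow, mul_pow, sub_zero]
      ring
    simp_rw [this]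
    rw [tsum_mul_left]
    push_cast
    ring

lemma pow_mul_rotatedFactor {N : ℕ} (hN : 0 < N) (μ : ℕ) {δ : ℝ} (hδ : 0 < δ) :
    δ ^ (2 * N * μ + 1) * rotatedFactor N (-μ) (δ ^ N) =
      (-1) ^ μ * (-(2 * (-1) ^ (N / 2) / N)) * (2 * Real.pi) ^ (2 * (μ : ℝ) + 1 / N) := by
  have hpi := Real.pi_pos
  have hNR : (N : ℝ) ≠ 0 := by exact_mod_cast hN.ne'
  have e1 : ((-1 : ℝ)) ^ (-(μ : ℤ)) = (-1) ^ μ := by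
    rw [zpow_neg, zpow_natCast, ← inv_pow]
    norm_num
  have e2 : (2 * (((-μ : ℤ) : ℝ)) - 1 / N) = -(2 * (μ : ℝ) + 1 / N) := by push_cast; ring
  have e3 : (δ ^ N) ^ (2 * (μ : ℝ) + 1 / N) = δ ^ (2 * N * μ + 1) := by
    rw [← Real.rpow_natCast, ← Real.rpow_natCast, ← Real.rpow_mul hδ.le]
    congr 1
    push_cast
    field_simp
  rw [rotatedFactor, e1, e2, Real.rpow_neg (by positivity),
    Real.div_rpow (by positivity) (by positivity), e3]
  field_simp

/-- The functional equation at `s = 2μ + 1/N`: its factor `cos(πs/2) = (-1) ^ μ cos(π/(2N))` cancels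
the cosine in the denominator of `rotationImSum`. -/
lemma rotatedFactor_mul_zeta {N : ℕ} (hN : 1 < N) (hNe : Even N) (μ : ℕ) :
    (((-1) ^ μ * (-(2 * (-1) ^ (N / 2) / N)) * (2 * Real.pi) ^ (2 * (μ : ℝ) + 1 / N) : ℝ) : ℂ) *
      (rotationImSum N / 2 * riemannZeta (2 * ((-μ : ℤ) : ℂ) + 1 - 1 / N)) =
      Complex.Gamma (2 * μ + 1 / N) * riemannZeta (2 * μ + 1 / N) / N := by
  have hpi := Real.pi_pos
  have hN0 : (0 : ℝ) < N := by exact_mod_cast (by omega : 0 < N)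
  have hN1 : (1 : ℝ) < N := by exact_mod_cast hN
  have hi : (0 : ℝ) < 1 / N := by positivity
  have hi1 : (1 : ℝ) / N < 1 := by rwa [div_lt_one hN0]
  have hc : (2 * (μ : ℂ) + 1 / N) = ((2 * (μ : ℝ) + 1 / N : ℝ) : ℂ) := by push_cast; rfl
  have hcos0 : Real.cos (Real.pi / (2 * N)) ≠ 0 := by
    refine (Real.cos_pos_of_mem_Ioo ⟨?_, ?_⟩).ne'
    · have : 0 < Real.pi / (2 * N) := by positivity
      linarith
    · exact div_lt_div_of_pos_left hpi two_pos (by linarith)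
  have hfe := riemannZeta_one_sub (s := 2 * (μ : ℂ) + 1 / N) (fun n h ↦ by
    rw [hc] at h
    have h' : (2 * (μ : ℝ) + 1 / N) = -n := by exact_mod_cast h
    have : (0 : ℝ) ≤ n := n.cast_nonneg
    have : (0 : ℝ) ≤ μ := μ.cast_nonneg
    linarith) (fun h ↦ by
    rw [hc] at h
    have h' : (2 * (μ : ℝ) + 1 / N) = 1 := by exact_mod_cast h
    by_cases hμ : μ = 0
    · subst hμ
      simp at h' hi1
      linarith
    · have : (1 : ℝ) ≤ μ := by exact_mod_cast Nat.one_le_iff_ne_zero.mpr hμ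
      linarith)
  have e1 : 2 * ((-μ : ℤ) : ℂ) + 1 - 1 / N = 1 - (2 * (μ : ℂ) + 1 / N) := by push_cast; ring
  have hcos : Complex.cos (Real.pi * (2 * (μ : ℂ) + 1 / N) / 2) =
      (((-1) ^ μ * Real.cos (Real.pi / (2 * N)) : ℝ) : ℂ) := by
    have : (Real.pi * (2 * (μ : ℂ) + 1 / N) / 2) = ((Real.pi / (2 * N) + μ * Real.pi : ℝ) : ℂ) := by
      push_cast
      field_simp
      ring
    rw [this, ← Complex.ofReal_cos, Real.cos_add_nat_mul_pi]
  have hpw : (2 * (Real.pi : ℂ)) ^ (-(2 * (μ : ℂ) + 1 / N)) *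
      (((2 * Real.pi) ^ (2 * (μ : ℝ) + 1 / N) : ℝ) : ℂ) = 1 := by
    have h2 : (2 * (Real.pi : ℂ)) = ((2 * Real.pi : ℝ) : ℂ) := by push_cast; rfl
    rw [h2, hc, ← Complex.ofReal_neg, ← Complex.ofReal_cpow (by positivity), ← Complex.ofReal_mul,
      ← Real.rpow_add (by positivity), neg_add_cancel, Real.rpow_zero, Complex.ofReal_one]
  have hs1 : ((-1 : ℝ) ^ μ) ^ 2 = 1 := by rw [← pow_mul, mul_comm, pow_mul]; simp
  have hs2 : ((-1 : ℝ) ^ (N / 2)) ^ 2 = 1 := by rw [← pow_mul, mul_comm, pow_mul]; simp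
  have hreal : (-1) ^ μ * (-(2 * (-1) ^ (N / 2) / N)) * (rotationImSum N / 2) *
      (2 * ((-1) ^ μ * Real.cos (Real.pi / (2 * N)))) = (1 : ℝ) / N := by
    rw [rotationImSum_eq (by omega) hNe]
    generalize (-1 : ℝ) ^ μ = s at *
    generalize (-1 : ℝ) ^ (N / 2) = t at *
    field_simp
    rw [hs1, hs2, one_mul]
  have hrC := congrArg (fun x : ℝ ↦ (x : ℂ)) hreal
  rw [e1, hfe, hcos]
  push_cast at hrC hpw ⊢
  linear_combination Complex.Gamma (2 * μ + 1 / N) * riemannZeta (2 * μ + 1 / N) * hrC +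
    Complex.Gamma (2 * μ + 1 / N) * riemannZeta (2 * μ + 1 / N) *
      ((-1) ^ μ * -(2 * (-1) ^ (N / 2) / N) * (rotationImSum N / 2) *
        (2 * ((-1) ^ μ * Complex.cos (Real.pi / (2 * N))))) * hpw

/-- The `ζ(-2Nμ)` term and the rotated series die out. The Riemann sum tends to `Γ(s) ζ(s) / N` with
`s = 2μ + 1/N`, which is the constant contributed by the `ζ(1 - s)` term. -/
lemma tendsto_lambertDefect {N : ℕ} (hN : 0 < N) (hNe : Even N) (μ : ℕ) :
    Tendsto (fun δ : ℝ ↦ (δ : ℂ) ^ (2 * N * μ + 1) * lambertDefect N (-μ) (δ ^ N)) (𝓝[>] 0)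
      (𝓝 0) := by
  have hN1 : 1 < N := by obtain ⟨M, hM⟩ := hNe; omega
  set κ : ℝ := (-1) ^ μ * (-(2 * (-1) ^ (N / 2) / N)) * (2 * Real.pi) ^ (2 * (μ : ℝ) + 1 / N)
    with hκ
  have h1 : Tendsto (fun δ : ℝ ↦ (δ : ℂ) ^ (2 * N * μ + 1) *
      (riemannZeta (2 * N * ((-μ : ℤ) : ℂ)) / 2)) (𝓝[>] 0) (𝓝 0) := by
    refine (Continuous.tendsto' (by fun_prop) _ _ ?_).mono_left nhdsWithin_le_nhds
    simp
  have h2 := (Complex.continuous_ofReal.tendsto _).comp (tendsto_riemannSum_Ioi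
    (continuousOn_lambertIntegrand N μ) fun x hx ↦ abs_lambertIntegrand_le hN1 μ hx)
  rw [integral_lambertIntegrand hN1] at h2
  have hpow : Tendsto (fun δ : ℝ ↦ δ ^ N) (𝓝[>] 0) (𝓝[>] 0) := by
    refine tendsto_nhdsWithin_iff.mpr ⟨?_, eventually_mem_nhdsWithin.mono fun δ hδ ↦
      pow_pos (mem_Ioi.mp hδ) N⟩
    refine (Continuous.tendsto' (by fun_prop) _ _ ?_).mono_left nhdsWithin_le_nhds
    rw [zero_pow hN.ne']
  have h3 := ((Complex.continuous_ofReal.tendsto _).comp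
    ((tendsto_rotatedSum_zero hN (-μ)).comp hpow)).const_mul (κ : ℂ)
  have h := ((h1.add h2).sub h3).sub_const
    (Complex.Gamma (2 * μ + 1 / N) * riemannZeta (2 * μ + 1 / N) / N)
  simp only [Complex.ofReal_zero, mul_zero, sub_zero, zero_add, sub_self] at h
  refine h.congr' ?_
  filter_upwards [eventually_mem_nhdsWithin] with δ hδ
  have hδ0 : (0 : ℝ) < δ := hδ
  have hf := congrArg (fun x : ℝ ↦ (x : ℂ)) (pow_mul_rotatedFactor hN μ hδ0)
  have hz := rotatedFactor_mul_zeta hN1 hNe μ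
  simp only [← hκ] at hf hz
  simp only [Function.comp_apply]
  rw [riemannSum_lambertIntegrand hN1 μ hδ0, lambertDefect]
  simp only [Complex.ofReal_mul, Complex.ofReal_pow] at hf
  linear_combination hz + (rotatedSum N (-μ) (δ ^ N) + rotationImSum N / 2 *
    riemannZeta (2 * ((-μ : ℤ) : ℂ) + 1 - 1 / N)) * hf

/-- The rescaled defect `E` is invariant under multiplication of `δ` by `c = 2 ^ (-1/N) < 1`;
iterating drives `δ` to `0`, where `E` tends to `0`. -/
lemma lambertDefect_eq_zero {N : ℕ} (hN : 0 < N) (hNe : Even N) (μ : ℕ) {A : ℝ} (hA : 0 < A) :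
    lambertDefect N (-μ) A = 0 := by
  set E : ℝ → ℂ := fun δ ↦ (δ : ℂ) ^ (2 * N * μ + 1) * lambertDefect N (-μ) (δ ^ N) with hE
  set c : ℝ := (1 / 2) ^ (1 / N : ℝ) with hc
  have hc0 : 0 < c := by positivity
  have hc1 : c < 1 := Real.rpow_lt_one (by norm_num) (by norm_num) (by positivity)
  have hcN : c ^ N = 1 / 2 := by
    rw [hc, one_div (N : ℝ), Real.rpow_inv_natCast_pow (by norm_num) hN.ne']
  have hc2 : (c : ℂ) * ((2 ^ (1 / N : ℝ) : ℝ) : ℂ) = 1 := by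
    rw [← Complex.ofReal_mul, hc, ← Real.mul_rpow (by norm_num) (by norm_num)]
    norm_num
  have hstep : ∀ δ : ℝ, 0 < δ → E (δ * c) = E δ := by
    intro δ hδ
    have h := lambertDefect_dilate hN hNe (A := (δ * c) ^ N) (by positivity) μ
    have e : 2 * (δ * c) ^ N = δ ^ N := by rw [mul_pow, hcN]; ring
    have eC : 2 * (((δ * c) ^ N : ℝ) : ℂ) = ((δ ^ N : ℝ) : ℂ) := by exact_mod_cast e
    rw [e, eC] at h
    simp only [hE]
    push_cast at h ⊢
    rw [pow_succ, pow_succ, mul_right_comm 2, mul_comm 2 μ, mul_comm _ N, pow_mul, pow_mul]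
    rw [mul_comm 2 μ] at h
    linear_combination δ * c * h + (δ : ℂ) * ((δ : ℂ) ^ N) ^ (μ * 2) * lambertDefect N (-μ) (δ ^ N) * hc2
  have hiter : ∀ δ : ℝ, 0 < δ → ∀ i : ℕ, E (δ * c ^ i) = E δ := by
    intro δ hδ i
    induction i with
    | zero => simp
    | succ i ih => rw [pow_succ, ← mul_assoc, hstep _ (by positivity), ih]
  set δ : ℝ := A ^ (1 / N : ℝ) with hδ
  have hδ0 : 0 < δ := by positivity
  have hδN : δ ^ N = A := by rw [hδ, one_div, Real.rpow_inv_natCast_pow hA.le hN.ne']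
  have ht : Tendsto (fun i : ℕ ↦ δ * c ^ i) atTop (𝓝[>] 0) := by
    refine tendsto_nhdsWithin_iff.mpr ⟨?_, Eventually.of_forall fun i ↦ ?_⟩
    · simpa using (tendsto_pow_atTop_nhds_zero_of_lt_one hc0.le hc1).const_mul δ
    · exact mem_Ioi.mpr (by positivity)
  have hlim := (tendsto_lambertDefect hN hNe μ).comp ht
  have hE0 : E δ = 0 := by
    refine tendsto_nhds_unique ?_ hlim
    refine tendsto_const_nhds.congr fun i ↦ ?_
    exact (hiter δ hδ0 i).symm
  simp only [hE, hδN] at hE0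
  exact (mul_eq_zero.mp hE0).resolve_left (pow_ne_zero _ (by exact_mod_cast hδ0.ne'))

/-- The transformation formula in a form free of `α` and `β`. -/
lemma lambert_identity {N : ℕ} (hN : 0 < N) (hNe : Even N) (m : ℤ) {A : ℝ} (hA : 0 < A) :
    riemannZeta (2 * N * m) / 2 + (lambertSum N m A : ℂ) = zetaProductSum N m A +
      rotatedFactor N m A * (rotatedSum N m A + rotationImSum N / 2 *
        riemannZeta (2 * m + 1 - 1 / N)) := by
  rcases le_or_gt m 0 with h | h
  · obtain ⟨μ, hμ⟩ := Int.exists_eq_neg_ofNat h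
    have h0 := lambertDefect_eq_zero hN hNe μ hA
    rw [← hμ, lambertDefect] at h0
    linear_combination h0
  · obtain ⟨k, hk⟩ := Int.eq_ofNat_of_zero_le h.le
    have hk0 : k ≠ 0 := by omega
    have h0 := lambert_identity_of_pos hN hNe hk0 hA
    rw [hk]
    push_cast at h0 ⊢
    exact h0

/-! ### Return to `α` and `β`. -/

lemma rotatedLambertTerm_eq (N : ℕ) (m : ℤ) (β : ℝ) (j : ℕ) (n : ℕ+) :
    rotatedLambertTerm N m β j n = (n : ℝ) ^ (-(2 * (m : ℝ) + 1 - 1 / N)) *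
      (unitRotation N j * bose (((2 * (n : ℝ)) ^ (1 / N : ℝ) * β : ℝ) * unitRotation N j)).im := by
  rw [rotatedLambertTerm, bose, Real.rpow_neg (by positivity : (0 : ℝ) ≤ n),
    one_div (_ ^ _), mul_one_div]
  push_cast
  rfl

lemma summable_rotatedLambertTerm {N j : ℕ} (hj : j < N / 2) (m : ℤ) {β : ℝ} (hβ : 0 < β) :
    Summable (rotatedLambertTerm N m β j) := by
  have hN : 0 < N := by omega
  have hre := unitRotation_re_pos hj
  obtain ⟨q, hq⟩ := exists_nat_gt (max (-2 * (m : ℝ) + 1 / N) 0)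
  have hq1 : -2 * (m : ℝ) + 1 / N < q := lt_of_le_of_lt (le_max_left _ _) hq
  have hq0 : q ≠ 0 := by
    rintro rfl
    simp at hq
  have hs := summable_pnat_rpow_neg (s := q + (2 * m + 1 - 1 / N)) (by linarith)
  refine Summable.of_norm_bounded (hs.mul_left
    ((N * q).factorial / (2 ^ q * (β * (unitRotation N j).re) ^ (N * q)))) fun n ↦ ?_
  have hn : (0 : ℝ) < n := by exact_mod_cast n.pos
  have hz : ((((2 * (n : ℝ)) ^ (1 / N : ℝ) * β : ℝ) : ℂ) * unitRotation N j).re =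
      (2 * (n : ℝ)) ^ (1 / N : ℝ) * (β * (unitRotation N j).re) := by
    rw [Complex.re_ofReal_mul, mul_assoc]
  have hb := norm_bose_le (p := N * q) (by rw [hz]; positivity) (Nat.mul_ne_zero hN.ne' hq0)
  rw [hz, mul_pow, pow_mul, one_div, Real.rpow_inv_natCast_pow (by positivity) hN.ne'] at hb
  have him : |(unitRotation N j *
      bose (((2 * (n : ℝ)) ^ (N : ℝ)⁻¹ * β : ℝ) * unitRotation N j)).im| ≤
      (N * q).factorial / ((2 * n) ^ q * (β * (unitRotation N j).re) ^ (N * q)) := by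
    refine (Complex.abs_im_le_norm _).trans ?_
    rw [norm_mul, norm_unitRotation, one_mul]
    exact hb
  rw [rotatedLambertTerm_eq, norm_mul, Real.norm_of_nonneg (by positivity), Real.norm_eq_abs,
    one_div]
  refine (mul_le_mul_of_nonneg_left him (by positivity)).trans (le_of_eq ?_)
  rw [neg_add, Real.rpow_add hn, Real.rpow_neg hn.le q, Real.rpow_natCast, mul_pow]
  field_simp

lemma two_mul_pow_mul_eq (N : ℕ) (α x : ℝ) : (2 * x) ^ N * α = 2 ^ N * α * x ^ N := by ring

lemma lambertTerm_eq (N : ℕ) (m : ℤ) (α : ℝ) :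
    lambertTerm N m α = fun n : ℕ+ ↦
      (n : ℝ) ^ (-2 * (N : ℤ) * m) * (1 / (Real.exp (2 ^ N * α * (n : ℝ) ^ N) - 1)) := by
  funext n
  rw [lambertTerm, mul_one_div, two_mul_pow_mul_eq]

/-- After taking `N`-th powers this is the relation `α β ^ N = π ^ (N+1)`. -/
lemma two_pi_mul_rpow_eq {N : ℕ} (hN : 0 < N) {α β x : ℝ} (hα : 0 < α) (hβ : 0 < β)
    (hαβ : α * β ^ N = Real.pi ^ (N + 1)) (hx : 0 < x) :
    2 * Real.pi * (2 * Real.pi / (2 ^ N * α) * x) ^ (1 / N : ℝ) = (2 * x) ^ (1 / N : ℝ) * β := by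
  have hpi := Real.pi_pos
  refine (pow_left_inj₀ (by positivity) (by positivity) hN.ne').mp ?_
  rw [mul_pow, mul_pow, mul_pow, one_div, Real.rpow_inv_natCast_pow (by positivity) hN.ne',
    Real.rpow_inv_natCast_pow (by positivity) hN.ne']
  field_simp
  rw [pow_succ] at hαβ
  linear_combination -hαβ

lemma sum_tsum_rotatedLambertTerm {N : ℕ} (hN : 0 < N) (m : ℤ) {α β : ℝ} (hα : 0 < α)
    (hβ : 0 < β) (hαβ : α * β ^ N = Real.pi ^ (N + 1)) :
    ∑ j ∈ Finset.range (N / 2), (-1) ^ j * ∑' n : ℕ+, rotatedLambertTerm N m β j n =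
      rotatedSum N m (2 ^ N * α) := by
  simp_rw [← tsum_mul_left]
  rw [← Summable.tsum_finsetSum fun j hj ↦
    (summable_rotatedLambertTerm (Finset.mem_range.mp hj) m hβ).mul_left _, rotatedSum]
  congr 1
  funext n
  have hn : (0 : ℝ) < n := by exact_mod_cast n.pos
  rw [rotatedBoseSum, Finset.mul_sum]
  refine Finset.sum_congr rfl fun j _ ↦ ?_
  rw [rotatedLambertTerm_eq, ← two_pi_mul_rpow_eq hN hα hβ hαβ hn]
  push_cast
  ring

lemma pi_rpow_eq {N : ℕ} {α β : ℝ} (hα : 0 < α) (hβ : 0 < β)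
    (hαβ : α * β ^ N = Real.pi ^ (N + 1)) (u : ℝ) :
    Real.pi ^ u = α ^ (u / (N + 1)) * β ^ (N * u / (N + 1)) := by
  have hN : (0 : ℝ) < N + 1 := by positivity
  have h := congrArg (fun x : ℝ ↦ x ^ (u / (N + 1))) hαβ
  rw [Real.mul_rpow hα.le (by positivity), ← Real.rpow_natCast, ← Real.rpow_natCast,
    ← Real.rpow_mul hβ.le, ← Real.rpow_mul Real.pi_pos.le] at h
  have e1 : ((N + 1 : ℕ) : ℝ) * (u / (N + 1)) = u := by push_cast; field_simp
  rw [e1, ← mul_div_assoc] at h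
  exact h.symm

lemma rpow_mul_div_rpow_eq {N : ℕ} (hN : 0 < N) (m : ℤ) {α β : ℝ} (hα : 0 < α)
    (hβ : 0 < β) (hαβ : α * β ^ N = Real.pi ^ (N + 1)) :
    α ^ (-((2 * (N : ℝ) * m - 1) / (N + 1))) *
      (2 ^ N * α / (2 * Real.pi)) ^ (2 * (m : ℝ) - 1 / N) =
    β ^ (-((2 * (N : ℝ) * m - 1) / (N + 1))) * 2 ^ (((N : ℝ) - 1) * (2 * (m : ℝ) - 1 / N)) := by
  have hpi := Real.pi_pos
  have hN0 : (N : ℝ) ≠ 0 := by exact_mod_cast hN.ne'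
  have hN1 : (N : ℝ) + 1 ≠ 0 := by positivity
  have e1 : 2 ^ N * α / (2 * Real.pi) = 2 ^ ((N : ℝ) - 1) * (α / Real.pi) := by
    rw [Real.rpow_sub two_pos, Real.rpow_natCast, Real.rpow_one]
    field_simp
  rw [e1, Real.mul_rpow (by positivity) (by positivity), ← Real.rpow_mul two_pos.le,
    Real.div_rpow hα.le hpi.le, pi_rpow_eq hα hβ hαβ]
  have e2 : α ^ (-((2 * (N : ℝ) * m - 1) / (N + 1))) * α ^ (2 * (m : ℝ) - 1 / N) =
      α ^ ((2 * (m : ℝ) - 1 / N) / (N + 1)) := by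
    rw [← Real.rpow_add hα]
    congr 1
    field_simp
    ring
  have e3 : β ^ (-((2 * (N : ℝ) * m - 1) / (N + 1))) =
      (β ^ ((N : ℝ) * (2 * (m : ℝ) - 1 / N) / (N + 1)))⁻¹ := by
    rw [← Real.rpow_neg hβ.le]
    congr 1
    field_simp
  have e4 : ∀ a b X Y t : ℝ, X ≠ 0 → a * b = X → a * (t * (b / (X * Y))) = Y⁻¹ * t := by
    intro a b X Y t hX h
    field_simp
    linear_combination t / Y * h
  rw [e3]
  exact e4 _ _ _ _ _ (by positivity) e2

lemma rotatedFactor_mul_eq {N : ℕ} (hN : 0 < N) (hNe : Even N) (m : ℤ) {α β : ℝ} (hα : 0 < α)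
    (hβ : 0 < β) (hαβ : α * β ^ N = Real.pi ^ (N + 1)) (R z : ℂ) :
    ((α ^ (-((2 * (N : ℝ) * m - 1) / (N + 1))) : ℝ) : ℂ) * (rotatedFactor N m (2 ^ N * α) *
      (R + rotationImSum N / 2 * z)) =
    ((β ^ (-((2 * (N : ℝ) * m - 1) / (N + 1))) : ℝ) : ℂ) * ((-1 : ℂ) ^ m / N) *
      ((2 ^ (((N : ℝ) - 1) * (2 * (m : ℝ) - 1 / N)) : ℝ) : ℂ) *
      (z / ((2 * Real.cos (Real.pi / (2 * N)) : ℝ) : ℂ) - 2 * (-1) ^ (N / 2) * R) := by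
  have h := congrArg (fun x : ℝ ↦ (x : ℂ)) (rpow_mul_div_rpow_eq hN m hα hβ hαβ)
  rw [Complex.ofReal_mul, Complex.ofReal_mul] at h
  have hΛ := congrArg (fun x : ℝ ↦ (x : ℂ)) (rotationImSum_eq hN hNe)
  simp only [Complex.ofReal_div, Complex.ofReal_neg, Complex.ofReal_pow, Complex.ofReal_one] at hΛ
  have hs2 : ((-1 : ℂ) ^ (N / 2)) ^ 2 = 1 := by rw [← pow_mul, mul_comm, pow_mul]; simp
  have hF : ((rotatedFactor N m (2 ^ N * α) : ℝ) : ℂ) = (-1) ^ m * (-(2 * (-1) ^ (N / 2) / N)) *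
      (((2 ^ N * α / (2 * Real.pi)) ^ (2 * (m : ℝ) - 1 / N) : ℝ) : ℂ) := by
    rw [rotatedFactor]
    push_cast
    rfl
  rw [hF, hΛ]
  linear_combination ((-1) ^ m / N) *
    (z / ((2 * Real.cos (Real.pi / (2 * N)) : ℝ) : ℂ) - 2 * (-1) ^ (N / 2) * R) * h + ((α ^ (-((2 * (N : ℝ) * m - 1) / (N + 1))) : ℝ) : ℂ) *
    (((2 ^ N * α / (2 * Real.pi)) ^ (2 * (m : ℝ) - 1 / N) : ℝ) : ℂ) * ((-1) ^ m / N) *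
    (z / ((2 * Real.cos (Real.pi / (2 * N)) : ℝ) : ℂ)) * hs2

/-- Euler's formula; as `p` is odd, its sign depends on `N` alone and can leave the sum over `j`. -/
lemma riemannZeta_mul_even {N : ℕ} (hNe : Even N) {p : ℕ} (hp : Odd p) :
    riemannZeta ((p * N : ℕ) : ℂ) = (-1) ^ (N / 2 + 1) * (2 : ℂ) ^ ((p * N : ℕ) - 1 : ℤ) *
      (Real.pi : ℂ) ^ (p * N) * (bernoulli (p * N) : ℂ) / (p * N).factorial := by
  obtain ⟨M, rfl⟩ := hNe
  have e : p * (M + M) = 2 * (p * M) := by ring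
  have e2 : (M + M) / 2 = M := by omega
  have e3 : ((-1 : ℂ)) ^ (p * M + 1) = (-1) ^ (M + 1) := by
    rw [pow_succ, pow_succ, pow_mul, hp.neg_one_pow]
  have h := riemannZeta_two_mul_nat' (k := p * M)
  rw [e3] at h
  rw [e, e2]
  push_cast at h ⊢
  exact h

lemma rpow_mul_pi_pow_eq {N : ℕ} (m : ℤ) (j : ℕ) {p : ℕ} (hp : (p : ℤ) = 2 * m + 1 - 2 * j)
    {α β : ℝ} (hα : 0 < α) (hβ : 0 < β) (hαβ : α * β ^ N = Real.pi ^ (N + 1)) :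
    α ^ (-((2 * (N : ℝ) * m - 1) / (N + 1))) * α ^ (2 * (j : ℤ) - 1) * Real.pi ^ (p * N) =
      α ^ (2 * (j : ℝ) / (N + 1)) *
        β ^ ((N : ℝ) + (2 * (N : ℝ) ^ 2 * (m - j) - N) / (N + 1)) := by
  have hN1 : (N : ℝ) + 1 ≠ 0 := by positivity
  have hpR : (p : ℝ) = 2 * m + 1 - 2 * j := by exact_mod_cast hp
  rw [← Real.rpow_natCast, pi_rpow_eq hα hβ hαβ, ← Real.rpow_intCast, ← Real.rpow_add hα,
    ← mul_assoc, ← Real.rpow_add hα]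
  congr 2
  · push_cast
    rw [hpR]
    field_simp
    ring
  · push_cast
    rw [hpR]
    field_simp
    ring

lemma zetaProductSum_eq {N : ℕ} (hNe : Even N) (m : ℤ) {α β : ℝ} (hα : 0 < α)
    (hβ : 0 < β) (hαβ : α * β ^ N = Real.pi ^ (N + 1)) :
    ((α ^ (-((2 * (N : ℝ) * m - 1) / (N + 1))) : ℝ) : ℂ) * zetaProductSum N m (2 ^ N * α) =
      (-1 : ℂ) ^ (N / 2 + 1) * (2 : ℂ) ^ (2 * (N : ℤ) * m - 1) * (bernoulliSum N m α β : ℝ) := by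
  have hpi := Real.pi_pos
  have hpiC : (Real.pi : ℂ) ≠ 0 := by exact_mod_cast hpi.ne'
  rw [zetaProductSum, bernoulliSum, Complex.ofReal_sum, Finset.mul_sum, Finset.mul_sum]
  refine Finset.sum_congr rfl fun j hj ↦ ?_
  have hjm : (j : ℤ) ≤ m := by
    have := Finset.mem_range.mp hj
    omega
  obtain ⟨p, hp⟩ := Int.eq_ofNat_of_zero_le (show 0 ≤ 2 * m + 1 - 2 * (j : ℤ) by omega)
  have hpodd : Odd p := by
    rw [← Int.odd_coe_nat, Int.odd_iff]
    omega
  have ht : ((2 * m + 1 - 2 * (j : ℤ)) * (N : ℤ)).toNat = p * N := by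
    rw [hp]
    exact_mod_cast Int.toNat_natCast (p * N)
  have hpow := congrArg (fun x : ℝ ↦ (x : ℂ)) (rpow_mul_pi_pow_eq m j hp.symm hα hβ hαβ)
  simp only [Complex.ofReal_mul, Complex.ofReal_pow, Complex.ofReal_zpow] at hpow
  -- One sign comes from `zetaProductSum`, the other from Euler's formula for `ζ(2j)`.
  have hsj : ((-1 : ℂ) ^ (j + 1)) * (-1) ^ (j + 1) = 1 := by rw [← mul_pow]; simp
  have h2 : (2 ^ N : ℂ) ^ (2 * (j : ℤ) - 1) * 2 * (2 : ℂ) ^ (-2 * (j : ℤ)) *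
      (2 : ℂ) ^ (2 * (j : ℤ) - 1) * (2 : ℂ) ^ ((p * N : ℕ) - 1 : ℤ) =
      (2 : ℂ) ^ (2 * (N : ℤ) * m - 1) := by
    have h20 : (2 : ℂ) ≠ 0 := two_ne_zero
    nth_rw 2 [← zpow_one (2 : ℂ)]
    rw [← zpow_natCast, ← zpow_mul, ← zpow_add₀ h20, ← zpow_add₀ h20, ← zpow_add₀ h20,
      ← zpow_add₀ h20]
    congr 1
    push_cast
    linear_combination (-(N : ℤ)) * hp
  have hpi2 : (Real.pi : ℂ) ^ (-2 * (j : ℤ)) * (Real.pi : ℂ) ^ (2 * j) = 1 := by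
    rw [← zpow_natCast, ← zpow_add₀ hpiC]
    simp
  rw [ht, riemannZeta_mul_even hNe hpodd, riemannZeta_two_mul_nat']
  push_cast
  rw [mul_zpow, mul_zpow, ← h2]
  generalize (bernoulli (2 * j) : ℂ) = b₁
  generalize (bernoulli (p * N) : ℂ) = b₂
  generalize (-1 : ℂ) ^ (j + 1) = s at *
  generalize (2 ^ N : ℂ) ^ (2 * (j : ℤ) - 1) = t₁
  generalize (2 : ℂ) ^ (-2 * (j : ℤ)) = t₂
  generalize (2 : ℂ) ^ (2 * (j : ℤ) - 1) = t₃
  rw [Nat.cast_mul p N]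
  generalize (2 : ℂ) ^ ((p : ℤ) * (N : ℤ) - 1) = t₄
  generalize (Real.pi : ℂ) ^ (-2 * (j : ℤ)) = q₁ at *
  generalize (Real.pi : ℂ) ^ (2 * j) = q₂ at *
  generalize (Real.pi : ℂ) ^ (p * N) = q₃ at *
  generalize (α : ℂ) ^ (2 * (j : ℤ) - 1) = a at *
  generalize (-1 : ℂ) ^ (N / 2 + 1) = u
  generalize ((2 * j).factorial : ℂ) = f₁
  generalize ((p * N).factorial : ℂ) = f₂
  linear_combination (t₁ * 2 * t₂ * t₃ * t₄ * u * b₁ * b₂ / (f₁ * f₂)) *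
    (hpow + ((α ^ (-((2 * (N : ℝ) * m - 1) / (N + 1))) : ℝ) : ℂ) * a * q₃ *
      (hsj + s * s * hpi2))

end

theorem mainTheorem3 (N : ℕ) (hN : 0 < N) (hNeven : Even N) (m : ℤ) (α β : ℝ)
    (hα : 0 < α) (hβ : 0 < β) (hαβ : α * β ^ N = Real.pi ^ (N + 1)) :
    Summable (lambertTerm N m α) ∧
    (∀ j ∈ Finset.range (N / 2), Summable (rotatedLambertTerm N m β j)) ∧
    ((α ^ (-((2 * (N : ℝ) * (m : ℝ) - 1) / ((N : ℝ) + 1))) : ℝ) : ℂ) *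
        (1 / 2 * riemannZeta (2 * (N : ℂ) * (m : ℂ)) +
          ((∑' n : ℕ+, lambertTerm N m α n : ℝ) : ℂ)) =
      ((β ^ (-((2 * (N : ℝ) * (m : ℝ) - 1) / ((N : ℝ) + 1))) : ℝ) : ℂ) *
          ((-1 : ℂ) ^ m / (N : ℂ)) *
          (((2 : ℝ) ^ (((N : ℝ) - 1) * (2 * (m : ℝ) - 1 / (N : ℝ))) : ℝ) : ℂ) *
          (riemannZeta (2 * (m : ℂ) + 1 - 1 / (N : ℂ)) /
              ((2 * Real.cos (Real.pi / (2 * (N : ℝ))) : ℝ) : ℂ) -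
            2 * (-1 : ℂ) ^ (N / 2) *
              ∑ j ∈ Finset.range (N / 2),
                (-1 : ℂ) ^ j * ((∑' n : ℕ+, rotatedLambertTerm N m β j n : ℝ) : ℂ)) +
        (-1 : ℂ) ^ (N / 2 + 1) * (2 : ℂ) ^ (2 * (N : ℤ) * m - 1) *
          ((bernoulliSum N m α β : ℝ) : ℂ) := by
  have hA : 0 < 2 ^ N * α := by positivity
  refine ⟨?_, fun j hj ↦ summable_rotatedLambertTerm (Finset.mem_range.mp hj) m hβ, ?_⟩
  · rw [lambertTerm_eq]
    exact summable_lambertSum hN m hA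
  have hL : ∑' n : ℕ+, lambertTerm N m α n = lambertSum N m (2 ^ N * α) := by
    rw [lambertTerm_eq, lambertSum]
  have hR : ∑ j ∈ Finset.range (N / 2),
      (-1 : ℂ) ^ j * ((∑' n : ℕ+, rotatedLambertTerm N m β j n : ℝ) : ℂ) =
      (rotatedSum N m (2 ^ N * α) : ℝ) := by
    rw [← sum_tsum_rotatedLambertTerm hN m hα hβ hαβ, Complex.ofReal_sum]
    refine Finset.sum_congr rfl fun j _ ↦ ?_
    rw [Complex.ofReal_mul]
    simp
  rw [hL, hR, ← rotatedFactor_mul_eq hN hNeven m hα hβ hαβ,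
    ← zetaProductSum_eq hNeven m hα hβ hαβ, one_div_mul_eq_div,
    lambert_identity hN hNeven m hA]
  ring
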